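/- **Setting.** Let $D\ge 1$ and let $\hat H=\sum_n\lambda_n|\lambda_n\rangle\langle\lambda_n|$ be a Hamiltonian on a finite-dimensional space, $|\lambda_{n_0}\rangle$ one of the eigenvectors in this (orthonormal) eigenbasis, and $\hat V^{(0)},\dots,\hat V^{(D)}$ operators, each given as a linear combination of unitaries whose coefficients have 1-norm $|\hat V^{(j)}|_1>0$. Put $\Omega=\prod_{j=0}^D|\hat V^{(j)}|_1$ and $V^{(j)}_{mn}=\langle\lambda_m|\hat V^{(j)}|\lambda_n\rangle$. Oracles are $e^{i\hat H}$, a unitary $\hat U_{\lambda}$ with $\hat U_{\lambda}|0\rangle=|\lambda_{n_0}\rangle$, and unitaries $\hat U_{V^{(j)}}$ that block-encode $\hat V^{(j)}/|\hat V^{(j)}|_1$; a query is one, possibly controlled, use of an oracle or of its inverse. Every circuit is a finite list of oracle-independent unitaries and queries, applied to a basis state and followed by a measurement in the computational basis; running a circuit once is a sample, and the next circuit may depend on earlier outcomes. The algorithm may depend on the spaces, the numbers $|\hat V^{(j)}|_1$, and the window and parameters below, but on $\hat H$, $|\lambda_{n_0}\rangle$, $\hat V^{(j)}$ only through queries. Worst-case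 numbers of queries are counted, and estimates have to be correct with probability at least $2/3$. A window of length $N$ is a vector $\alpha\in\mathbb C^N$ with $\sum_k|\alpha_k|^2=1$, with window function $\mathcal L(x)=N^{-1/2}\sum_{k=0}^{N-1}\alpha_ke^{ikx}$. The windowed multivariate correlation function is $$R(\vec\omega)=\sum_{n_1,\dots,n_D}V^{(D)}_{n_Dn_0}\prod_{j=1}^{D}V^{(j-1)}_{n_{j-1}n_j}\,\mathcal L\bigl(\lambda_{n_{j-1}}-\lambda_{n_j}-\omega_{D-j+1}\bigr),\qquad\vec\omega\in\mathbb R^D .$$ Let $\eta,\epsilon\in(0,1)$. The window resolves $\eta$ with failure weight $\delta$ if for every $x\in\mathbb R$ the numbers $|\mathcal L(x-2\pi k/N)|^2$, summed over those $k\in\{0,\dots,N-1\}$ for which $2\pi k/N$ is within $\eta$ of $x$ modulo $2\pi$, add up to at least $1-\delta$. **Theorem 1 (Complexity).** (0) There is an absolute constant $K$ such that for all $D\ge1$ and $\eta,\epsilon\in(0,1)$ there is a window whose length $N$ is a power of two with $N\le K\log(2D/\epsilon)/\eta$ that resolves $\eta$ with failure weight $\epsilon/D$. Moreover, for every $K>0$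 there is a constant $C$, depending only on $K$, such that for all $D\ge1$, $\eta,\epsilon\in(0,1)$ and every window of length $N\le K\log(2D/\epsilon)/\eta$ the following hold. (1) At a single point: for every $\vec\omega\in\mathbb R^D$, $R(\vec\omega)$ can be estimated up to error $\epsilon$ with at most $C$ samples and in total at most $C\,\frac{D\,\Omega}{\eta\,\epsilon}\log\frac{2D}{\epsilon}$ queries to $e^{\pm i\hat H}$ and at most $C\,\Omega/\epsilon$ queries to $\hat U_\lambda$ and to each $\hat U_{V^{(j)}}$. (2) At all points $\vec\omega_{\vec k}=2\pi\vec k/N$, $\vec k\in\{0,\dots,N-1\}^D$, simultaneously: there is a circuit with at most $C\,\frac D\eta\log\frac{2D}\epsilon$ queries to $e^{\pm i\hat H}$ and at most $C$ queries to $\hat U_\lambda$ and to each $\hat U_{V^{(j)}}$, whose final state has amplitude $R(\vec\omega_{\vec k})/\Omega$ on a basis state $|\vec k,0\rangle$ for every $\vec k$ (distinct basis states for distinct $\vec k$), such that at most $C\,\Omega^4/\epsilon^4$ independent samples of this circuit give estimates of $|R(\vec\omega_{\vec k})|$ that are up to error $\epsilon$ correct for all $\vec k$ at once. The complex values $R(\vec\omega_{\vec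 k})$ can also be estimated, up to error $\epsilon$ for all $\vec k$ at once, with at most $C\,\Omega^4/\epsilon^4$ samples of circuits that each obey the same query bounds, hence in total with at most $C\,\frac{D\,\Omega^4}{\eta\,\epsilon^4}\log\frac{2D}\epsilon$ queries to $e^{\pm i\hat H}$ and at most $C\,\Omega^4/\epsilon^4$ queries to $\hat U_\lambda$ and to each $\hat U_{V^{(j)}}$. -/

import Mathlib

open scoped BigOperators

noncomputable section

namespace GQPE

/-! ### Query circuits and adaptive sampling protocols

An oracle family is a family of matrices `O i : Matrix (X i) (X i) ℂ` (unitary in all uses below),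
where `X i` indexes the computational basis of the space on which the oracle `i` acts. -/

/-- A gate on a memory with computational basis `M`: either a fixed unitary, or one query to the
oracle `i` or (if `inv`) to its inverse, applied to a register of the memory (`e` splits the memory
into that register and the rest) and controlled by the basis state of the rest. -/
inductive Gate {ι : Type} (X : ι → Type) (M : Type) [Fintype M] [DecidableEq M] : Type 1
  | free (U : Matrix.unitaryGroup M ℂ) : Gate X M
  | query (i : ι) (inv : Bool) (R : Type) (e : M ≃ X i × R) (ctrl : R → Bool) : Gate X M

section
variable {ι : Type} {X : ι → Type}

open Classical in
/-- The matrix of a gate. -/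
def Gate.mat {M : Type} [Fintype M] [DecidableEq M] (O : ∀ i, Matrix (X i) (X i) ℂ) :
    Gate X M → Matrix M M ℂ
  | .free U => (U : Matrix M M ℂ)
  | .query i inv _ e ctrl =>
      (Matrix.blockDiagonal fun r =>
        if ctrl r then (if inv then (O i).conjTranspose else O i) else 1).submatrix e e

open Classical in
/-- The number of queries that a gate makes to the oracle `i`. -/
def Gate.queries {M : Type} [Fintype M] [DecidableEq M] (i : ι) : Gate X M → ℕ
  | .free _ => 0
  | .query i' _ _ _ _ => if i' = i then 1 else 0

end

/-- A query circuit: a finite memory, an initial basis state, and a list of gates, which are applied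
from left to right; at the end the memory is measured in the computational basis. -/
structure Circuit {ι : Type} (X : ι → Type) : Type 1 where
  M : Type
  [fin : Fintype M]
  [dec : DecidableEq M]
  init : M
  gates : List (Gate X M)

attribute [instance] Circuit.fin Circuit.dec

section
variable {ι : Type} {X : ι → Type}

/-- The final state of a circuit before the measurement. -/
def Circuit.state (c : Circuit X) (O : ∀ i, Matrix (X i) (X i) ℂ) : c.M → ℂ :=
  c.gates.foldl (fun ψ g => (g.mat O).mulVec ψ) (Pi.single c.init 1)

/-- The probability of the measurement outcome `m`. -/
def Circuit.prob (c : Circuit X) (O : ∀ i, Matrix (X i) (X i) ℂ) (m : c.M) : ℝ :=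
  ‖c.state O m‖ ^ 2

/-- The number of queries that a circuit makes to the oracle `i`. -/
def Circuit.queries (c : Circuit X) (i : ι) : ℕ :=
  (c.gates.map (Gate.queries i)).sum

end

/-- An estimation protocol with values in `Out`: circuits are run and measured one after the other,
each circuit may depend on the previous measurement outcomes, and so does the final output. -/
inductive Protocol {ι : Type} (X : ι → Type) (Out : Type) : Type 1
  | done (o : Out) : Protocol X Out
  | run (c : Circuit X) (next : c.M → Protocol X Out) : Protocol X Out

namespace Protocol
variable {ι : Type} {X : ι → Type} {Out : Type}

open Classical in
/-- The probability that the output satisfies `P`. -/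
def prob (O : ∀ i, Matrix (X i) (X i) ℂ) (P : Out → Prop) : Protocol X Out → ℝ
  | .done o => if P o then 1 else 0
  | .run c next => ∑ m : c.M, c.prob O m * (next m).prob O P

/-- The number of samples, i.e. of circuit runs, in the worst case over the outcomes. -/
def samples : Protocol X Out → ℕ
  | .done _ => 0
  | .run c next => 1 + Finset.univ.sup fun m : c.M => (next m).samples

/-- The largest number of queries to the oracle `i` that a single circuit makes. -/
def circuitQueries (i : ι) : Protocol X Out → ℕ
  | .done _ => 0
  | .run c next => max (c.queries i) (Finset.univ.sup fun m : c.M => (next m).circuitQueries i)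

/-- The total number of queries to the oracle `i`, in the worst case over the outcomes. -/
def totalQueries (i : ι) : Protocol X Out → ℕ
  | .done _ => 0
  | .run c next => c.queries i + Finset.univ.sup fun m : c.M => (next m).totalQueries i

/-- Run one and the same circuit `n` times independently and output a function of the outcomes. -/
def iid (c : Circuit X) : (n : ℕ) → ((Fin n → c.M) → Out) → Protocol X Out
  | 0, f => .done (f Fin.elim0)
  | n + 1, f => .run c fun m => iid c n fun s => f (Fin.cons m s)

end Protocol

/-! ### Window functions -/

/-- The window function `𝓛(x) = N^{-1/2} ∑_{k<N} α_k e^{ikx}`. -/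
def window {N : ℕ} (α : Fin N → ℂ) (x : ℝ) : ℂ :=
  ((Real.sqrt N : ℝ) : ℂ)⁻¹ * ∑ k : Fin N, α k * Complex.exp (Complex.I * (k.val : ℂ) * (x : ℂ))

/-- The coefficient vector of a window is normalized. -/
def IsWindow {N : ℕ} (α : Fin N → ℂ) : Prop := ∑ k, ‖α k‖ ^ 2 = 1

open Classical in
/-- Resolution `η` with failure weight `δ`: wherever the true frequency `x` lies, the frequency
distribution `k ↦ |𝓛(x - 2πk/N)|²` on the grid `{2πk/N}` (whose total weight is `1`) puts weight at
least `1 - δ` on the grid points within `η` of `x`, modulo `2π`. -/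
def Resolves {N : ℕ} (α : Fin N → ℂ) (η δ : ℝ) : Prop :=
  ∀ x : ℝ, 1 - δ ≤ ∑ k ∈ Finset.univ.filter (fun k : Fin N =>
      ∃ m : ℤ, |x - 2 * Real.pi * (k.val : ℝ) / (N : ℝ) - 2 * Real.pi * (m : ℝ)| ≤ η),
    ‖window α (x - 2 * Real.pi * (k.val : ℝ) / (N : ℝ))‖ ^ 2

/-- The point `2πk/N` of the frequency grid. -/
def gridPoint {D : ℕ} (N : ℕ) (k : Fin D → Fin N) : Fin D → ℝ :=
  fun j => 2 * Real.pi * ((k j).val : ℝ) / (N : ℝ)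

/-! ### The physical system and its correlation function -/

/-- `V` is a linear combination of unitaries whose coefficients have 1-norm `ν`. -/
def HasLCU {S : Type} [Fintype S] [DecidableEq S] (V : Matrix S S ℂ) (ν : ℝ) : Prop :=
  ∃ (l : ℕ) (c : Fin l → ℂ) (W : Fin l → Matrix.unitaryGroup S ℂ),
    V = ∑ i, c i • (W i : Matrix S S ℂ) ∧ ν = ∑ i, ‖c i‖

/-- A system with space `ℂ^S` and reference state `|s0⟩`: a Hamiltonian `H = ∑ₙ λₙ |λₙ⟩⟨λₙ|`, an
initial eigenstate `|λ_{n0}⟩` with a unitary preparing it from `|s0⟩`, operators `V⁽⁰⁾, …, V⁽ᴰ⁾`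
that are linear combinations of unitaries with 1-norms `ν j`, and block-encodings of `V⁽ʲ⁾ / ν j`
on `ℂ^{A j} ⊗ ℂ^S` with reference ancilla state `|a0 j⟩`. -/
structure System (D : ℕ) (S : Type) [Fintype S] [DecidableEq S] (s0 : S)
    (A : Fin (D + 1) → Type) [∀ j, Fintype (A j)] [∀ j, DecidableEq (A j)] (a0 : ∀ j, A j)
    (ν : Fin (D + 1) → ℝ) where
  H : Matrix S S ℂ
  /-- the eigenvalues -/
  energy : S → ℝ
  /-- the columns are the eigenvectors -/
  eigvec : Matrix.unitaryGroup S ℂ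
  spectral : H = (eigvec : Matrix S S ℂ) * Matrix.diagonal (fun n => (energy n : ℂ)) *
    (eigvec : Matrix S S ℂ).conjTranspose
  /-- the label of the initial eigenstate -/
  n0 : S
  prep : Matrix.unitaryGroup S ℂ
  prep_spec : ∀ x, (prep : Matrix S S ℂ) x s0 = (eigvec : Matrix S S ℂ) x n0
  V : Fin (D + 1) → Matrix S S ℂ
  lcu : ∀ j, HasLCU (V j) (ν j)
  block : ∀ j, Matrix.unitaryGroup (A j × S) ℂ
  block_spec : ∀ j x y,
    (block j : Matrix (A j × S) (A j × S) ℂ) (a0 j, x) (a0 j, y) = V j x y / (ν j : ℂ)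

/-- The names of the oracles: time evolution, state preparation, block-encodings. -/
inductive Oracle (D : ℕ) : Type
  | evo : Oracle D
  | prep : Oracle D
  | block (j : Fin (D + 1)) : Oracle D

/-- The registers on which the oracles act. -/
def Reg {D : ℕ} (S : Type) (A : Fin (D + 1) → Type) : Oracle D → Type
  | .evo => S
  | .prep => S
  | .block j => A j × S

namespace System
variable {D : ℕ} {S : Type} [Fintype S] [DecidableEq S] {s0 : S}
  {A : Fin (D + 1) → Type} [∀ j, Fintype (A j)] [∀ j, DecidableEq (A j)] {a0 : ∀ j, A j}
  {ν : Fin (D + 1) → ℝ}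

/-- The oracles `e^{iH}`, the state preparation and the block-encodings of a system. -/
def oracle (σ : System D S s0 A a0 ν) : ∀ i : Oracle D, Matrix (Reg S A i) (Reg S A i) ℂ
  | .evo => (NormedSpace.exp (Complex.I • σ.H) : Matrix S S ℂ)
  | .prep => (σ.prep : Matrix S S ℂ)
  | .block j => (σ.block j : Matrix (A j × S) (A j × S) ℂ)

/-- The matrix element `⟨λ_m| V⁽ʲ⁾ |λ_n⟩`. -/
def elem (σ : System D S s0 A a0 ν) (j : Fin (D + 1)) (m n : S) : ℂ :=
  ((σ.eigvec : Matrix S S ℂ).conjTranspose * σ.V j * (σ.eigvec : Matrix S S ℂ)) m n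

/-- The windowed correlation function
`R(ω) = ∑_{n₁,…,n_D} V⁽ᴰ⁾_{n_D n₀} ∏_{j=1}^D V⁽ʲ⁻¹⁾_{n_{j-1} n_j} 𝓛(λ_{n_{j-1}} - λ_{n_j} - ω_{D-j+1})`.
-/
def R (σ : System D S s0 A a0 ν) {N : ℕ} (α : Fin N → ℂ) (ω : Fin D → ℝ) : ℂ :=
  ∑ t : Fin D → S,
    let n : Fin (D + 1) → S := Fin.cons σ.n0 t
    σ.elem (Fin.last D) (n (Fin.last D)) σ.n0 *
      ∏ j : Fin D, σ.elem j.castSucc (n j.castSucc) (n j.succ) *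
        window α (σ.energy (n j.castSucc) - σ.energy (n j.succ) - ω j.rev)

end System

end GQPE

end

/-! Expand every window into its coefficients. The factor `𝓛(λ_m - λ_n - ω)` is `N^{-1/2} ∑_q α_q
e^{-iqω} e^{iq(λ_m - λ_n)}`, and `V_{mn} e^{iq(λ_m - λ_n)}` is a matrix element of `e^{iqH} V
e^{-iqH}`. Hence `R(ω)` is a sum over tuples of times `q`, with product weights and Fourier phases,
of the expectation in `|λ_{n0}⟩` of a product of evolved operators. A circuit realizes this sum:
load `α` into each of `D` time registers, prepare the eigenstate, apply the block-encodings between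
controlled powers of `e^{±iH}`, undo the preparation, and Fourier transform each time register, with
`ω` as an offset. With one ancilla per block-encoding, the amplitude of the outcome with all
references restored and grid index `k` is `R(ω + 2πk/N)/Ω` (`exists_gates_correlation`, resting on
`block_amplitude` and `window_eq_fourier_mulVec`). The cost is `2DN` evolutions, two preparations
and one use of each block-encoding.

For a single point this amplitude is a diagonal entry `a` of a unitary `U`. The self-adjoint unitary
built from `U` and `U†` has expectation `Re(za)` in a suitable state `χ`. Multiplied by the
reflection about `χ`, it has the moments `cos(kφ)` with `cos φ = Re(za)` (`dotProduct_pow_mulVec`).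
Windowed phase estimation then reads off `cos φ`, so one sample each for `z = 1` and `z = -i` and
`O(Ω/ε)` uses of `U` suffice (`exists_amplitude_estimate`).

For all points at once, the summed variance of the empirical frequencies is at most `1/n` however
many outcomes there are (`sum_prod_mul_freq_sub_sq_le`), so one Chebyshev bound controls all of them
without a union bound. Taking square roots turns tolerance `(ε/Ω)^2` for probabilities into `ε/Ω`
for moduli, which gives the fourth power. For complex values, the estimated moduli first single out
a set of `O((Ω/ε)^2)` candidate large amplitudes. These interfere with a uniform reference state on
that set, and differences of frequencies reveal real and imaginary parts
(`exists_recovery_on_support`).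

The windows in (0) are the normalized coefficients of `(1 + X + ⋯ + X^{m-1})^p` with `m ~ 1/η` and
`p ~ log(1/δ)`: raising the Dirichlet kernel to a power makes its tails exponentially small in `p`.
-/

set_option linter.unusedSectionVars false

namespace GQPE

/-! ### Matrices of gate lists -/

section Gates

variable {ι : Type} {X : ι → Type} {M Q : Type} [Fintype M] [DecidableEq M] [Fintype Q]
  [DecidableEq Q]

/-- The matrix of a list of gates that are applied from left to right. -/
noncomputable def gatesMat (O : ∀ i, Matrix (X i) (X i) ℂ) : List (Gate X M) → Matrix M M ℂ
  | [] => 1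
  | g :: gs => gatesMat O gs * g.mat O

theorem gatesMat_append (O : ∀ i, Matrix (X i) (X i) ℂ) (gs hs : List (Gate X M)) :
    gatesMat O (gs ++ hs) = gatesMat O hs * gatesMat O gs := by
  induction gs with
  | nil => simp [gatesMat]
  | cons g gs ih => simp [gatesMat, ih, Matrix.mul_assoc]

theorem gatesMat_singleton (O : ∀ i, Matrix (X i) (X i) ℂ) (g : Gate X M) :
    gatesMat O [g] = g.mat O := by
  simp [gatesMat]

theorem foldl_mulVec_eq_gatesMat (O : ∀ i, Matrix (X i) (X i) ℂ) (gs : List (Gate X M))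
    (ψ : M → ℂ) :
    gs.foldl (fun ψ g => (g.mat O).mulVec ψ) ψ = (gatesMat O gs).mulVec ψ := by
  induction gs generalizing ψ with
  | nil => simp [gatesMat]
  | cons g gs ih => simp [gatesMat, ih, Matrix.mulVec_mulVec]

theorem Circuit.state_eq_gatesMat (O : ∀ i, Matrix (X i) (X i) ℂ) (c : Circuit X) (m : c.M) :
    c.state O m = gatesMat O c.gates m c.init := by
  rw [Circuit.state, foldl_mulVec_eq_gatesMat]
  simp

/-- Gates act from left to right while the leftmost factor of a matrix product acts last, hence the
reversal. -/
theorem gatesMat_flatten_reverse (O : ∀ i, Matrix (X i) (X i) ℂ) (l : List (List (Gate X M))) :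
    gatesMat O l.reverse.flatten = (l.map (gatesMat O)).prod := by
  induction l with
  | nil => simp [gatesMat]
  | cons g l ih => simp [gatesMat_append, ih]

/-- The number of queries to the oracle `i` in a list of gates. -/
noncomputable def gatesQueries (i : ι) (gs : List (Gate X M)) : ℕ :=
  (gs.map (Gate.queries i)).sum

theorem gatesQueries_append (i : ι) (gs hs : List (Gate X M)) :
    gatesQueries i (gs ++ hs) = gatesQueries i gs + gatesQueries i hs := by
  simp [gatesQueries]

theorem gatesQueries_cons (i : ι) (g : Gate X M) (gs : List (Gate X M)) :
    gatesQueries i (g :: gs) = g.queries i + gatesQueries i gs := by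
  simp [gatesQueries]

theorem gatesQueries_nil (i : ι) : gatesQueries i ([] : List (Gate X M)) = 0 := rfl

theorem gatesQueries_flatten (i : ι) (l : List (List (Gate X M))) :
    gatesQueries i l.flatten = (l.map (gatesQueries i)).sum := by
  induction l with
  | nil => rfl
  | cons g l ih => simp [gatesQueries_append, ih]

/-! ### Unitarity and inverses -/

theorem Gate.mat_mem_unitaryGroup [∀ i, Fintype (X i)] [∀ i, DecidableEq (X i)]
    {O : ∀ i, Matrix (X i) (X i) ℂ} (hO : ∀ i, O i ∈ Matrix.unitaryGroup (X i) ℂ)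
    (g : Gate X M) : g.mat O ∈ Matrix.unitaryGroup M ℂ := by
  cases g with
  | free U => exact U.2
  | query i inv R e ctrl =>
    -- The control register `R` of a query carries no finiteness assumption. A point of the memory
    -- embeds `R` into the finite memory; an empty memory says nothing about `R` but makes all its
    -- matrices equal.
    rcases isEmpty_or_nonempty M with hM | ⟨⟨m0⟩⟩
    · rw [Matrix.mem_unitaryGroup_iff]
      exact Subsingleton.elim _ _
    rename_i inst
    -- `Gate.mat` uses classical decidability on the oracle registers, and the given instance must
    -- agree with it before rewriting.
    obtain rfl : inst = fun i a b => Classical.propDecidable (a = b) := Subsingleton.elim _ _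
    classical
    let _ : Fintype R := Fintype.ofInjective (fun r => e.symm ((e m0).1, r)) fun r r' h => by
      simpa using h
    have h1 := Matrix.mem_unitaryGroup_iff.mp (hO i)
    have h2 := Matrix.mem_unitaryGroup_iff'.mp (hO i)
    rw [Matrix.star_eq_conjTranspose] at h1 h2
    rw [Matrix.mem_unitaryGroup_iff, Matrix.star_eq_conjTranspose, Gate.mat,
      Matrix.conjTranspose_submatrix, Matrix.submatrix_mul_equiv, Matrix.blockDiagonal_conjTranspose,
      ← Matrix.blockDiagonal_mul]
    have h3 : (fun r => (if ctrl r then (if inv then (O i).conjTranspose else O i) else 1) *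
        (if ctrl r then (if inv then (O i).conjTranspose else O i) else 1).conjTranspose)
        = (1 : R → Matrix (X i) (X i) ℂ) := by
      funext r
      split_ifs <;> simp [h1, h2]
    rw [h3, Matrix.blockDiagonal_one]
    exact Matrix.submatrix_one_equiv e

/-- The inverse of a gate. -/
def Gate.inverse : Gate X M → Gate X M
  | .free U => .free U⁻¹
  | .query i inv R e ctrl => .query i (!inv) R e ctrl

theorem Gate.mat_inverse (O : ∀ i, Matrix (X i) (X i) ℂ) (g : Gate X M) :
    g.inverse.mat O = (g.mat O).conjTranspose := by
  classical
  cases g with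
  | free U => rfl
  | query i inv R e ctrl =>
    rw [Gate.inverse, Gate.mat, Gate.mat, Matrix.conjTranspose_submatrix,
      Matrix.blockDiagonal_conjTranspose]
    refine congrArg (fun B => (Matrix.blockDiagonal B).submatrix e e) ?_
    funext r
    cases inv <;> by_cases h : ctrl r <;> simp [h]

theorem Gate.queries_inverse (i : ι) (g : Gate X M) : g.inverse.queries i = g.queries i := by
  cases g <;> rfl

/-- The inverse of a list of gates. -/
def inverseGates (gs : List (Gate X M)) : List (Gate X M) := (gs.map Gate.inverse).reverse

theorem gatesMat_inverseGates (O : ∀ i, Matrix (X i) (X i) ℂ) (gs : List (Gate X M)) :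
    gatesMat O (inverseGates gs) = (gatesMat O gs).conjTranspose := by
  induction gs with
  | nil => simp [gatesMat, inverseGates]
  | cons g gs ih =>
    rw [inverseGates] at ih ⊢
    rw [List.map_cons, List.reverse_cons, gatesMat_append, ih, gatesMat_singleton,
      Gate.mat_inverse, gatesMat, Matrix.conjTranspose_mul]

theorem gatesQueries_inverseGates (i : ι) (gs : List (Gate X M)) :
    gatesQueries i (inverseGates gs) = gatesQueries i gs := by
  simp only [gatesQueries, inverseGates, List.map_reverse, List.sum_reverse, List.map_map]
  congr 2
  funext g
  exact g.queries_inverse i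

theorem gatesMat_mem_unitaryGroup [∀ i, Fintype (X i)] [∀ i, DecidableEq (X i)]
    {O : ∀ i, Matrix (X i) (X i) ℂ} (hO : ∀ i, O i ∈ Matrix.unitaryGroup (X i) ℂ)
    (gs : List (Gate X M)) : gatesMat O gs ∈ Matrix.unitaryGroup M ℂ := by
  induction gs with
  | nil => exact one_mem _
  | cons g gs ih => exact mul_mem ih (g.mat_mem_unitaryGroup hO)

/-! ### Controlled gates -/

theorem blockDiagonal_mem_unitaryGroup {U : Q → Matrix M M ℂ}
    (hU : ∀ q, U q ∈ Matrix.unitaryGroup M ℂ) :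
    Matrix.blockDiagonal U ∈ Matrix.unitaryGroup (M × Q) ℂ := by
  rw [Matrix.mem_unitaryGroup_iff, Matrix.star_eq_conjTranspose,
    Matrix.blockDiagonal_conjTranspose, ← Matrix.blockDiagonal_mul, ← Matrix.blockDiagonal_one]
  congr 1
  funext q
  exact Matrix.mem_unitaryGroup_iff.mp (hU q)

/-- A gate controlled by the condition `b` on an additional register `Q`. -/
def Gate.control (b : Q → Bool) : Gate X M → Gate X (M × Q)
  | .free U => .free ⟨Matrix.blockDiagonal fun q => if b q then (U : Matrix M M ℂ) else 1,
      blockDiagonal_mem_unitaryGroup fun q => by split_ifs <;> [exact U.2; exact one_mem _]⟩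
  | .query i inv R e ctrl => .query i inv (R × Q)
      ((e.prodCongr (Equiv.refl Q)).trans (Equiv.prodAssoc _ _ _)) fun r => ctrl r.1 && b r.2

theorem Gate.mat_control (O : ∀ i, Matrix (X i) (X i) ℂ) (b : Q → Bool) (g : Gate X M) :
    (g.control b).mat O = Matrix.blockDiagonal fun q => if b q then g.mat O else 1 := by
  classical
  cases g with
  | free U => rfl
  | query i inv R e ctrl =>
    ext ⟨m, q⟩ ⟨m', q'⟩
    simp only [Gate.control, Gate.mat, Matrix.submatrix_apply, Matrix.blockDiagonal_apply,
      Equiv.trans_apply, Equiv.prodCongr_apply, Prod.map, Equiv.prodAssoc_apply, Equiv.refl_apply,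
      Prod.mk.injEq]
    by_cases hq : q = q'
    · subst hq
      by_cases hb : b q
      · simp [hb, Matrix.blockDiagonal_apply]
      · have : m = m' ↔ (e m).1 = (e m').1 ∧ (e m).2 = (e m').2 := by
          rw [← e.injective.eq_iff, Prod.ext_iff]
        by_cases h1 : (e m).1 = (e m').1 <;> by_cases h2 : (e m).2 = (e m').2 <;>
          simp [hb, Matrix.one_apply, this, h1, h2]
    · simp [hq]

/-- The new condition is absorbed into the control of the query, so no further oracle use arises. -/
theorem Gate.queries_control (i : ι) (b : Q → Bool) (g : Gate X M) :
    (g.control b).queries i = g.queries i := by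
  cases g <;> rfl

theorem gatesMat_map_control (O : ∀ i, Matrix (X i) (X i) ℂ) (b : Q → Bool)
    (gs : List (Gate X M)) :
    gatesMat O (gs.map (Gate.control b)) =
      Matrix.blockDiagonal fun q => if b q then gatesMat O gs else 1 := by
  induction gs with
  | nil => simp only [List.map_nil, gatesMat, ite_self]; exact Matrix.blockDiagonal_one.symm
  | cons g gs ih =>
    rw [List.map_cons, gatesMat, ih, Gate.mat_control, ← Matrix.blockDiagonal_mul]
    congr 1
    funext q
    split_ifs <;> simp [gatesMat]

theorem gatesQueries_map_control (i : ι) (b : Q → Bool) (gs : List (Gate X M)) :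
    gatesQueries i (gs.map (Gate.control b)) = gatesQueries i gs := by
  simp only [gatesQueries, List.map_map]
  congr 2
  funext g
  exact g.queries_control i b

/-- The list `gs`, repeated as often as the number `r q` stored in the register `Q` says, where
`r q ≤ N`. -/
def powerGates (N : ℕ) (r : Q → ℕ) (gs : List (Gate X M)) : List (Gate X (M × Q)) :=
  (List.range N).flatMap fun i => gs.map (Gate.control fun q => decide (i < r q))

/-- The truncated exponent makes the induction on `N` possible, since a bound `r q ≤ N` would not
pass to smaller `N`. -/
theorem gatesMat_powerGates_min (O : ∀ i, Matrix (X i) (X i) ℂ) (N : ℕ) (r : Q → ℕ)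
    (gs : List (Gate X M)) : gatesMat O (powerGates N r gs) =
      Matrix.blockDiagonal fun q => gatesMat O gs ^ min N (r q) := by
  induction N with
  | zero =>
    simp only [powerGates, List.range_zero, List.flatMap_nil, gatesMat, zero_min, pow_zero]
    exact Matrix.blockDiagonal_one.symm
  | succ N ih =>
    rw [powerGates] at ih ⊢
    rw [List.range_succ, List.flatMap_append, gatesMat_append, ih, List.flatMap_singleton,
      gatesMat_map_control, ← Matrix.blockDiagonal_mul]
    congr 1
    funext q
    by_cases h : N < r q
    · simp only [h, decide_true, if_true]
      rw [min_eq_left h.le, min_eq_left (Nat.succ_le_of_lt h), pow_succ']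
    · simp only [h, decide_false, Bool.false_eq_true, if_false]
      rw [min_eq_right (not_lt.mp h), min_eq_right ((not_lt.mp h).trans N.le_succ), one_mul]

theorem gatesMat_powerGates (O : ∀ i, Matrix (X i) (X i) ℂ) {N : ℕ} {r : Q → ℕ}
    (hr : ∀ q, r q ≤ N) (gs : List (Gate X M)) : gatesMat O (powerGates N r gs) =
      Matrix.blockDiagonal fun q => gatesMat O gs ^ r q := by
  rw [gatesMat_powerGates_min]
  congr 1
  funext q
  rw [min_eq_right (hr q)]

theorem gatesQueries_powerGates (i : ι) (N : ℕ) (r : Q → ℕ) (gs : List (Gate X M)) :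
    gatesQueries i (powerGates N r gs) = N * gatesQueries i gs := by
  induction N with
  | zero => simp [powerGates, gatesQueries]
  | succ N ih =>
    rw [powerGates] at ih ⊢
    rw [List.range_succ, List.flatMap_append, gatesQueries_append, ih, List.flatMap_singleton,
      gatesQueries_map_control, add_mul, one_mul]

/-! ### Fixed unitaries -/

/-- A fixed unitary on the second factor of the memory. -/
def Gate.onRegister (W : Matrix.unitaryGroup Q ℂ) : Gate X (M × Q) :=
  .free ⟨Matrix.kroneckerMap (· * ·) (1 : Matrix M M ℂ) (W : Matrix Q Q ℂ),
    Matrix.kronecker_mem_unitary (one_mem _) W.2⟩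

theorem Gate.mat_onRegister (O : ∀ i, Matrix (X i) (X i) ℂ) (W : Matrix.unitaryGroup Q ℂ) :
    (Gate.onRegister W : Gate X (M × Q)).mat O =
      Matrix.kroneckerMap (· * ·) (1 : Matrix M M ℂ) (W : Matrix Q Q ℂ) := rfl

/-- A unit vector extends to an orthonormal basis. This supplies all oracle-independent state
preparations. -/
theorem exists_unitary_with_column (i : M) (v : M → ℂ) (hv : ∑ m, ‖v m‖ ^ 2 = 1) :
    ∃ W : Matrix.unitaryGroup M ℂ, ∀ m, (W : Matrix M M ℂ) m i = v m := by
  have hv1 : ‖WithLp.toLp 2 v‖ = 1 := by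
    rw [EuclideanSpace.norm_eq, Real.sqrt_eq_one]
    exact hv
  have ho : Orthonormal ℂ (Set.domRestrict {i} fun _ : M => WithLp.toLp 2 v) := by
    refine ⟨fun _ => hv1, fun a b hab => ?_⟩
    exact absurd (Subsingleton.elim a b) hab
  obtain ⟨b, hb⟩ := ho.exists_orthonormalBasis_extension_of_card_eq (by simp)
  refine ⟨⟨Matrix.of fun m j => b j m, ?_⟩, fun m => ?_⟩
  · rw [Matrix.mem_unitaryGroup_iff']
    ext j k
    have h := orthonormal_iff_ite.mp b.orthonormal j k
    rw [PiLp.inner_apply] at h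
    simp only [Matrix.mul_apply, Matrix.star_apply, Matrix.of_apply, Matrix.one_apply, ← h]
    exact Finset.sum_congr rfl fun m _ => by simp [mul_comm]
  · simp [hb i rfl]

end Gates
end GQPE

namespace GQPE

/-! ### Discrete Fourier transforms -/

section Fourier

/-- Unitary matrices preserve the sum of the squared absolute values. -/
theorem sum_norm_sq_mulVec {M : Type} [Fintype M] [DecidableEq M] {U : Matrix M M ℂ}
    (hU : U ∈ Matrix.unitaryGroup M ℂ) (v : M → ℂ) :
    ∑ m, ‖U.mulVec v m‖ ^ 2 = ∑ m, ‖v m‖ ^ 2 := by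
  have key : ∀ w : M → ℂ, ((∑ m, ‖w m‖ ^ 2 : ℝ) : ℂ) = dotProduct (star w) w := fun w => by
    rw [dotProduct, Complex.ofReal_sum]
    refine Finset.sum_congr rfl fun m _ => ?_
    rw [Pi.star_apply, Complex.star_def, Complex.conj_mul']
    push_cast
    rfl
  have h : dotProduct (star (U.mulVec v)) (U.mulVec v) = dotProduct (star v) v := by
    rw [Matrix.star_mulVec, ← Matrix.dotProduct_mulVec, Matrix.mulVec_mulVec,
      ← Matrix.star_eq_conjTranspose, Matrix.mem_unitaryGroup_iff'.mp hU, Matrix.one_mulVec]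
  rw [← key, ← key] at h
  exact_mod_cast h

/-- The inverse discrete Fourier transform on `ℂ^N`, with frequencies shifted by `ω`. -/
noncomputable def fourier (N : ℕ) (ω : ℝ) : Matrix (Fin N) (Fin N) ℂ :=
  Matrix.of fun m k => ((Real.sqrt N : ℝ) : ℂ)⁻¹ *
    Complex.exp (-(Complex.I * (k.val : ℂ) * ((ω + 2 * Real.pi * (m.val : ℝ) / (N : ℝ) : ℝ) : ℂ)))

/-- The offset `ω` contributes phases that depend only on the column and cancel. Two distinct rows
then have as inner product a geometric sum over a nontrivial `N`-th root of unity. -/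
theorem fourier_mem_unitaryGroup (N : ℕ) (ω : ℝ) : fourier N ω ∈ Matrix.unitaryGroup (Fin N) ℂ := by
  rw [Matrix.mem_unitaryGroup_iff]
  ext m m'
  have hN : 0 < N := m.pos
  have hN0 : (N : ℂ) ≠ 0 := by exact_mod_cast hN.ne'
  have hsq : ((Real.sqrt N : ℝ) : ℂ)⁻¹ * ((Real.sqrt N : ℝ) : ℂ)⁻¹ = (N : ℂ)⁻¹ := by
    rw [← mul_inv, ← Complex.ofReal_mul, Real.mul_self_sqrt (Nat.cast_nonneg N)]
    simp
  set ζ : ℂ := Complex.exp (2 * Real.pi * Complex.I * ((m'.val : ℂ) - m.val) / N) with hζ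
  have hterm : ∀ k : Fin N, fourier N ω m k * star (fourier N ω m' k) = (N : ℂ)⁻¹ * ζ ^ k.val := by
    intro k
    simp only [fourier, Matrix.of_apply, Complex.star_def, map_mul, map_inv₀, Complex.conj_ofReal,
      ← Complex.exp_conj, map_neg, Complex.conj_I, Complex.conj_natCast]
    rw [mul_mul_mul_comm, hsq, ← Complex.exp_add, hζ, ← Complex.exp_nat_mul]
    congr 2
    push_cast
    field_simp
    ring
  rw [Matrix.mul_apply]
  simp only [Matrix.star_apply, hterm]
  rw [← Finset.mul_sum, Fin.sum_univ_eq_sum_range (fun k => ζ ^ k) N, Matrix.one_apply]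
  split_ifs with h
  · subst h
    simp [hζ, hN0]
  · have hζ1 : ζ ≠ 1 := by
      intro h1
      obtain ⟨n, hn⟩ := Complex.exp_eq_one_iff.mp h1
      have hpi : (2 * Real.pi * Complex.I : ℂ) ≠ 0 := Complex.two_pi_I_ne_zero
      have h2 : ((m'.val : ℂ) - m.val) = n * N := by
        field_simp at hn
        linear_combination hn
      have h3 : (m'.val : ℤ) - m.val = n * N := by exact_mod_cast h2
      have hm := m.2
      have hm' := m'.2
      apply h
      rcases lt_trichotomy n 0 with hn0 | hn0 | hn0
      · exfalso
        nlinarith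
      · subst hn0
        ext
        omega
      · exfalso
        nlinarith
    have hζN : ζ ^ N = 1 := by
      rw [hζ, ← Complex.exp_nat_mul, Complex.exp_eq_one_iff]
      refine ⟨(m'.val : ℤ) - m.val, ?_⟩
      push_cast
      field_simp
    rw [geom_sum_eq hζ1, hζN]
    simp

/-- This is why window functions appear as amplitudes: they are what the Fourier transform produces
from a time register whose weights `α` have picked up the phases `e^{ikx}`. -/
theorem window_eq_fourier_mulVec {N : ℕ} (α : Fin N → ℂ) (x ω : ℝ) (m : Fin N) :
    window α (x - ω - 2 * Real.pi * (m.val : ℝ) / (N : ℝ)) =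
      ∑ k, fourier N ω m k * (α k * Complex.exp (Complex.I * (k.val : ℂ) * (x : ℂ))) := by
  rw [window, Finset.mul_sum]
  refine Finset.sum_congr rfl fun k _ => ?_
  have h : Complex.I * (k.val : ℂ) *
      ((x - ω - 2 * Real.pi * (m.val : ℝ) / (N : ℝ) : ℝ) : ℂ) =
      -(Complex.I * (k.val : ℂ) * ((ω + 2 * Real.pi * (m.val : ℝ) / (N : ℝ) : ℝ) : ℂ)) +
        Complex.I * (k.val : ℂ) * (x : ℂ) := by
    push_cast
    ring
  rw [fourier, Matrix.of_apply, h, Complex.exp_add]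
  ring

/-- Parseval's identity for window functions. -/
theorem sum_norm_sq_window {N : ℕ} (α : Fin N → ℂ) (x : ℝ) :
    ∑ m : Fin N, ‖window α (x - 2 * Real.pi * (m.val : ℝ) / (N : ℝ))‖ ^ 2 = ∑ k, ‖α k‖ ^ 2 := by
  have h := sum_norm_sq_mulVec (fourier_mem_unitaryGroup N 0)
    (fun k => α k * Complex.exp (Complex.I * (k.val : ℂ) * (x : ℂ)))
  have h1 : ∀ k : Fin N, ‖α k * Complex.exp (Complex.I * (k.val : ℂ) * (x : ℂ))‖ = ‖α k‖ := by
    intro k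
    rw [norm_mul, mul_assoc, mul_comm Complex.I, ← Complex.ofReal_natCast, ← Complex.ofReal_mul,
      Complex.norm_exp_ofReal_mul_I, mul_one]
  simp only [h1] at h
  rw [← h]
  refine Finset.sum_congr rfl fun m _ => ?_
  rw [Matrix.mulVec, dotProduct, ← window_eq_fourier_mulVec, sub_zero]

/-- The tensor product of unitary matrices. -/
theorem tensor_mem_unitaryGroup {D N : ℕ} {U : Fin D → Matrix (Fin N) (Fin N) ℂ}
    (hU : ∀ j, U j ∈ Matrix.unitaryGroup (Fin N) ℂ) :
    (Matrix.of fun m k : Fin D → Fin N => ∏ j, U j (m j) (k j)) ∈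
      Matrix.unitaryGroup (Fin D → Fin N) ℂ := by
  rw [Matrix.mem_unitaryGroup_iff]
  ext m m'
  simp only [Matrix.mul_apply, Matrix.star_apply, Matrix.of_apply, star_prod]
  simp only [← Finset.prod_mul_distrib]
  rw [← Fintype.prod_sum (fun j k => U j (m j) k * star (U j (m' j) k))]
  have h : ∀ j, ∑ k, U j (m j) k * star (U j (m' j) k) = if m j = m' j then 1 else 0 := by
    intro j
    have h1 := congrFun (congrFun (Matrix.mem_unitaryGroup_iff.mp (hU j)) (m j)) (m' j)
    rw [Matrix.mul_apply, Matrix.one_apply] at h1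
    exact h1
  simp only [h, Matrix.one_apply, funext_iff]
  rw [Finset.prod_ite_zero]
  simp

end Fourier

/-! ### Windows of small resolution -/

section Windows

open Polynomial

theorem window_coeff {N : ℕ} {P : ℂ[X]} (hP : P.natDegree < N) (x : ℝ) :
    window (fun k : Fin N => P.coeff k) x =
      ((Real.sqrt N : ℝ) : ℂ)⁻¹ * P.eval (Complex.exp (Complex.I * x)) := by
  rw [window, Polynomial.eval_eq_sum_range' hP,
    ← Fin.sum_univ_eq_sum_range (fun k => P.coeff k * Complex.exp (Complex.I * x) ^ k)]
  congr 1
  refine Finset.sum_congr rfl fun k _ => ?_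
  rw [← Complex.exp_nat_mul]
  congr 2
  ring

theorem norm_window_coeff_sq {N : ℕ} {P : ℂ[X]} (hP : P.natDegree < N) (x : ℝ) :
    ‖window (fun k : Fin N => P.coeff k) x‖ ^ 2 =
      (N : ℝ)⁻¹ * ‖P.eval (Complex.exp (Complex.I * x))‖ ^ 2 := by
  rw [window_coeff hP, norm_mul, mul_pow, norm_inv, Complex.norm_real, Real.norm_eq_abs, inv_pow,
    sq_abs, Real.sq_sqrt (Nat.cast_nonneg N)]

/-- Reduce `y` modulo `2π` to `z ∈ (-π, π]`. Then `|e^{iz} - 1| = 2|sin(z/2)|`, and Jordan's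
inequality bounds the sine from below. -/
theorem norm_exp_sub_one_ge {η y : ℝ} (hy : ∀ n : ℤ, η < |y - 2 * Real.pi * n|) :
    2 * η / Real.pi ≤ ‖Complex.exp (Complex.I * y) - 1‖ := by
  have hpi := Real.pi_pos
  have h2pi : (0 : ℝ) < 2 * Real.pi := by positivity
  set n := toIocDiv h2pi (-Real.pi) y with hn
  have hmem := toIocMod_mem_Ioc h2pi (-Real.pi) y
  have hz : y - n • (2 * Real.pi) = toIocMod h2pi (-Real.pi) y :=
    self_sub_toIocDiv_zsmul h2pi (-Real.pi) y
  set z := toIocMod h2pi (-Real.pi) y with hzdef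
  have hzy : z = y - 2 * Real.pi * n := by rw [← hz, zsmul_eq_mul, mul_comm]
  have h1 : Complex.exp (Complex.I * y) = Complex.exp (Complex.I * z) := by
    rw [hzy, Complex.exp_eq_exp_iff_exists_int]
    refine ⟨n, ?_⟩
    push_cast
    ring
  have h2 : |z / 2| ≤ Real.pi / 2 := by
    rw [abs_le]
    constructor <;> linarith [hmem.1, hmem.2]
  have h3 := Real.mul_abs_le_abs_sin h2
  have h4 := hy n
  rw [← hzy] at h4
  rw [h1, Complex.norm_exp_I_mul_ofReal_sub_one, norm_mul, Real.norm_eq_abs, Real.norm_eq_abs,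
    abs_two]
  rw [abs_div, abs_two] at h3
  have h5 : 2 / Real.pi * (|z| / 2) = |z| / Real.pi := by ring
  rw [h5] at h3
  have h6 : η / Real.pi ≤ |z| / Real.pi := by gcongr
  calc 2 * η / Real.pi = 2 * (η / Real.pi) := by ring
    _ ≤ _ := by linarith

/-- The Dirichlet kernel is bounded away from its peaks. -/
theorem norm_geom_sum_exp_le {η y : ℝ} (hη : 0 < η) (hy : ∀ n : ℤ, η < |y - 2 * Real.pi * n|)
    (m : ℕ) : ‖∑ i ∈ Finset.range m, Complex.exp (Complex.I * y) ^ i‖ ≤ Real.pi / η := by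
  have hpi := Real.pi_pos
  have h1 := norm_exp_sub_one_ge hy
  have h2 := congrArg norm (mul_geom_sum (Complex.exp (Complex.I * y)) m)
  have hn : ‖Complex.exp (Complex.I * y)‖ = 1 := by
    rw [mul_comm, Complex.norm_exp_ofReal_mul_I]
  have h3 : ‖Complex.exp (Complex.I * y) ^ m - 1‖ ≤ 2 := by
    refine (norm_sub_le _ _).trans ?_
    rw [norm_pow, hn]
    norm_num
  rw [← h2, norm_mul] at h3
  have hpos : 0 < 2 * η / Real.pi := by positivity
  have h4 := (mul_le_mul_of_nonneg_right h1 (norm_nonneg _)).trans h3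
  rw [← le_div_iff₀' hpos] at h4
  refine h4.trans (le_of_eq ?_)
  field_simp

/-- The polynomial `(1 + X + ⋯ + X^{m-1})^p`. -/
noncomputable def dirichletPower (m p : ℕ) : ℂ[X] := (∑ i ∈ Finset.range m, (X : ℂ[X]) ^ i) ^ p

theorem natDegree_geom_sum_lt {m : ℕ} (hm : 0 < m) :
    (∑ i ∈ Finset.range m, (X : ℂ[X]) ^ i).natDegree < m := by
  refine lt_of_le_of_lt (natDegree_sum_le_of_forall_le _ _ (n := m - 1) fun i hi => ?_)
    (Nat.sub_lt hm one_pos)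
  rw [natDegree_X_pow]
  have := Finset.mem_range.mp hi
  omega

theorem natDegree_dirichletPower_lt {m p : ℕ} (hm : 0 < m) (hp : 0 < p) :
    (dirichletPower m p).natDegree < p * m := by
  rw [dirichletPower]
  exact lt_of_le_of_lt natDegree_pow_le
    (Nat.mul_lt_mul_of_pos_left (natDegree_geom_sum_lt hm) hp)

/-- Parseval's identity for a polynomial with `m` coefficients equal to `1` and the others `0`. -/
theorem sum_norm_sq_eval_geom_sum_le {m N : ℕ} (hm : 0 < m) (hmN : m ≤ N) (x : ℝ) :
    ∑ k : Fin N, ‖∑ i ∈ Finset.range m, Complex.exp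
      (Complex.I * ((x - 2 * Real.pi * (k.val : ℝ) / (N : ℝ) : ℝ) : ℂ)) ^ i‖ ^ 2 ≤ N * m := by
  have hN : (0 : ℝ) < N := by exact_mod_cast hm.trans_le hmN
  set G : ℂ[X] := ∑ i ∈ Finset.range m, (X : ℂ[X]) ^ i with hG
  have hdeg : G.natDegree < N := (natDegree_geom_sum_lt hm).trans_le hmN
  have h1 := sum_norm_sq_window (fun k : Fin N => G.coeff k) x
  simp only [norm_window_coeff_sq hdeg] at h1
  rw [← Finset.mul_sum] at h1
  have h2 : ∑ k : Fin N, ‖G.coeff k‖ ^ 2 ≤ m := by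
    rw [Fin.sum_univ_eq_sum_range (fun k => ‖G.coeff k‖ ^ 2) N]
    have h3 : ∀ k, ‖G.coeff k‖ ^ 2 = if k < m then 1 else 0 := fun k => by
      simp only [hG, finsetSum_coeff, coeff_X_pow]
      rw [Finset.sum_ite_eq]
      split_ifs <;> simp_all
    simp only [h3]
    rw [Finset.sum_ite, Finset.sum_const_zero, add_zero, Finset.sum_const, nsmul_eq_mul, mul_one]
    have : (Finset.range N).filter (fun k => k < m) ⊆ Finset.range m := fun k hk => by
      simpa using (Finset.mem_filter.mp hk).2
    exact_mod_cast (Finset.card_le_card this).trans (by simp)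
  have h4 : ∀ z : ℂ, ∑ i ∈ Finset.range m, z ^ i = G.eval z := fun z => by
    simp [hG, eval_finsetSum]
  simp only [h4]
  rw [inv_mul_eq_iff_eq_mul₀ hN.ne'] at h1
  rw [h1]
  gcongr

/-- Evaluation at `1` gives coefficient sum `m^p`; Cauchy–Schwarz over the `N` coefficients does the
rest. -/
theorem le_sum_norm_sq_coeff_dirichletPower {m p N : ℕ} (hm : 0 < m) (hp : 0 < p)
    (hN : p * m ≤ N) :
    (m : ℝ) ^ (2 * p) ≤ N * ∑ k : Fin N, ‖(dirichletPower m p).coeff k‖ ^ 2 := by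
  have hdeg := (natDegree_dirichletPower_lt hm hp).trans_le hN
  have h1 : ∑ k : Fin N, (dirichletPower m p).coeff k = (m : ℂ) ^ p := by
    rw [Fin.sum_univ_eq_sum_range (fun k => (dirichletPower m p).coeff k) N]
    have := Polynomial.eval_eq_sum_range' hdeg 1
    simp only [one_pow, mul_one] at this
    rw [← this]
    simp [dirichletPower, eval_finsetSum]
  have h2 : (m : ℝ) ^ p ≤ ∑ k : Fin N, ‖(dirichletPower m p).coeff k‖ := by
    calc (m : ℝ) ^ p = ‖∑ k : Fin N, (dirichletPower m p).coeff k‖ := by simp [h1]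
      _ ≤ _ := norm_sum_le _ _
  calc (m : ℝ) ^ (2 * p) = ((m : ℝ) ^ p) ^ 2 := by rw [mul_comm, pow_mul]
    _ ≤ (∑ k : Fin N, ‖(dirichletPower m p).coeff k‖) ^ 2 := by gcongr
    _ ≤ _ := by simpa using sq_sum_le_card_mul_sum_sq (s := Finset.univ)
                  (f := fun k : Fin N => ‖(dirichletPower m p).coeff k‖)

/-- The window consists of the normalized coefficients of `dirichletPower m p`. Since the total
weight is `1`, it suffices to bound the weight away from the peak. There `2(p-1)` of the `2p` kernel
factors are bounded pointwise by `π/η`, and the remaining square is summed over the grid by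
Parseval. -/
theorem exists_isWindow_resolves {m p N : ℕ} {η δ : ℝ} (hη : 0 < η) (hm : 0 < m) (hp : 0 < p)
    (hN : p * m ≤ N) (hδ : N / m * (Real.pi / (η * m)) ^ (2 * (p - 1)) ≤ δ) :
    ∃ α : Fin N → ℂ, IsWindow α ∧ Resolves α η δ := by
  classical
  set P := dirichletPower m p with hP
  have hdeg : P.natDegree < N := (natDegree_dirichletPower_lt hm hp).trans_le hN
  have hm' : (0 : ℝ) < m := by exact_mod_cast hm
  have hmN : m ≤ N := (Nat.le_mul_of_pos_left m hp).trans hN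
  have hN' : (0 : ℝ) < N := by exact_mod_cast hm.trans_le hmN
  have hle := le_sum_norm_sq_coeff_dirichletPower hm hp hN
  rw [← hP] at hle
  set s : ℝ := ∑ k : Fin N, ‖P.coeff k‖ ^ 2 with hs
  have hs0 : 0 < s := by
    by_contra h
    have : (0 : ℝ) < (m : ℝ) ^ (2 * p) := by positivity
    nlinarith
  have hsq : Real.sqrt s ^ 2 = s := Real.sq_sqrt hs0.le
  have hwin : ∀ x : ℝ, window (fun k : Fin N => ((Real.sqrt s : ℝ) : ℂ)⁻¹ * P.coeff k) x =
      ((Real.sqrt s : ℝ) : ℂ)⁻¹ * window (fun k : Fin N => P.coeff k) x := by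
    intro x
    simp only [window, Finset.mul_sum]
    exact Finset.sum_congr rfl fun k _ => by ring
  have hnorm : ∀ z : ℂ, ‖((Real.sqrt s : ℝ) : ℂ)⁻¹ * z‖ ^ 2 = s⁻¹ * ‖z‖ ^ 2 := fun z => by
    rw [norm_mul, mul_pow, norm_inv, Complex.norm_real, Real.norm_eq_abs, inv_pow, sq_abs, hsq]
  have hα : IsWindow (fun k : Fin N => ((Real.sqrt s : ℝ) : ℂ)⁻¹ * P.coeff k) := by
    simp only [IsWindow, hnorm]
    rw [← Finset.mul_sum, ← hs, inv_mul_cancel₀ hs0.ne']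
  refine ⟨_, hα, fun x => ?_⟩
  have htot := sum_norm_sq_window (fun k : Fin N => ((Real.sqrt s : ℝ) : ℂ)⁻¹ * P.coeff k) x
  rw [hα, ← Finset.sum_filter_add_sum_filter_not Finset.univ (fun k : Fin N =>
      ∃ m : ℤ, |x - 2 * Real.pi * (k.val : ℝ) / (N : ℝ) - 2 * Real.pi * (m : ℝ)| ≤ η)] at htot
  have hbad : ∑ k ∈ Finset.univ.filter (fun k : Fin N => ¬
      ∃ m : ℤ, |x - 2 * Real.pi * (k.val : ℝ) / (N : ℝ) - 2 * Real.pi * (m : ℝ)| ≤ η),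
      ‖window (fun k : Fin N => ((Real.sqrt s : ℝ) : ℂ)⁻¹ * P.coeff k)
        (x - 2 * Real.pi * (k.val : ℝ) / (N : ℝ))‖ ^ 2 ≤ δ := by
    calc _ ≤ ∑ k ∈ Finset.univ.filter (fun k : Fin N => ¬
            ∃ m : ℤ, |x - 2 * Real.pi * (k.val : ℝ) / (N : ℝ) - 2 * Real.pi * (m : ℝ)| ≤ η),
          s⁻¹ * ((N : ℝ)⁻¹ * ((Real.pi / η) ^ (2 * (p - 1)) *
          ‖∑ i ∈ Finset.range m, Complex.exp
            (Complex.I * ((x - 2 * Real.pi * (k.val : ℝ) / (N : ℝ) : ℝ) : ℂ)) ^ i‖ ^ 2)) := by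
          refine Finset.sum_le_sum fun k hk => ?_
          rw [hwin, hnorm, norm_window_coeff_sq hdeg]
          have hk' := (Finset.mem_filter.mp hk).2
          push Not at hk'
          have hb := norm_geom_sum_exp_le hη hk' m
          have he : ∀ z : ℂ, ‖P.eval z‖ ^ 2 = (‖∑ i ∈ Finset.range m, z ^ i‖) ^ (2 * (p - 1)) *
              ‖∑ i ∈ Finset.range m, z ^ i‖ ^ 2 := fun z => by
            rw [← pow_add, hP, dirichletPower, eval_pow, norm_pow, ← pow_mul]
            congr 1
            · simp [eval_finsetSum]
            · omega
          rw [he]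
          gcongr
      _ ≤ ∑ k : Fin N, s⁻¹ * ((N : ℝ)⁻¹ * ((Real.pi / η) ^ (2 * (p - 1)) *
          ‖∑ i ∈ Finset.range m, Complex.exp
            (Complex.I * ((x - 2 * Real.pi * (k.val : ℝ) / (N : ℝ) : ℝ) : ℂ)) ^ i‖ ^ 2)) := by
          refine Finset.sum_le_sum_of_subset_of_nonneg (Finset.filter_subset _ _) fun k _ _ => ?_
          have := Real.pi_pos
          positivity
      _ ≤ s⁻¹ * ((N : ℝ)⁻¹ * ((Real.pi / η) ^ (2 * (p - 1)) * (N * m))) := by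
          simp only [← Finset.mul_sum]
          have := Real.pi_pos
          gcongr
          exact sum_norm_sq_eval_geom_sum_le hm hmN x
      _ = s⁻¹ * ((Real.pi / η) ^ (2 * (p - 1)) * m) := by
          field_simp
      _ ≤ ((m : ℝ) ^ (2 * p) / N)⁻¹ * ((Real.pi / η) ^ (2 * (p - 1)) * m) := by
          have := Real.pi_pos
          have h : (m : ℝ) ^ (2 * p) / N ≤ s := by
            rw [div_le_iff₀ hN']
            linarith
          gcongr
      _ = N / m * (Real.pi / (η * m)) ^ (2 * (p - 1)) := by
          obtain ⟨p, rfl⟩ : ∃ p', p = p' + 1 := ⟨p - 1, by omega⟩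
          simp only [Nat.add_sub_cancel, mul_add, mul_one, pow_add, div_pow, mul_pow]
          field_simp
      _ ≤ δ := hδ
  linarith

/-- Windows of resolution `η` and failure weight `δ` need at most `O(log(1/δ)/η)` coefficients. -/
theorem exists_short_window_resolves : ∃ K : ℝ, 0 < K ∧ ∀ η δ : ℝ, 0 < η → η < 1 → 0 < δ → δ < 1 →
    ∃ (q : ℕ) (α : Fin (2 ^ q) → ℂ), IsWindow α ∧
      ((2 ^ q : ℕ) : ℝ) ≤ K * Real.log (2 / δ) / η ∧ Resolves α η δ := by
  refine ⟨160, by norm_num, fun η δ hη hη1 hδ hδ1 => ?_⟩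
  have hpi := Real.pi_pos
  have hpi3 := Real.pi_gt_three
  have hpi4 := Real.pi_lt_d2
  have hlog2 := Real.log_two_gt_d9
  set l := Real.log (2 / δ) with hl
  have hl2 : Real.log 2 ≤ l := Real.log_le_log (by norm_num) (by rw [le_div_iff₀ hδ]; linarith)
  have hl0 : 0 ≤ l := by linarith
  -- The choice of `m` makes `π/(ηm) ≤ 1/2`, so every additional power of the kernel reduces the
  -- failure weight by a factor `4`; `p ~ log(1/δ)` powers then reach `δ`.
  set p := ⌈8 * l⌉₊ with hp
  set m := ⌈2 * Real.pi / η⌉₊ with hm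
  have hp1 : 8 * l ≤ p := Nat.le_ceil _
  have hp2 : (p : ℝ) ≤ 10 * l := by
    have := Nat.ceil_lt_add_one (a := 8 * l) (by linarith)
    rw [← hp] at this
    linarith
  have hm1 : 2 * Real.pi / η ≤ m := Nat.le_ceil _
  have hm2 : (m : ℝ) ≤ 8 / η := by
    have := Nat.ceil_lt_add_one (a := 2 * Real.pi / η) (by positivity)
    rw [← hm] at this
    have h1 : (1 : ℝ) ≤ 1 / η := by rw [le_div_iff₀ hη]; linarith
    have h2 : 2 * Real.pi / η + 1 / η ≤ 8 / η := by
      rw [← add_div]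
      gcongr
      linarith
    linarith
  have hp0 : 0 < p := Nat.ceil_pos.mpr (by linarith)
  have hm0 : 0 < m := Nat.ceil_pos.mpr (by positivity)
  have hpr : (1 : ℝ) ≤ p := by exact_mod_cast hp0
  have hmr : (1 : ℝ) ≤ m := by exact_mod_cast hm0
  -- The length is the power of two in `(pm, 2pm]`. With `p ≤ 10 l` and `m ≤ 8/η` this gives the
  -- constant `160`.
  obtain ⟨q, hq1, hq2⟩ := exists_nat_pow_near (x := (p * m : ℕ)) (y := 2)
    (Nat.mul_pos hp0 hm0) one_lt_two
  have hN2 : ((2 ^ (q + 1) : ℕ) : ℝ) ≤ 2 * (p * m) := by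
    have : 2 ^ (q + 1) ≤ 2 * (p * m) := by rw [pow_succ']; omega
    exact_mod_cast this
  have hfail : ((2 ^ (q + 1) : ℕ) : ℝ) / m * (Real.pi / (η * m)) ^ (2 * (p - 1)) ≤ δ := by
    have h1 : Real.pi / (η * m) ≤ 1 / 2 := by
      rw [div_le_div_iff₀ (by positivity) (by norm_num)]
      rw [div_le_iff₀ hη] at hm1
      linarith
    have h2 : ((2 ^ (q + 1) : ℕ) : ℝ) / m ≤ 2 * p := by
      rw [div_le_iff₀ (by positivity)]
      linarith
    have h3 : (p : ℝ) ≤ 2 ^ p := by exact_mod_cast Nat.lt_two_pow_self.le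
    have h4 : (16 : ℝ) / δ ≤ 2 ^ p := by
      have e1 : Real.exp (4 * l) ≤ 2 ^ p := by
        rw [← Real.rpow_natCast, Real.rpow_def_of_pos (by norm_num)]
        apply Real.exp_le_exp.mpr
        nlinarith
      have e2 : Real.exp (4 * l) = (2 / δ) ^ 4 := by
        rw [hl, ← Real.exp_log (show (0 : ℝ) < 2 / δ by positivity), ← Real.exp_nat_mul,
          Real.log_exp]
        norm_num
      refine le_trans ?_ (e2 ▸ e1)
      rw [div_pow, div_le_div_iff₀ hδ (by positivity)]
      have : δ ^ 4 ≤ δ := by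
        calc δ ^ 4 ≤ δ ^ 1 := pow_le_pow_of_le_one hδ.le hδ1.le (by norm_num)
          _ = δ := pow_one δ
      linarith
    have h5 : (2 : ℝ) * p * (1 / 2) ^ (2 * (p - 1)) = 8 * p / (2 ^ p * 2 ^ p) := by
      obtain ⟨p', hp'⟩ : ∃ p', p = p' + 1 := ⟨p - 1, by omega⟩
      have h6 : ((1 : ℝ) / 2) ^ (2 * p') = (2 ^ p' * 2 ^ p')⁻¹ := by
        rw [one_div, inv_pow, two_mul, pow_add]
      rw [hp', Nat.add_sub_cancel, h6, pow_succ]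
      field_simp
      ring
    calc _ ≤ (2 : ℝ) * p * (1 / 2) ^ (2 * (p - 1)) := by gcongr
      _ = 8 * p / (2 ^ p * 2 ^ p) := h5
      _ ≤ 8 * 2 ^ p / (2 ^ p * 2 ^ p) := by gcongr
      _ = 8 / 2 ^ p := by field_simp
      _ ≤ 8 / (16 / δ) := by gcongr
      _ ≤ δ := by
        field_simp
        linarith
  obtain ⟨α, hα, hres⟩ := exists_isWindow_resolves hη hm0 hp0 hq2.le hfail
  refine ⟨q + 1, α, hα, hN2.trans ?_, hres⟩
  calc 2 * ((p : ℝ) * m) ≤ 2 * (10 * l * (8 / η)) := by gcongr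
    _ = 160 * l / η := by ring

end Windows

end GQPE

namespace GQPE

/-! ### Composition of protocols and statistics of repeated samples -/

section Protocols

variable {ι : Type} {X : ι → Type} {Out Out' : Type}

theorem Circuit.prob_nonneg (c : Circuit X) (O : ∀ i, Matrix (X i) (X i) ℂ) (m : c.M) :
    0 ≤ c.prob O m := sq_nonneg _

theorem sum_norm_sq_column {M : Type} [Fintype M] [DecidableEq M] {U : Matrix M M ℂ}
    (hU : U ∈ Matrix.unitaryGroup M ℂ) (i : M) : ∑ m, ‖U m i‖ ^ 2 = 1 := by
  have h := sum_norm_sq_mulVec hU (Pi.single i 1)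
  simp only [Matrix.mulVec_single_one, Matrix.col_apply] at h
  rw [h, Finset.sum_eq_single i]
  · simp
  · intro m _ hm
    simp [Pi.single_eq_of_ne hm]
  · simp

theorem Circuit.sum_prob [∀ i, Fintype (X i)] [∀ i, DecidableEq (X i)]
    {O : ∀ i, Matrix (X i) (X i) ℂ} (hO : ∀ i, O i ∈ Matrix.unitaryGroup (X i) ℂ)
    (c : Circuit X) : ∑ m, c.prob O m = 1 := by
  simp only [Circuit.prob, Circuit.state_eq_gatesMat]
  exact sum_norm_sq_column (gatesMat_mem_unitaryGroup hO _) _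

namespace Protocol

theorem prob_nonneg (O : ∀ i, Matrix (X i) (X i) ℂ) (T : Out → Prop) (P : Protocol X Out) :
    0 ≤ P.prob O T := by
  induction P with
  | done o => rw [prob]; split_ifs <;> norm_num
  | run c next ih =>
    rw [prob]
    exact Finset.sum_nonneg fun m _ => mul_nonneg (c.prob_nonneg O m) (ih m)

/-- Run the protocol `P` and continue with a protocol that depends on its output. -/
def bind : Protocol X Out → (Out → Protocol X Out') → Protocol X Out'
  | .done o, f => f o
  | .run c next, f => .run c fun m => (next m).bind f

/-- Condition on the first stage: whatever its outcome in `Q`, the continuation succeeds with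
probability at least `b`, because later runs are independent of earlier ones. -/
theorem prob_mul_le_prob_bind (O : ∀ i, Matrix (X i) (X i) ℂ) {Q : Out → Prop} {T : Out' → Prop}
    {b : ℝ} (P : Protocol X Out) {f : Out → Protocol X Out'}
    (hf : ∀ a, Q a → b ≤ (f a).prob O T) : P.prob O Q * b ≤ (P.bind f).prob O T := by
  induction P with
  | done o =>
    rw [prob, bind]
    split_ifs with h
    · simpa using hf o h
    · simpa using prob_nonneg O T (f o)
  | run c next ih =>
    rw [prob, bind, prob, Finset.sum_mul]
    refine Finset.sum_le_sum fun m _ => ?_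
    rw [mul_assoc]
    exact mul_le_mul_of_nonneg_left (ih m) (c.prob_nonneg O m)

theorem samples_bind_le {s : ℕ} (P : Protocol X Out) {f : Out → Protocol X Out'}
    (hf : ∀ a, (f a).samples ≤ s) : (P.bind f).samples ≤ P.samples + s := by
  induction P with
  | done o => simpa [bind, samples] using hf o
  | run c next ih =>
    rw [bind, samples, samples, add_assoc]
    refine Nat.add_le_add_left (Finset.sup_le fun m _ => (ih m).trans ?_) 1
    exact Nat.add_le_add_right
      (Finset.le_sup (f := fun m => (next m).samples) (Finset.mem_univ m)) s

theorem circuitQueries_bind_le (i : ι) {s : ℕ} (P : Protocol X Out) {f : Out → Protocol X Out'}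
    (hP : P.circuitQueries i ≤ s) (hf : ∀ a, (f a).circuitQueries i ≤ s) :
    (P.bind f).circuitQueries i ≤ s := by
  induction P with
  | done o => exact hf o
  | run c next ih =>
    rw [circuitQueries] at hP
    rw [bind, circuitQueries]
    refine max_le ((le_max_left _ _).trans hP) (Finset.sup_le fun m _ => ih m ?_)
    exact (Finset.le_sup (f := fun m => (next m).circuitQueries i) (Finset.mem_univ m)).trans
      ((le_max_right _ _).trans hP)

theorem totalQueries_le (i : ι) (P : Protocol X Out) :
    P.totalQueries i ≤ P.samples * P.circuitQueries i := by
  induction P with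
  | done o => simp [totalQueries]
  | run c next ih =>
    rw [totalQueries, samples, circuitQueries, add_mul, one_mul]
    refine Nat.add_le_add (le_max_left _ _) (Finset.sup_le fun m _ => (ih m).trans ?_)
    exact Nat.mul_le_mul (Finset.le_sup (f := fun m => (next m).samples) (Finset.mem_univ m))
      ((Finset.le_sup (f := fun m => (next m).circuitQueries i) (Finset.mem_univ m)).trans
        (le_max_right _ _))

theorem samples_iid_le (c : Circuit X) (n : ℕ) (f : (Fin n → c.M) → Out) :
    (iid c n f).samples ≤ n := by
  induction n with
  | zero => simp [iid, samples]
  | succ n ih =>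
    rw [iid, samples, add_comm]
    exact Nat.add_le_add_right (Finset.sup_le fun m _ => ih _) 1

theorem circuitQueries_iid_le (i : ι) (c : Circuit X) (n : ℕ) (f : (Fin n → c.M) → Out) :
    (iid c n f).circuitQueries i ≤ c.queries i := by
  induction n with
  | zero => simp [iid, circuitQueries]
  | succ n ih =>
    rw [iid, circuitQueries]
    exact max_le le_rfl (Finset.sup_le fun m _ => ih _)

theorem sum_pi_succ {M : Type} [Fintype M] {n : ℕ} (F : (Fin (n + 1) → M) → ℝ) :
    ∑ s, F s = ∑ m, ∑ s : Fin n → M, F (Fin.cons m s) := by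
  rw [← Fintype.sum_prod_type']
  exact (Fintype.sum_equiv (Fin.consEquiv fun _ => M) _ _ fun _ => rfl).symm

open Classical in
-- Unfolding the tree of runs gives the product measure on outcome sequences, on which the moment
-- computations take place.
theorem prob_iid (O : ∀ i, Matrix (X i) (X i) ℂ) (T : Out → Prop) (c : Circuit X) (n : ℕ)
    (f : (Fin n → c.M) → Out) : (iid c n f).prob O T =
      ∑ s : Fin n → c.M, (∏ i, c.prob O (s i)) * if T (f s) then 1 else 0 := by
  induction n with
  | zero =>
    rw [iid, prob, Fintype.sum_unique, Finset.univ_eq_empty, Finset.prod_empty, one_mul]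
    congr 3
  | succ n ih =>
    rw [iid, prob, sum_pi_succ]
    refine Finset.sum_congr rfl fun m _ => ?_
    rw [ih, Finset.mul_sum]
    refine Finset.sum_congr rfl fun s _ => ?_
    rw [Fin.prod_univ_succ, mul_assoc]
    rfl

end Protocol

/-! ### Empirical frequencies -/

section Frequencies

variable {M : Type} [Fintype M] {p : M → ℝ}

theorem sum_prod_eq_one (hp1 : ∑ m, p m = 1) (n : ℕ) : ∑ s : Fin n → M, ∏ i, p (s i) = 1 := by
  induction n with
  | zero => simp
  | succ n ih =>
    rw [Protocol.sum_pi_succ]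
    simp only [Fin.prod_univ_succ, Fin.cons_zero, Fin.cons_succ, ← Finset.mul_sum, ih, mul_one, hp1]

theorem sum_prod_mul_sum_eq_zero (hp1 : ∑ m, p m = 1) {h : M → ℝ} (hh : ∑ m, p m * h m = 0)
    (n : ℕ) : ∑ s : Fin n → M, (∏ i, p (s i)) * ∑ i, h (s i) = 0 := by
  induction n with
  | zero => simp
  | succ n ih =>
    rw [Protocol.sum_pi_succ]
    have : ∀ m, ∑ s : Fin n → M, (∏ i, p (Fin.cons (α := fun _ => M) m s i)) *
        ∑ i, h (Fin.cons (α := fun _ => M) m s i) = p m * h m := fun m => by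
      simp only [Fin.prod_univ_succ, Fin.sum_univ_succ, Fin.cons_zero, Fin.cons_succ, mul_add,
        Finset.sum_add_distrib, mul_assoc, ← Finset.mul_sum, ih, mul_zero, add_zero]
      rw [← Finset.sum_mul, sum_prod_eq_one hp1, one_mul]
    simp only [this, hh]

/-- Variances of independent centred variables add: splitting off the first outcome leaves a cross
term that vanishes by `sum_prod_mul_sum_eq_zero`. -/
theorem sum_prod_mul_sum_sq (hp1 : ∑ m, p m = 1) {h : M → ℝ} (hh : ∑ m, p m * h m = 0)
    (n : ℕ) : ∑ s : Fin n → M, (∏ i, p (s i)) * (∑ i, h (s i)) ^ 2 =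
      n * ∑ m, p m * h m ^ 2 := by
  induction n with
  | zero => simp
  | succ n ih =>
    rw [Protocol.sum_pi_succ]
    have : ∀ m, ∑ s : Fin n → M, (∏ i, p (Fin.cons (α := fun _ => M) m s i)) *
        (∑ i, h (Fin.cons (α := fun _ => M) m s i)) ^ 2 =
        p m * h m ^ 2 + p m * (n * ∑ m, p m * h m ^ 2) := fun m => by
      have e : ∀ s : Fin n → M, (∏ i, p (Fin.cons (α := fun _ => M) m s i)) *
          (∑ i, h (Fin.cons (α := fun _ => M) m s i)) ^ 2 =
          p m * h m ^ 2 * (∏ i, p (s i)) + 2 * p m * h m * ((∏ i, p (s i)) * ∑ i, h (s i)) +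
            p m * ((∏ i, p (s i)) * (∑ i, h (s i)) ^ 2) := fun s => by
        simp only [Fin.prod_univ_succ, Fin.sum_univ_succ, Fin.cons_zero, Fin.cons_succ]
        ring
      simp only [e, Finset.sum_add_distrib, ← Finset.mul_sum, ih, sum_prod_eq_one hp1,
        sum_prod_mul_sum_eq_zero hp1 hh]
      ring
    simp only [this, Finset.sum_add_distrib, ← Finset.sum_mul, hp1]
    push_cast
    ring

open Classical in
/-- The relative frequency of `m` among the outcomes `s`. -/
noncomputable def freq {n : ℕ} (s : Fin n → M) (m : M) : ℝ :=
  (n : ℝ)⁻¹ * ∑ i, if s i = m then 1 else 0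

/-- The frequency of `m` has variance `p m (1 - p m)/n ≤ p m / n`, and the `p m` sum to `1`. The
bound does not involve the number of outcomes, which is why the sample count is independent of the
number `N^D` of grid points. -/
theorem sum_prod_mul_freq_sub_sq_le (hp1 : ∑ m, p m = 1) {n : ℕ}
    (hn : 0 < n) : ∑ s : Fin n → M, (∏ i, p (s i)) * ∑ m, (freq s m - p m) ^ 2 ≤ (n : ℝ)⁻¹ := by
  classical
  have hn' : (n : ℝ) ≠ 0 := by exact_mod_cast hn.ne'
  have hn0 : (0 : ℝ) < n := by exact_mod_cast hn
  have e : ∀ (m : M) (s : Fin n → M), freq s m - p m =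
      (n : ℝ)⁻¹ * ∑ i, ((if s i = m then 1 else 0) - p m) := fun m s => by
    rw [freq, Finset.sum_sub_distrib, mul_sub, Finset.sum_const, Finset.card_univ,
      Fintype.card_fin, nsmul_eq_mul, inv_mul_cancel_left₀ hn']
  have hmean : ∀ m, ∑ x, p x * ((if x = m then 1 else 0) - p m) = 0 := fun m => by
    simp only [mul_sub, Finset.sum_sub_distrib, ← Finset.sum_mul, hp1]
    simp
  have hvar : ∀ m, ∑ x, p x * ((if x = m then 1 else 0) - p m) ^ 2 ≤ p m := fun m => by
    have e1 : ∀ x, p x * ((if x = m then (1 : ℝ) else 0) - p m) ^ 2 =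
        p x * (if x = m then 1 else 0) - 2 * p m * (p x * (if x = m then 1 else 0)) +
          p x * p m ^ 2 := fun x => by
      split_ifs <;> ring
    simp only [e1, Finset.sum_add_distrib, Finset.sum_sub_distrib, ← Finset.mul_sum,
      ← Finset.sum_mul, hp1]
    simp
    nlinarith [sq_nonneg (p m)]
  simp only [Finset.mul_sum, e]
  rw [Finset.sum_comm]
  have e2 : ∀ m, ∑ s : Fin n → M, (∏ i, p (s i)) *
      ((∑ i, (n : ℝ)⁻¹ * ((if s i = m then 1 else 0) - p m))) ^ 2 ≤ (n : ℝ)⁻¹ * p m := fun m => by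
    simp only [← Finset.mul_sum, mul_pow, mul_left_comm _ ((n : ℝ)⁻¹ ^ 2)]
    rw [sum_prod_mul_sum_sq hp1 (h := fun x => (if x = m then 1 else 0) - p m) (hmean m)]
    calc _ = (n : ℝ)⁻¹ * ∑ x, p x * ((if x = m then 1 else 0) - p m) ^ 2 := by
          field_simp
      _ ≤ _ := mul_le_mul_of_nonneg_left (hvar m) (by positivity)
  refine (Finset.sum_le_sum fun m _ => e2 m).trans ?_
  rw [← Finset.mul_sum, hp1, mul_one]

end Frequencies

/-- All frequencies are close to the probabilities with high probability, at once. -/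
theorem Protocol.le_prob_iid {O : ∀ i, Matrix (X i) (X i) ℂ} {c : Circuit X}
    (hc : ∑ m, c.prob O m = 1) {T : Out → Prop} {n : ℕ} {f : (Fin n → c.M) → Out} {τ β : ℝ}
    (hτ : 0 < τ) (hβ : 1 ≤ β * (n * τ ^ 2))
    (hf : ∀ s, (∀ m, |freq s m - c.prob O m| ≤ τ) → T (f s)) :
    1 - β ≤ (Protocol.iid c n f).prob O T := by
  classical
  have hn : 0 < n := by
    rcases Nat.eq_zero_or_pos n with rfl | h
    · norm_num at hβ
    · exact h
  have hn0 : (0 : ℝ) < n := by exact_mod_cast hn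
  have h1 := sum_prod_mul_freq_sub_sq_le hc hn
  -- Chebyshev's inequality in pointwise form: the indicator of success is at least `1 - τ^{-2} ∑
  -- (freq - prob)^2`, since one deviation beyond `τ` already makes the right side nonpositive.
  have h2 : ∀ s : Fin n → c.M, (∏ i, c.prob O (s i)) - (τ ^ 2)⁻¹ * ((∏ i, c.prob O (s i)) *
      ∑ m, (freq s m - c.prob O m) ^ 2) ≤
      (∏ i, c.prob O (s i)) * if T (f s) then 1 else 0 := fun s => by
    have hpr : 0 ≤ ∏ i, c.prob O (s i) := Finset.prod_nonneg fun i _ => c.prob_nonneg O _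
    have hsum : 0 ≤ ∑ m, (freq s m - c.prob O m) ^ 2 := Finset.sum_nonneg fun m _ => sq_nonneg _
    split_ifs with hT
    · have : 0 ≤ (τ ^ 2)⁻¹ * ((∏ i, c.prob O (s i)) * ∑ m, (freq s m - c.prob O m) ^ 2) := by
        positivity
      linarith
    · have hbad : ¬ ∀ m, |freq s m - c.prob O m| ≤ τ := fun h => hT (hf s h)
      push Not at hbad
      obtain ⟨m, hm⟩ := hbad
      have h3 : τ ^ 2 ≤ ∑ m, (freq s m - c.prob O m) ^ 2 := by
        refine le_trans ?_ (Finset.single_le_sum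
          (f := fun m => (freq s m - c.prob O m) ^ 2) (fun m _ => sq_nonneg _) (Finset.mem_univ m))
        rw [← sq_abs (freq s m - c.prob O m)]
        gcongr
      have h4 : 1 ≤ (τ ^ 2)⁻¹ * ∑ m, (freq s m - c.prob O m) ^ 2 := by
        rw [← div_eq_inv_mul, le_div_iff₀ (by positivity), one_mul]
        exact h3
      have h5 := mul_le_mul_of_nonneg_left h4 hpr
      linarith
  rw [Protocol.prob_iid]
  refine le_trans ?_ (Finset.sum_le_sum fun s _ => h2 s)
  rw [Finset.sum_sub_distrib, sum_prod_eq_one hc, ← Finset.mul_sum]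
  have h6 : (τ ^ 2)⁻¹ * (n : ℝ)⁻¹ ≤ β := by
    rw [← mul_inv, inv_le_iff_one_le_mul₀ (by positivity)]
    linarith
  have h7 := mul_le_mul_of_nonneg_left h1 (show 0 ≤ (τ ^ 2)⁻¹ by positivity)
  linarith

end Protocols

end GQPE

namespace GQPE

/-! ### Products of block-encodings with separate ancillas -/

section BaseCircuit

variable {D : ℕ} {S : Type} [Fintype S] [DecidableEq S]
  {A : Fin (D + 1) → Type} [∀ j, Fintype (A j)] [∀ j, DecidableEq (A j)]

instance Reg.instFintype : ∀ i : Oracle D, Fintype (Reg S A i)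
  | .evo => inferInstanceAs (Fintype S)
  | .prep => inferInstanceAs (Fintype S)
  | .block j => inferInstanceAs (Fintype (A j × S))

instance Reg.instDecidableEq : ∀ i : Oracle D, DecidableEq (Reg S A i)
  | .evo => inferInstanceAs (DecidableEq S)
  | .prep => inferInstanceAs (DecidableEq S)
  | .block j => inferInstanceAs (DecidableEq (A j × S))

/-- The memory of the system and the ancillas of all block-encodings. -/
abbrev SysMem (S : Type) (A : Fin (D + 1) → Type) : Type := (∀ j, A j) × S

/-- A query to the time evolution. -/
def evoGate (inv : Bool) : Gate (Reg S A) (SysMem S A) :=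
  .query .evo inv (∀ j, A j) (Equiv.prodComm _ _) fun _ => true

/-- A query to the state preparation. -/
def prepGate (inv : Bool) : Gate (Reg S A) (SysMem S A) :=
  .query .prep inv (∀ j, A j) (Equiv.prodComm _ _) fun _ => true

/-- The memory, split into the register of the block-encoding `j` and the other ancillas. -/
def splitBlock (j : Fin (D + 1)) : SysMem S A ≃ (A j × S) × ∀ i : {i // i ≠ j}, A i :=
  ((Equiv.piSplitAt j A).prodCongr (Equiv.refl S)).trans
    ⟨fun x => ((x.1.1, x.2), x.1.2), fun x => ((x.1.1, x.2), x.1.2), fun _ => rfl, fun _ => rfl⟩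

/-- A query to the block-encoding `j`. -/
def blockGate (j : Fin (D + 1)) : Gate (Reg S A) (SysMem S A) :=
  .query (.block j) false (∀ i : {i // i ≠ j}, A i) (splitBlock j) fun _ => true

/-- On states whose ancillas `j < t'` (resp. `j < t`) are in the reference state, and after
projection of the ancillas onto the reference state, the matrix `B` acts as `Y`. -/
def Lifts (a0 : ∀ j, A j) (t' t : ℕ) (B : Matrix (SysMem S A) (SysMem S A) ℂ) (Y : Matrix S S ℂ) :
    Prop :=
  ∀ (ψ : SysMem S A → ℂ) (φ : S → ℂ),
    (∀ a s, (∃ j : Fin (D + 1), j.val < t' ∧ a j ≠ a0 j) → ψ (a, s) = 0) →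
    (∀ s, ψ (a0, s) = φ s) →
    (∀ a s, (∃ j : Fin (D + 1), j.val < t ∧ a j ≠ a0 j) → B.mulVec ψ (a, s) = 0) ∧
      ∀ s, B.mulVec ψ (a0, s) = Y.mulVec φ s

variable {a0 : ∀ j, A j}

theorem Lifts.one (t : ℕ) : Lifts a0 t t (1 : Matrix (SysMem S A) (SysMem S A) ℂ) 1 := by
  intro ψ φ h1 h2
  simpa using ⟨fun a s => by simpa using h1 a s, h2⟩

theorem Lifts.mul {t1 t2 t3 : ℕ} {B B' : Matrix (SysMem S A) (SysMem S A) ℂ}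
    {Y Y' : Matrix S S ℂ} (h' : Lifts a0 t2 t3 B' Y') (h : Lifts a0 t1 t2 B Y) :
    Lifts a0 t1 t3 (B' * B) (Y' * Y) := by
  intro ψ φ h1 h2
  obtain ⟨h3, h4⟩ := h ψ φ h1 h2
  have h5 := h' _ _ h3 h4
  rwa [Matrix.mulVec_mulVec, Matrix.mulVec_mulVec] at h5

theorem Lifts.pow {t : ℕ} {B : Matrix (SysMem S A) (SysMem S A) ℂ} {Y : Matrix S S ℂ}
    (h : Lifts a0 t t B Y) (k : ℕ) : Lifts a0 t t (B ^ k) (Y ^ k) := by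
  induction k with
  | zero => simpa using Lifts.one t
  | succ k ih => rw [pow_succ, pow_succ]; exact ih.mul h

/-- The rightmost factor acts first and has the largest index, so the threshold below which the
ancillas are fresh descends from `s + n` to `s`. -/
theorem Lifts.prod_ofFn {n s : ℕ} {B : Fin n → Matrix (SysMem S A) (SysMem S A) ℂ}
    {Y : Fin n → Matrix S S ℂ}
    (h : ∀ j : Fin n, Lifts a0 (s + j.val + 1) (s + j.val) (B j) (Y j)) :
    Lifts a0 (s + n) s (List.ofFn B).prod (List.ofFn Y).prod := by
  induction n generalizing s with
  | zero => simpa using Lifts.one s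
  | succ n ih =>
    rw [List.ofFn_succ, List.ofFn_succ, List.prod_cons, List.prod_cons]
    have h0 : Lifts a0 (s + 1) s (B 0) (Y 0) := by simpa using h 0
    refine h0.mul ?_
    have := ih (s := s + 1) (B := fun j => B j.succ) (Y := fun j => Y j.succ) fun j => by
      have := h j.succ
      rw [Fin.val_succ] at this
      convert this using 1 <;> ring
    convert this using 1
    ring

/-- The matrix `Y` on the system, extended to the whole memory. -/
theorem lifts_system {t : ℕ} {B : Matrix (SysMem S A) (SysMem S A) ℂ} {Y : Matrix S S ℂ}
    (hB : ∀ a s a' s', B (a, s) (a', s') = if a = a' then Y s s' else 0) : Lifts a0 t t B Y := by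
  have key : ∀ (ψ : SysMem S A → ℂ) a s, B.mulVec ψ (a, s) = ∑ s', Y s s' * ψ (a, s') := by
    intro ψ a s
    rw [Matrix.mulVec, dotProduct, Fintype.sum_prod_type, Finset.sum_eq_single a]
    · simp [hB]
    · intro a' _ h
      simp [hB, h.symm]
    · simp
  intro ψ φ h1 h2
  refine ⟨fun a s h => ?_, fun s => ?_⟩
  · rw [key]
    exact Finset.sum_eq_zero fun s' _ => by rw [h1 a s' h, mul_zero]
  · rw [key, Matrix.mulVec, dotProduct]
    exact Finset.sum_congr rfl fun s' _ => by rw [h2]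

/-- Block-encoding `j` needs its own ancilla fresh and leaves the others alone. The component of the
output on the reference state therefore comes only from inputs in the reference state, even if
ancillas above `j` have already been used. -/
theorem lifts_block {j : Fin (D + 1)} {B : Matrix (SysMem S A) (SysMem S A) ℂ}
    {U : Matrix (A j × S) (A j × S) ℂ} {Y : Matrix S S ℂ}
    (hB : ∀ a s a' s', B (a, s) (a', s') =
      if ∀ i, i ≠ j → a i = a' i then U (a j, s) (a' j, s') else 0)
    (hU : ∀ s s', U (a0 j, s) (a0 j, s') = Y s s') : Lifts a0 (j.val + 1) j.val B Y := by
  intro ψ φ h1 h2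
  refine ⟨fun a s ⟨i, hi, hai⟩ => ?_, fun s => ?_⟩
  · rw [Matrix.mulVec, dotProduct]
    refine Finset.sum_eq_zero fun x _ => ?_
    obtain ⟨a', s'⟩ := x
    rw [hB]
    split_ifs with h
    · have hij : i ≠ j := fun h => by simp [h] at hi
      rw [h1 a' s' ⟨i, by omega, by rw [← h i hij]; exact hai⟩, mul_zero]
    · rw [zero_mul]
  · rw [Matrix.mulVec, dotProduct, Fintype.sum_prod_type, Finset.sum_eq_single a0]
    · rw [Matrix.mulVec, dotProduct]
      exact Finset.sum_congr rfl fun s' _ => by rw [hB, if_pos fun _ _ => rfl, hU, h2]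
    · intro a' _ ha'
      refine Finset.sum_eq_zero fun s' _ => ?_
      rw [hB]
      split_ifs with h
      · have : a' j ≠ a0 j := fun hj => ha' (funext fun i => by
          by_cases hi : i = j
          · rw [hi, hj]
          · exact (h i hi).symm)
        rw [h1 a' s' ⟨j, by omega, this⟩, mul_zero]
      · rw [zero_mul]
    · simp

theorem evoGate_mat_apply (O : ∀ i, Matrix (Reg S A i) (Reg S A i) ℂ) (inv : Bool)
    (a : ∀ j, A j) (s : S) (a' : ∀ j, A j) (s' : S) :
    (evoGate inv : Gate (Reg S A) _).mat O (a, s) (a', s') =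
      if a = a' then (if inv then (O .evo).conjTranspose else O .evo) s s' else 0 := by
  simp only [evoGate, Gate.mat, Matrix.submatrix_apply, Matrix.blockDiagonal_apply, if_true]
  by_cases h : a = a'
  · rw [if_pos h]
    exact if_pos h
  · rw [if_neg h]
    exact if_neg h

theorem prepGate_mat_apply (O : ∀ i, Matrix (Reg S A i) (Reg S A i) ℂ) (inv : Bool)
    (a : ∀ j, A j) (s : S) (a' : ∀ j, A j) (s' : S) :
    (prepGate inv : Gate (Reg S A) _).mat O (a, s) (a', s') =
      if a = a' then (if inv then (O .prep).conjTranspose else O .prep) s s' else 0 := by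
  simp only [prepGate, Gate.mat, Matrix.submatrix_apply, Matrix.blockDiagonal_apply, if_true]
  by_cases h : a = a'
  · rw [if_pos h]
    exact if_pos h
  · rw [if_neg h]
    exact if_neg h

theorem blockGate_mat_apply (O : ∀ i, Matrix (Reg S A i) (Reg S A i) ℂ) (j : Fin (D + 1))
    (a : ∀ j, A j) (s : S) (a' : ∀ j, A j) (s' : S) :
    (blockGate j : Gate (Reg S A) _).mat O (a, s) (a', s') =
      if ∀ i, i ≠ j → a i = a' i then O (.block j) (a j, s) (a' j, s') else 0 := by
  have h : (∀ i, i ≠ j → a i = a' i) ↔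
      (fun i : {i // i ≠ j} => a i) = fun i : {i // i ≠ j} => a' i := by
    simp [funext_iff]
  simp only [h]
  simp only [blockGate, Gate.mat, Matrix.submatrix_apply, Matrix.blockDiagonal_apply, if_true,
    Bool.false_eq_true, if_false]
  by_cases h : (fun i : {i // i ≠ j} => a i) = fun i : {i // i ≠ j} => a' i
  · rw [if_pos h]
    exact if_pos h
  · rw [if_neg h]
    exact if_neg h

/-! ### The gates of the base circuit -/

variable {N : ℕ}

/-- The gates that multiply by `e^{iqH} V⁽ʲ⁾ e^{-iqH}` with the content `q` of the frequency
register that belongs to `j`. -/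
def segmentGates (S : Type) [Fintype S] [DecidableEq S] (A : Fin (D + 1) → Type)
    [∀ j, Fintype (A j)] [∀ j, DecidableEq (A j)] (N : ℕ) (j : Fin D) :
    List (Gate (Reg S A) (SysMem S A × (Fin D → Fin N))) :=
  powerGates N (fun q => (q j.rev).val) [evoGate true] ++
    [blockGate j.castSucc].map (Gate.control fun _ => true) ++
    powerGates N (fun q => (q j.rev).val) [evoGate false]

/-- The oracle calls of the base circuit. -/
def coreGates (S : Type) [Fintype S] [DecidableEq S] (A : Fin (D + 1) → Type)
    [∀ j, Fintype (A j)] [∀ j, DecidableEq (A j)] (N : ℕ) :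
    List (Gate (Reg S A) (SysMem S A × (Fin D → Fin N))) :=
  [prepGate false, blockGate (Fin.last D)].map (Gate.control fun _ => true) ++
    (List.ofFn (segmentGates S A N)).reverse.flatten ++
    [prepGate true].map (Gate.control fun _ => true)

theorem gatesMat_segmentGates (O : ∀ i, Matrix (Reg S A i) (Reg S A i) ℂ) (j : Fin D) :
    gatesMat O (segmentGates S A N j) = Matrix.blockDiagonal fun q : Fin D → Fin N =>
      (evoGate false).mat O ^ (q j.rev).val *
        ((blockGate j.castSucc).mat O * (evoGate true).mat O ^ (q j.rev).val) := by
  rw [segmentGates, gatesMat_append, gatesMat_append, gatesMat_map_control,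
    gatesMat_powerGates O (fun q => (q j.rev).2.le), gatesMat_powerGates O (fun q => (q j.rev).2.le),
    ← Matrix.blockDiagonal_mul, ← Matrix.blockDiagonal_mul]
  simp only [if_true, gatesMat_singleton]

theorem prod_ofFn_blockDiagonal {M Q : Type} [Fintype M] [DecidableEq M] [Fintype Q]
    [DecidableEq Q] {n : ℕ} (B : Fin n → Q → Matrix M M ℂ) :
    (List.ofFn fun j => Matrix.blockDiagonal (B j)).prod =
      Matrix.blockDiagonal fun q => (List.ofFn fun j => B j q).prod := by
  induction n with
  | zero =>
    simp only [List.ofFn_zero, List.prod_nil]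
    exact Matrix.blockDiagonal_one.symm
  | succ n ih =>
    simp only [List.ofFn_succ, List.prod_cons, ih (fun j => B j.succ)]
    rw [← Matrix.blockDiagonal_mul]

theorem gatesMat_coreGates (O : ∀ i, Matrix (Reg S A i) (Reg S A i) ℂ) :
    gatesMat O (coreGates S A N) = Matrix.blockDiagonal fun q : Fin D → Fin N =>
      (prepGate true).mat O * ((List.ofFn fun j : Fin D =>
      (evoGate false).mat O ^ (q j.rev).val *
        ((blockGate j.castSucc).mat O * (evoGate true).mat O ^ (q j.rev).val)).prod *
        ((blockGate (Fin.last D)).mat O * (prepGate false).mat O)) := by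
  have h : (gatesMat O ∘ segmentGates S A N) = fun j => Matrix.blockDiagonal fun q =>
      (evoGate false).mat O ^ (q j.rev).val *
        ((blockGate j.castSucc).mat O * (evoGate true).mat O ^ (q j.rev).val) :=
    funext fun j => gatesMat_segmentGates O j
  rw [coreGates, gatesMat_append, gatesMat_append, gatesMat_map_control, gatesMat_map_control,
    gatesMat_flatten_reverse, List.map_ofFn, h, prod_ofFn_blockDiagonal,
    ← Matrix.blockDiagonal_mul, ← Matrix.blockDiagonal_mul]
  simp only [if_true, gatesMat, one_mul]

/-- Each of the `D` segments uses `N` controlled queries to the inverse evolution and `N` to the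
evolution, whatever the time register contains. -/
theorem gatesQueries_coreGates (i : Oracle D) : gatesQueries i (coreGates S A N) =
    gatesQueries i [(prepGate false : Gate (Reg S A) (SysMem S A)), blockGate (Fin.last D),
      prepGate true] + ∑ j : Fin D, (N * gatesQueries i [(evoGate true : Gate (Reg S A) _)] +
      gatesQueries i [(blockGate j.castSucc : Gate (Reg S A) _)] +
      N * gatesQueries i [(evoGate false : Gate (Reg S A) _)]) := by
  rw [coreGates, gatesQueries_append, gatesQueries_append, gatesQueries_map_control,
    gatesQueries_map_control, gatesQueries_flatten, List.map_reverse, List.sum_reverse,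
    List.map_ofFn, List.sum_ofFn]
  simp only [Function.comp_apply, segmentGates, gatesQueries_append, gatesQueries_powerGates,
    gatesQueries_map_control, gatesQueries_cons, gatesQueries_nil]
  ring

theorem gatesQueries_evo_coreGates : gatesQueries .evo (coreGates S A N) = 2 * D * N := by
  rw [gatesQueries_coreGates]
  simp [gatesQueries_cons, gatesQueries_nil, Gate.queries, evoGate, blockGate, prepGate]
  ring

theorem gatesQueries_prep_coreGates : gatesQueries .prep (coreGates S A N) = 2 := by
  rw [gatesQueries_coreGates]
  simp [gatesQueries_cons, gatesQueries_nil, Gate.queries, evoGate, blockGate, prepGate]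

theorem gatesQueries_block_coreGates (j : Fin (D + 1)) :
    gatesQueries (.block j) (coreGates S A N) = 1 := by
  rw [gatesQueries_coreGates]
  simp only [gatesQueries_cons, gatesQueries_nil, Gate.queries, evoGate, blockGate, prepGate]
  simp only [Oracle.block.injEq, reduceCtorEq, if_false, zero_add, add_zero, mul_zero]
  have h := Fin.sum_univ_castSucc fun i : Fin (D + 1) => if i = j then 1 else 0
  rw [Finset.sum_ite_eq' Finset.univ j fun _ => 1, if_pos (Finset.mem_univ j)] at h
  omega

end BaseCircuit

end GQPE

namespace GQPE

/-! ### The correlation function as an amplitude -/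

section Correlation

variable {D : ℕ} {S : Type} [Fintype S] [DecidableEq S] {s0 : S}
  {A : Fin (D + 1) → Type} [∀ j, Fintype (A j)] [∀ j, DecidableEq (A j)] {a0 : ∀ j, A j}
  {ν : Fin (D + 1) → ℝ}

namespace System

theorem conjTranspose_eigvec_mul (σ : System D S s0 A a0 ν) :
    (σ.eigvec : Matrix S S ℂ).conjTranspose * (σ.eigvec : Matrix S S ℂ) = 1 :=
  Matrix.mem_unitaryGroup_iff'.mp σ.eigvec.2

theorem eigvec_mul_conjTranspose (σ : System D S s0 A a0 ν) :
    (σ.eigvec : Matrix S S ℂ) * (σ.eigvec : Matrix S S ℂ).conjTranspose = 1 :=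
  Matrix.mem_unitaryGroup_iff.mp σ.eigvec.2

theorem oracle_evo_eq (σ : System D S s0 A a0 ν) : σ.oracle .evo =
    ((σ.eigvec : Matrix S S ℂ) * Matrix.diagonal (fun n => Complex.exp (Complex.I * σ.energy n)) *
      (σ.eigvec : Matrix S S ℂ).conjTranspose : Matrix S S ℂ) := by
  have hinv : (σ.eigvec : Matrix S S ℂ)⁻¹ = (σ.eigvec : Matrix S S ℂ).conjTranspose :=
    Matrix.inv_eq_right_inv σ.eigvec_mul_conjTranspose
  have hu : IsUnit (σ.eigvec : Matrix S S ℂ) :=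
    IsUnit.of_mul_eq_one _ σ.eigvec_mul_conjTranspose
  have h : (Complex.I • σ.H) = (σ.eigvec : Matrix S S ℂ) *
      Matrix.diagonal (fun n => Complex.I * (σ.energy n : ℂ)) * (σ.eigvec : Matrix S S ℂ)⁻¹ := by
    rw [hinv, σ.spectral, ← Matrix.smul_mul, ← Matrix.mul_smul, ← Matrix.diagonal_smul]
    rfl
  have h2 : σ.oracle .evo = (NormedSpace.exp (Complex.I • σ.H) : Matrix S S ℂ) := rfl
  rw [h2, h, Matrix.exp_conj _ _ hu, Matrix.exp_diagonal, hinv]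
  congr 3
  funext n
  rw [Pi.coe_exp, Complex.exp_eq_exp_ℂ]

theorem oracle_evo_pow (σ : System D S s0 A a0 ν) (k : ℕ) :
    (show Matrix S S ℂ from σ.oracle .evo) ^ k =
    (σ.eigvec : Matrix S S ℂ) *
      Matrix.diagonal (fun n => Complex.exp (Complex.I * k * σ.energy n)) *
      (σ.eigvec : Matrix S S ℂ).conjTranspose := by
  rw [oracle_evo_eq]
  have : ∀ k : ℕ, ((σ.eigvec : Matrix S S ℂ) *
      Matrix.diagonal (fun n => Complex.exp (Complex.I * σ.energy n)) *
      (σ.eigvec : Matrix S S ℂ).conjTranspose) ^ k = (σ.eigvec : Matrix S S ℂ) *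
      Matrix.diagonal (fun n => Complex.exp (Complex.I * σ.energy n)) ^ k *
      (σ.eigvec : Matrix S S ℂ).conjTranspose := by
    intro k
    induction k with
    | zero => simp [eigvec_mul_conjTranspose]
    | succ k ih =>
      rw [pow_succ, ih, pow_succ]
      simp only [Matrix.mul_assoc]
      rw [← Matrix.mul_assoc _ (σ.eigvec : Matrix S S ℂ), conjTranspose_eigvec_mul, Matrix.one_mul]
  rw [this, Matrix.diagonal_pow]
  congr 3
  funext n
  rw [Pi.pow_apply, ← Complex.exp_nat_mul]
  congr 1
  ring

theorem oracle_evo_conjTranspose_pow (σ : System D S s0 A a0 ν) (k : ℕ) :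
    (show Matrix S S ℂ from σ.oracle .evo).conjTranspose ^ k = (σ.eigvec : Matrix S S ℂ) *
      Matrix.diagonal (fun n => Complex.exp (-(Complex.I * k * σ.energy n))) *
      (σ.eigvec : Matrix S S ℂ).conjTranspose := by
  rw [← Matrix.conjTranspose_pow, oracle_evo_pow, Matrix.conjTranspose_mul,
    Matrix.conjTranspose_mul, Matrix.conjTranspose_conjTranspose, Matrix.diagonal_conjTranspose,
    Matrix.mul_assoc]
  congr 3
  funext n
  rw [Pi.star_apply, Complex.star_def, ← Complex.exp_conj]
  simp

theorem oracle_mem_unitaryGroup (σ : System D S s0 A a0 ν) (i : Oracle D) :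
    σ.oracle i ∈ Matrix.unitaryGroup (Reg S A i) ℂ := by
  cases i with
  | prep => exact σ.prep.2
  | block j => exact (σ.block j).2
  | evo =>
    have h : (show Matrix S S ℂ from σ.oracle .evo) ∈ Matrix.unitaryGroup S ℂ := by
      have h1 := σ.oracle_evo_pow 1
      have h2 := σ.oracle_evo_conjTranspose_pow 1
      rw [pow_one] at h1 h2
      rw [Matrix.mem_unitaryGroup_iff, Matrix.star_eq_conjTranspose, h2, h1]
      simp only [Matrix.mul_assoc]
      rw [← Matrix.mul_assoc _ (σ.eigvec : Matrix S S ℂ), conjTranspose_eigvec_mul, Matrix.one_mul,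
        ← Matrix.mul_assoc (Matrix.diagonal _), Matrix.diagonal_mul_diagonal]
      simp only [← Complex.exp_add, add_neg_cancel, Complex.exp_zero, Matrix.diagonal_one,
        Matrix.one_mul, eigvec_mul_conjTranspose]
    exact h

/-- The matrix of `e^{ikH} V⁽ʲ⁾ e^{-ikH} / ν j` in the eigenbasis. -/
noncomputable def rotated (σ : System D S s0 A a0 ν) (j : Fin (D + 1)) (k : ℕ) : Matrix S S ℂ :=
  Matrix.of fun m n => (ν j : ℂ)⁻¹ *
    (σ.elem j m n * Complex.exp (Complex.I * k * ((σ.energy m - σ.energy n : ℝ) : ℂ)))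

/-- In the eigenbasis the Heisenberg evolution multiplies the `(m, n)` entry by the phase `e^{ik(λ_m
- λ_n)}`, the phase that the window sums over. -/
theorem evolved_eq_rotated (σ : System D S s0 A a0 ν) (j : Fin (D + 1)) (k : ℕ) :
    (show Matrix S S ℂ from σ.oracle .evo) ^ k *
      (((ν j : ℂ)⁻¹ • σ.V j) * (show Matrix S S ℂ from σ.oracle .evo).conjTranspose ^ k) =
    (σ.eigvec : Matrix S S ℂ) * σ.rotated j k * (σ.eigvec : Matrix S S ℂ).conjTranspose := by
  have h : σ.rotated j k = Matrix.diagonal (fun n => Complex.exp (Complex.I * k * σ.energy n)) *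
      ((ν j : ℂ)⁻¹ • ((σ.eigvec : Matrix S S ℂ).conjTranspose * σ.V j *
        (σ.eigvec : Matrix S S ℂ))) *
      Matrix.diagonal (fun n => Complex.exp (-(Complex.I * k * σ.energy n))) := by
    ext m n
    rw [Matrix.mul_diagonal, Matrix.diagonal_mul, Matrix.smul_apply, rotated, Matrix.of_apply, elem]
    push_cast
    rw [mul_sub, sub_eq_add_neg, Complex.exp_add, smul_eq_mul]
    ring
  rw [oracle_evo_pow, oracle_evo_conjTranspose_pow, h]
  simp only [Matrix.mul_assoc, Matrix.smul_mul, Matrix.mul_smul]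

/-- Only column `s0` of the preparation enters, and it equals the eigenvector column `n0`; the other
columns are arbitrary. -/
theorem prep_sandwich (σ : System D S s0 A a0 ν) (B : Matrix S S ℂ) :
    ((σ.prep : Matrix S S ℂ).conjTranspose * (B * (σ.prep : Matrix S S ℂ))) s0 s0 =
      ((σ.eigvec : Matrix S S ℂ).conjTranspose * (B * (σ.eigvec : Matrix S S ℂ))) σ.n0 σ.n0 := by
  simp only [Matrix.mul_apply, Matrix.conjTranspose_apply, σ.prep_spec]

end System

/-- Adjacent factors `W' W` cancel; the other identity serves the empty product. -/
theorem prod_ofFn_conj {n : ℕ} {W W' : Matrix S S ℂ} (h : W' * W = 1) (h' : W * W' = 1)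
    (Z : Fin n → Matrix S S ℂ) :
    (List.ofFn fun j => W * Z j * W').prod = W * (List.ofFn Z).prod * W' := by
  induction n with
  | zero => simp [h']
  | succ n ih =>
    rw [List.ofFn_succ, List.ofFn_succ, List.prod_cons, List.prod_cons, ih]
    simp only [Matrix.mul_assoc]
    rw [← Matrix.mul_assoc W' W, h, Matrix.one_mul]

/-- The entries of a matrix product are sums over paths. -/
theorem prod_ofFn_mul_apply {n : ℕ} (Z : Fin n → Matrix S S ℂ) (B : Matrix S S ℂ) (x y : S) :
    ((List.ofFn Z).prod * B) x y = ∑ t : Fin n → S,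
      (∏ j : Fin n, Z j ((Fin.cons x t : Fin (n + 1) → S) j.castSucc)
        ((Fin.cons x t : Fin (n + 1) → S) j.succ)) *
        B ((Fin.cons x t : Fin (n + 1) → S) (Fin.last n)) y := by
  induction n generalizing x with
  | zero => simp [Fin.last]
  | succ n ih =>
    rw [List.ofFn_succ, List.prod_cons, Matrix.mul_assoc, Matrix.mul_apply,
      ← (Fin.consEquiv fun _ => S).sum_comp, Fintype.sum_prod_type]
    refine Finset.sum_congr rfl fun z _ => ?_
    rw [ih, Finset.mul_sum]
    refine Finset.sum_congr rfl fun t _ => ?_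
    simp only [Fin.consEquiv_apply, Fin.prod_univ_succ, Fin.castSucc_zero, Fin.cons_zero,
      Fin.cons_succ, ← Fin.succ_castSucc, ← Fin.succ_last, mul_assoc]

theorem Lifts.apply_eq {B : Matrix (SysMem S A) (SysMem S A) ℂ} {Y : Matrix S S ℂ} {t' t : ℕ}
    (h : Lifts a0 t' t B Y) (s s' : S) : B (a0, s) (a0, s') = Y s s' := by
  have h1 := (h (Pi.single (a0, s') 1) (Pi.single s' 1) (fun a s ⟨j, _, hj⟩ => ?_) fun s => ?_).2 s
  · simpa using h1
  · rw [Pi.single_eq_of_ne]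
    rintro h
    exact hj (congrFun (Prod.ext_iff.mp h).1 j)
  · simp [Pi.single_apply]

/-- For fixed times `q` the reference amplitude is the expectation of a product of evolved operators
in `|λ_{n0}⟩`. In the eigenbasis it is a sum over paths `n₀, n₁, …, n_D`, as in the definition of
`R`. -/
theorem block_amplitude (σ : System D S s0 A a0 ν) {N : ℕ} (q : Fin D → Fin N) :
    ((prepGate true).mat σ.oracle * ((List.ofFn fun j : Fin D =>
      (evoGate false).mat σ.oracle ^ (q j.rev).val *
        ((blockGate j.castSucc).mat σ.oracle * (evoGate true).mat σ.oracle ^ (q j.rev).val)).prod *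
        ((blockGate (Fin.last D)).mat σ.oracle * (prepGate false).mat σ.oracle)))
      ((a0, s0) : SysMem S A) (a0, s0) =
    ∑ t : Fin D → S, (∏ j : Fin D, σ.rotated j.castSucc (q j.rev).val
      ((Fin.cons σ.n0 t : Fin (D + 1) → S) j.castSucc)
      ((Fin.cons σ.n0 t : Fin (D + 1) → S) j.succ)) *
      ((ν (Fin.last D) : ℂ)⁻¹ *
        σ.elem (Fin.last D) ((Fin.cons σ.n0 t : Fin (D + 1) → S) (Fin.last D)) σ.n0) := by
  set E : Matrix S S ℂ := σ.oracle .evo with hE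
  have hprep : ∀ t, Lifts a0 t t ((prepGate false).mat σ.oracle) (σ.prep : Matrix S S ℂ) :=
    fun t => lifts_system fun a s a' s' => by rw [prepGate_mat_apply]; rfl
  have hprep' : ∀ t, Lifts a0 t t ((prepGate true).mat σ.oracle)
      (σ.prep : Matrix S S ℂ).conjTranspose :=
    fun t => lifts_system fun a s a' s' => by rw [prepGate_mat_apply]; rfl
  have hevo : ∀ t, Lifts a0 t t ((evoGate false).mat σ.oracle) E :=
    fun t => lifts_system fun a s a' s' => by rw [evoGate_mat_apply]; rfl
  have hevo' : ∀ t, Lifts a0 t t ((evoGate true).mat σ.oracle) E.conjTranspose :=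
    fun t => lifts_system fun a s a' s' => by rw [evoGate_mat_apply]; rfl
  have hblock : ∀ j : Fin (D + 1), Lifts a0 (j.val + 1) j.val ((blockGate j).mat σ.oracle)
      ((ν j : ℂ)⁻¹ • σ.V j) := fun j => lifts_block (blockGate_mat_apply σ.oracle j) fun s s' => by
    rw [Matrix.smul_apply, smul_eq_mul, ← div_eq_inv_mul]
    exact σ.block_spec j s s'
  have hprod : Lifts a0 (0 + D) 0 (List.ofFn fun j : Fin D =>
      (evoGate false).mat σ.oracle ^ (q j.rev).val *
        ((blockGate j.castSucc).mat σ.oracle * (evoGate true).mat σ.oracle ^ (q j.rev).val)).prod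
      (List.ofFn fun j : Fin D => E ^ (q j.rev).val *
        (((ν j.castSucc : ℂ)⁻¹ • σ.V j.castSucc) * E.conjTranspose ^ (q j.rev).val)).prod := by
    refine Lifts.prod_ofFn fun j => ?_
    rw [zero_add]
    exact ((hevo _).pow _).mul ((hblock j.castSucc).mul ((hevo' _).pow _))
  rw [zero_add] at hprod
  -- Read from right to left: the preparation finds all `D + 1` ancillas fresh, and the blocks `D,
  -- D-1, …, 0` use them up one by one.
  have hall := (hprep' 0).mul (hprod.mul ((hblock (Fin.last D)).mul (hprep (D + 1))))
  rw [hall.apply_eq]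
  simp only [hE, σ.evolved_eq_rotated]
  rw [prod_ofFn_conj σ.conjTranspose_eigvec_mul σ.eigvec_mul_conjTranspose,
    ← Matrix.mul_assoc _ _ (σ.prep : Matrix S S ℂ), σ.prep_sandwich]
  have hfin : (σ.eigvec : Matrix S S ℂ).conjTranspose *
      ((σ.eigvec : Matrix S S ℂ) *
        (List.ofFn fun j : Fin D => σ.rotated j.castSucc (q j.rev).val).prod *
        (σ.eigvec : Matrix S S ℂ).conjTranspose *
        ((ν (Fin.last D) : ℂ)⁻¹ • σ.V (Fin.last D)) * (σ.eigvec : Matrix S S ℂ)) =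
      (List.ofFn fun j : Fin D => σ.rotated j.castSucc (q j.rev).val).prod *
      ((ν (Fin.last D) : ℂ)⁻¹ • ((σ.eigvec : Matrix S S ℂ).conjTranspose * σ.V (Fin.last D) *
        (σ.eigvec : Matrix S S ℂ))) := by
    simp only [Matrix.mul_assoc, Matrix.smul_mul, Matrix.mul_smul]
    rw [← Matrix.mul_assoc _ (σ.eigvec : Matrix S S ℂ), σ.conjTranspose_eigvec_mul, Matrix.one_mul]
  rw [hfin, prod_ofFn_mul_apply]
  rfl

/-- The general shape of the circuits here: load weights into a control register, act depending on
its content, and mix its basis states at the end. -/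
theorem kronecker_block_kronecker_apply {M Q : Type} [Fintype M] [DecidableEq M] [Fintype Q]
    [DecidableEq Q] (F W : Matrix Q Q ℂ) (T : Q → Matrix M M ℂ) (x y : M) (m q0 : Q) :
    (Matrix.kroneckerMap (· * ·) (1 : Matrix M M ℂ) F * (Matrix.blockDiagonal T *
      Matrix.kroneckerMap (· * ·) (1 : Matrix M M ℂ) W)) (x, m) (y, q0) =
      ∑ q, F m q * T q x y * W q q0 := by
  have h1 : ∀ (x' : M) (q : Q), (Matrix.blockDiagonal T *
      Matrix.kroneckerMap (· * ·) (1 : Matrix M M ℂ) W) (x', q) (y, q0) =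
      T q x' y * W q q0 := by
    intro x' q
    rw [Matrix.mul_apply, Fintype.sum_prod_type, Finset.sum_eq_single y, Finset.sum_eq_single q]
    · simp [Matrix.blockDiagonal_apply]
    · intro q' _ h
      simp [Matrix.blockDiagonal_apply, h.symm]
    · simp
    · intro z _ h
      simp [h]
    · simp
  rw [Matrix.mul_apply, Fintype.sum_prod_type, Finset.sum_eq_single x]
  · simp only [h1, Matrix.kroneckerMap_apply, Matrix.one_apply_eq, one_mul, mul_assoc]
  · intro z _ h
    simp [Matrix.one_apply_ne h.symm]
  · simp

/-- A product of functions of separate registers sums register by register. The reversal reflects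
that the factor `j` of `R` carries the frequency `ω j.rev`. -/
theorem sum_prod_rev {D N : ℕ} (g : Fin D → Fin N → ℂ) :
    ∑ q : Fin D → Fin N, ∏ j, g j (q j.rev) = ∏ j, ∑ k, g j k := by
  have h : ∀ q : Fin D → Fin N, ∏ j, g j (q j.rev) = ∏ j, g j.rev (q j) := fun q => by
    rw [← Equiv.prod_comp Fin.revPerm]
    simp
  simp only [h]
  rw [← Fintype.prod_sum (fun j k => g (Fin.rev j) k)]
  exact Equiv.prod_comp Fin.revPerm fun j => ∑ k, g j k

/-- A circuit that encodes the correlation function, with frequencies in a grid with offset `ω`,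
in its amplitudes. -/
theorem exists_gates_correlation {N : ℕ} (hN : 0 < N) {α : Fin N → ℂ} (hα : IsWindow α)
    (S : Type) [Fintype S] [DecidableEq S] (s0 : S)
    (A : Fin (D + 1) → Type) [∀ j, Fintype (A j)] [∀ j, DecidableEq (A j)] (a0 : ∀ j, A j)
    (ν : Fin (D + 1) → ℝ) (ω : Fin D → ℝ) :
    ∃ gs : List (Gate (Reg S A) (SysMem S A × (Fin D → Fin N))),
      gatesQueries .evo gs = 2 * D * N ∧ gatesQueries .prep gs = 2 ∧
      (∀ j, gatesQueries (.block j) gs = 1) ∧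
      ∀ (σ : System D S s0 A a0 ν) (m : Fin D → Fin N),
        gatesMat σ.oracle gs ((a0, s0), m) ((a0, s0), fun _ => ⟨0, hN⟩) =
          σ.R α (ω + gridPoint N m) / ((∏ j, ν j : ℝ) : ℂ) := by
  -- The weights on time tuples are the tensor power of `α`, a unit vector because `α` is one.
  obtain ⟨W, hW⟩ := exists_unitary_with_column (fun _ : Fin D => (⟨0, hN⟩ : Fin N))
    (fun q => ∏ j, α (q j)) (by
      simp only [norm_prod, ← Finset.prod_pow]
      rw [← Fintype.prod_sum (fun (_ : Fin D) k => ‖α k‖ ^ 2)]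
      exact Finset.prod_eq_one fun _ _ => hα)
  let F : Matrix.unitaryGroup (Fin D → Fin N) ℂ :=
    ⟨_, tensor_mem_unitaryGroup fun j => fourier_mem_unitaryGroup N (ω j)⟩
  refine ⟨[Gate.onRegister W] ++ coreGates S A N ++ [Gate.onRegister F], ?_, ?_, fun j => ?_,
    fun σ m => ?_⟩
  · rw [gatesQueries_append, gatesQueries_append, gatesQueries_evo_coreGates]
    simp [gatesQueries_cons, gatesQueries_nil, Gate.onRegister, Gate.queries]
  · rw [gatesQueries_append, gatesQueries_append, gatesQueries_prep_coreGates]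
    simp [gatesQueries_cons, gatesQueries_nil, Gate.onRegister, Gate.queries]
  · rw [gatesQueries_append, gatesQueries_append, gatesQueries_block_coreGates]
    simp [gatesQueries_cons, gatesQueries_nil, Gate.onRegister, Gate.queries]
  · rw [gatesMat_append, gatesMat_append, gatesMat_singleton, gatesMat_singleton,
      Gate.mat_onRegister, Gate.mat_onRegister, gatesMat_coreGates,
      kronecker_block_kronecker_apply]
    simp only [block_amplitude, hW, Finset.mul_sum, Finset.sum_mul]
    rw [Finset.sum_comm, System.R, Finset.sum_div]
    refine Finset.sum_congr rfl fun t _ => ?_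
    set n : Fin (D + 1) → S := Fin.cons σ.n0 t with hn
    have hF : ∀ q, (F : Matrix (Fin D → Fin N) (Fin D → Fin N) ℂ) m q =
        ∏ j : Fin D, fourier N (ω j.rev) (m j.rev) (q j.rev) := fun q =>
      (Equiv.prod_comp Fin.revPerm fun j => fourier N (ω j) (m j) (q j)).symm
    have hαq : ∀ q : Fin D → Fin N, ∏ j, α (q j) = ∏ j : Fin D, α (q j.rev) := fun q =>
      (Equiv.prod_comp Fin.revPerm fun j => α (q j)).symm
    have hterm : ∀ q : Fin D → Fin N,
        (F : Matrix (Fin D → Fin N) (Fin D → Fin N) ℂ) m q *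
          ((∏ j : Fin D, σ.rotated j.castSucc (q j.rev).val (n j.castSucc) (n j.succ)) *
            ((ν (Fin.last D) : ℂ)⁻¹ * σ.elem (Fin.last D) (n (Fin.last D)) σ.n0)) *
          ∏ j, α (q j) =
        ((ν (Fin.last D) : ℂ)⁻¹ * σ.elem (Fin.last D) (n (Fin.last D)) σ.n0) *
          ∏ j : Fin D, ((ν j.castSucc : ℂ)⁻¹ * σ.elem j.castSucc (n j.castSucc) (n j.succ)) *
            (fourier N (ω j.rev) (m j.rev) (q j.rev) * (α (q j.rev) * Complex.exp (Complex.I *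
              ((q j.rev).val : ℂ) *
              ((σ.energy (n j.castSucc) - σ.energy (n j.succ) : ℝ) : ℂ)))) := fun q => by
      rw [hF, hαq, mul_right_comm, ← mul_assoc, mul_comm _ ((ν (Fin.last D) : ℂ)⁻¹ * _),
        ← Finset.prod_mul_distrib, ← Finset.prod_mul_distrib]
      congr 1
      refine Finset.prod_congr rfl fun j _ => ?_
      rw [System.rotated, Matrix.of_apply]
      ring
    simp only [hterm]
    -- For a fixed path, the sum over all time tuples factorizes into `D` Fourier sums, each of
    -- which is one window value.
    rw [← Finset.mul_sum, sum_prod_rev fun j k =>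
      ((ν j.castSucc : ℂ)⁻¹ * σ.elem j.castSucc (n j.castSucc) (n j.succ)) *
            (fourier N (ω j.rev) (m j.rev) k * (α k * Complex.exp (Complex.I *
              (k.val : ℂ) * ((σ.energy (n j.castSucc) - σ.energy (n j.succ) : ℝ) : ℂ))))]
    simp only [← Finset.mul_sum, ← window_eq_fourier_mulVec]
    rw [Fin.prod_univ_castSucc ν]
    push_cast
    simp only [Finset.prod_mul_distrib, Finset.prod_inv_distrib, Pi.add_apply, gridPoint,
      sub_add_eq_sub_sub]
    rw [div_eq_mul_inv, mul_inv]
    ring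

end Correlation

end GQPE

namespace GQPE

/-! ### Amplitude estimation by windowed phase estimation -/

section AmplitudeEstimation

variable {M : Type} [Fintype M] [DecidableEq M]

/-- The reflection about the vector `χ`. -/
noncomputable def reflection (χ : M → ℂ) : Matrix M M ℂ :=
  (2 : ℂ) • Matrix.vecMulVec χ (star χ) - 1

theorem reflection_mulVec (χ v : M → ℂ) :
    (reflection χ).mulVec v = (2 * dotProduct (star χ) v) • χ - v := by
  rw [reflection, Matrix.sub_mulVec, Matrix.one_mulVec, Matrix.smul_mulVec,
    Matrix.vecMulVec_mulVec, mul_smul]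
  congr 2
  ext m
  simp [mul_comm]

theorem conjTranspose_reflection (χ : M → ℂ) : (reflection χ).conjTranspose = reflection χ := by
  ext m m'
  simp [reflection, Matrix.vecMulVec_apply, Matrix.one_apply, mul_comm, eq_comm]

theorem reflection_mul_self {χ : M → ℂ} (hχ : dotProduct (star χ) χ = 1) :
    reflection χ * reflection χ = 1 := by
  refine Matrix.ext_of_mulVec_single fun m => ?_
  rw [← Matrix.mulVec_mulVec, reflection_mulVec χ (Pi.single m 1), Matrix.mulVec_sub,
    Matrix.mulVec_smul, reflection_mulVec, reflection_mulVec, hχ, Matrix.one_mulVec]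
  module

theorem reflection_mem_unitaryGroup {χ : M → ℂ} (hχ : dotProduct (star χ) χ = 1) :
    reflection χ ∈ Matrix.unitaryGroup M ℂ := by
  rw [Matrix.mem_unitaryGroup_iff, Matrix.star_eq_conjTranspose, conjTranspose_reflection,
    reflection_mul_self hχ]

variable {χ : M → ℂ} {B : Matrix M M ℂ} {φ : ℝ}

/-- Powers of a product of two reflections act as Chebyshev polynomials. -/
theorem dotProduct_pow_mulVec (hχ : dotProduct (star χ) χ = 1) (hBB : B * B = 1)
    (hφ : dotProduct (star χ) (B.mulVec χ) = (Real.cos φ : ℂ)) (k : ℕ) :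
    dotProduct (star χ) (((reflection χ * B) ^ k).mulVec χ) = (Real.cos (k * φ) : ℂ) := by
  -- With `G = reflection χ * B`, the relations `Gχ = 2 cos φ χ - Bχ` and `GBχ = χ` give `G^{k+2}χ =
  -- 2 cos φ G^{k+1}χ - G^k χ`, the Chebyshev recurrence. No spectral decomposition of `G` is
  -- needed.
  have hG : (reflection χ * B).mulVec χ = (2 * (Real.cos φ : ℂ)) • χ - B.mulVec χ := by
    rw [← Matrix.mulVec_mulVec, reflection_mulVec, hφ]
  have hGB : (reflection χ * B).mulVec (B.mulVec χ) = χ := by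
    rw [Matrix.mulVec_mulVec, Matrix.mul_assoc, hBB, Matrix.mul_one, reflection_mulVec, hχ]
    module
  induction k using Nat.twoStepInduction with
  | zero => simp [hχ]
  | one =>
    rw [pow_one, hG, dotProduct_sub, dotProduct_smul, hχ, hφ]
    simp only [smul_eq_mul, Nat.cast_one, one_mul]
    ring
  | more k h0 h1 =>
    have h : ((reflection χ * B) ^ (k + 2)).mulVec χ =
        (2 * (Real.cos φ : ℂ)) • ((reflection χ * B) ^ (k + 1)).mulVec χ -
          ((reflection χ * B) ^ k).mulVec χ := by
      rw [pow_succ, ← Matrix.mulVec_mulVec, hG, Matrix.mulVec_sub, Matrix.mulVec_smul]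
      congr 1
      rw [pow_succ, ← Matrix.mulVec_mulVec, hGB]
    rw [h, dotProduct_sub, dotProduct_smul, h0, h1, smul_eq_mul]
    have hc : Real.cos ((k + 2 : ℕ) * φ) =
        2 * Real.cos φ * Real.cos ((k + 1 : ℕ) * φ) - Real.cos (k * φ) := by
      have e1 : ((k + 2 : ℕ) : ℝ) * φ = (k + 1 : ℕ) * φ + φ := by push_cast; ring
      have e2 : (k : ℝ) * φ = (k + 1 : ℕ) * φ - φ := by push_cast; ring
      rw [e1, e2, Real.cos_add, Real.cos_sub]
      ring
    rw [hc]
    push_cast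
    ring

/-- Since the product of the reflections is unitary, the Gram matrix of its orbit depends only on `k
- l`. This Gram matrix alone determines the outcome distribution of phase estimation. -/
theorem dotProduct_pow_mulVec_pow_mulVec (hχ : dotProduct (star χ) χ = 1)
    (hBH : B.conjTranspose = B) (hBB : B * B = 1)
    (hφ : dotProduct (star χ) (B.mulVec χ) = (Real.cos φ : ℂ)) (l k : ℕ) :
    dotProduct (star (((reflection χ * B) ^ l).mulVec χ)) (((reflection χ * B) ^ k).mulVec χ) =
      (Real.cos ((k - l) * φ) : ℂ) := by
  have hu : ∀ l : ℕ, ((reflection χ * B) ^ l).conjTranspose * (reflection χ * B) ^ l = 1 := by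
    intro l
    have h : reflection χ * B ∈ Matrix.unitaryGroup M ℂ :=
      mul_mem (reflection_mem_unitaryGroup hχ) (by
        rw [Matrix.mem_unitaryGroup_iff, Matrix.star_eq_conjTranspose, hBH, hBB])
    exact Matrix.mem_unitaryGroup_iff'.mp (pow_mem h l)
  have key : ∀ l d : ℕ, dotProduct (star (((reflection χ * B) ^ l).mulVec χ))
      (((reflection χ * B) ^ (l + d)).mulVec χ) = (Real.cos (d * φ) : ℂ) := by
    intro l d
    rw [Matrix.star_mulVec, ← Matrix.dotProduct_mulVec, Matrix.mulVec_mulVec, pow_add,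
      ← Matrix.mul_assoc, hu, Matrix.one_mul, dotProduct_pow_mulVec hχ hBB hφ]
  rcases le_total l k with h | h
  · obtain ⟨d, rfl⟩ := Nat.exists_eq_add_of_le h
    rw [key]
    congr 3
    push_cast
    ring
  · obtain ⟨d, rfl⟩ := Nat.exists_eq_add_of_le h
    rw [Matrix.star_dotProduct, key, Complex.star_def, Complex.conj_ofReal, ← Real.cos_neg]
    congr 3
    push_cast
    ring

/-- The outcome distribution of phase estimation for a product of two reflections. -/
theorem sum_norm_sq_phase_estimation (hχ : dotProduct (star χ) χ = 1)
    (hBH : B.conjTranspose = B) (hBB : B * B = 1)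
    (hφ : dotProduct (star χ) (B.mulVec χ) = (Real.cos φ : ℂ)) {N : ℕ} (α : Fin N → ℂ)
    (m : Fin N) :
    ∑ x, ‖∑ k : Fin N, fourier N 0 m k * ((reflection χ * B) ^ k.val).mulVec χ x * α k‖ ^ 2 =
      (‖window α (φ - 2 * Real.pi * (m.val : ℝ) / (N : ℝ))‖ ^ 2 +
        ‖window α (-φ - 2 * Real.pi * (m.val : ℝ) / (N : ℝ))‖ ^ 2) / 2 := by
  set f : Fin N → ℂ := fun k => fourier N 0 m k * α k with hf
  set u : Fin N → M → ℂ := fun k => ((reflection χ * B) ^ k.val).mulVec χ with hu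
  have hw : ∀ x : ℝ, window α (x - 2 * Real.pi * (m.val : ℝ) / (N : ℝ)) =
      ∑ k, f k * Complex.exp (Complex.I * (k.val : ℂ) * (x : ℂ)) := fun x => by
    have h := window_eq_fourier_mulVec α x 0 m
    rw [sub_zero] at h
    rw [h]
    exact Finset.sum_congr rfl fun k _ => by rw [hf]; ring
  have hsq : ∀ z : ℂ, ((‖z‖ ^ 2 : ℝ) : ℂ) = star z * z := fun z => by
    rw [Complex.star_def, Complex.conj_mul']
    push_cast
    rfl
  have hexp : ∀ x : ℝ, ((‖∑ k, f k * Complex.exp (Complex.I * (k.val : ℂ) * (x : ℂ))‖ ^ 2 : ℝ) : ℂ) =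
      ∑ l, ∑ k, star (f l) * f k *
        Complex.exp ((((k.val : ℝ) - l.val) * x : ℝ) * Complex.I) := fun x => by
    rw [hsq, star_sum, Finset.sum_mul_sum]
    refine Finset.sum_congr rfl fun l _ => Finset.sum_congr rfl fun k _ => ?_
    have : Complex.exp ((((k.val : ℝ) - l.val) * x : ℝ) * Complex.I) =
        star (Complex.exp (Complex.I * (l.val : ℂ) * (x : ℂ))) *
          Complex.exp (Complex.I * (k.val : ℂ) * (x : ℂ)) := by
      rw [Complex.star_def, ← Complex.exp_conj, ← Complex.exp_add]
      congr 1
      simp only [map_mul, Complex.conj_I, Complex.conj_natCast, Complex.conj_ofReal]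
      push_cast
      ring
    rw [this, star_mul']
    ring
  have hL : ((∑ x, ‖∑ k : Fin N, fourier N 0 m k * u k x * α k‖ ^ 2 : ℝ) : ℂ) =
      ∑ l, ∑ k, star (f l) * f k * (Real.cos (((k.val : ℝ) - l.val) * φ) : ℂ) := by
    have h1 : ∀ x, ((‖∑ k : Fin N, fourier N 0 m k * u k x * α k‖ ^ 2 : ℝ) : ℂ) =
        ∑ l, ∑ k, star (f l) * f k * (star (u l x) * u k x) := fun x => by
      rw [hsq, star_sum, Finset.sum_mul_sum]
      refine Finset.sum_congr rfl fun l _ => Finset.sum_congr rfl fun k _ => ?_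
      simp only [hf, star_mul']
      ring
    rw [Complex.ofReal_sum]
    simp only [h1]
    rw [Finset.sum_comm]
    refine Finset.sum_congr rfl fun l _ => ?_
    rw [Finset.sum_comm]
    refine Finset.sum_congr rfl fun k _ => ?_
    rw [← Finset.mul_sum]
    congr 1
    exact dotProduct_pow_mulVec_pow_mulVec hχ hBH hBB hφ l k
  rw [hw, hw]
  apply Complex.ofReal_injective
  rw [hL, Complex.ofReal_div, Complex.ofReal_add, hexp, hexp, ← Finset.sum_add_distrib,
    Finset.sum_div]
  refine Finset.sum_congr rfl fun l _ => ?_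
  rw [← Finset.sum_add_distrib, Finset.sum_div]
  refine Finset.sum_congr rfl fun k _ => ?_
  -- Entry by entry the claim is `cos y = (e^{iy} + e^{-iy})/2`: the distribution is an even mixture
  -- of the ones for the phases `φ` and `-φ`.
  rw [Complex.ofReal_cos, Complex.cos]
  push_cast
  rw [show ((k.val : ℂ) - l.val) * -(φ : ℂ) * Complex.I =
    -(((k.val : ℂ) - l.val) * φ) * Complex.I by ring]
  ring

open Classical in
-- Cosine is even, periodic and 1-Lipschitz. The ambiguity between `φ` and `-φ` is thus harmless,
-- and phase precision `η` modulo `2π` gives precision `η` for `cos φ`.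
theorem Resolves.le_sum_phase_estimation {N : ℕ} {α : Fin N → ℂ} {η δ : ℝ}
    (hα : Resolves α η δ) (hχ : dotProduct (star χ) χ = 1)
    (hBH : B.conjTranspose = B) (hBB : B * B = 1)
    (hφ : dotProduct (star χ) (B.mulVec χ) = (Real.cos φ : ℂ)) :
    1 - δ ≤ ∑ x, ∑ m : Fin N,
      ‖∑ k : Fin N, fourier N 0 m k * ((reflection χ * B) ^ k.val).mulVec χ x * α k‖ ^ 2 *
        if |Real.cos (2 * Real.pi * (m.val : ℝ) / (N : ℝ)) - Real.cos φ| ≤ η then 1 else 0 := by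
  have hcos : ∀ (x : ℝ), Real.cos x = Real.cos φ → 1 - δ ≤ ∑ m : Fin N,
      ‖window α (x - 2 * Real.pi * (m.val : ℝ) / (N : ℝ))‖ ^ 2 *
        if |Real.cos (2 * Real.pi * (m.val : ℝ) / (N : ℝ)) - Real.cos φ| ≤ η then 1 else 0 := by
    intro x hx
    refine (hα x).trans ?_
    rw [Finset.sum_filter]
    refine Finset.sum_le_sum fun m _ => ?_
    by_cases h : ∃ n : ℤ, |x - 2 * Real.pi * (m.val : ℝ) / (N : ℝ) - 2 * Real.pi * (n : ℝ)| ≤ η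
    · obtain ⟨n, hn⟩ := h
      have h1 : |Real.cos (2 * Real.pi * (m.val : ℝ) / (N : ℝ)) - Real.cos φ| ≤ η := by
        have h2 : Real.cos φ = Real.cos (x - 2 * Real.pi * n) := by
          rw [← hx, mul_comm, Real.cos_sub_int_mul_two_pi]
        rw [h2, abs_sub_comm]
        refine (Real.abs_cos_sub_cos_le _ _).trans (le_trans (le_of_eq ?_) hn)
        congr 1
        ring
      rw [if_pos ⟨n, hn⟩, if_pos h1, mul_one]
    · rw [if_neg h]
      positivity
  rw [Finset.sum_comm]
  simp only [← Finset.sum_mul, sum_norm_sq_phase_estimation hχ hBH hBB hφ]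
  have h1 := hcos φ rfl
  have h2 := hcos (-φ) (Real.cos_neg φ)
  have h3 := div_le_div_of_nonneg_right (add_le_add h1 h2) (zero_le_two : (0 : ℝ) ≤ 2)
  rw [← Finset.sum_add_distrib, Finset.sum_div] at h3
  calc 1 - δ = (1 - δ + (1 - δ)) / 2 := by ring
    _ ≤ _ := h3
    _ = _ := Finset.sum_congr rfl fun m _ => by ring

/-! ### The circuit -/

variable {ι : Type} {X : ι → Type}

theorem boolSwap_mem_unitaryGroup :
    (Matrix.of fun b b' : Bool => if b = !b' then (1 : ℂ) else 0) ∈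
      Matrix.unitaryGroup Bool ℂ := by
  rw [Matrix.mem_unitaryGroup_iff]
  ext b b'
  cases b <;> cases b' <;> simp [Matrix.mul_apply]

/-- The state `(|i, 0⟩ + z |i, 1⟩) / √2`. -/
noncomputable def plusState (i : M) (z : ℂ) : M × Bool → ℂ := fun x =>
  if x.1 = i then ((Real.sqrt 2 : ℝ) : ℂ)⁻¹ * (if x.2 then z else 1) else 0

theorem inv_sqrt_two_mul_self :
    ((Real.sqrt 2 : ℝ) : ℂ)⁻¹ * ((Real.sqrt 2 : ℝ) : ℂ)⁻¹ = 1 / 2 := by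
  rw [← mul_inv, ← Complex.ofReal_mul, Real.mul_self_sqrt zero_le_two]
  norm_num

theorem dotProduct_plusState (i : M) {z : ℂ} (v : M × Bool → ℂ) :
    dotProduct (star (plusState i z)) v =
      ((Real.sqrt 2 : ℝ) : ℂ)⁻¹ * (v (i, false) + star z * v (i, true)) := by
  rw [dotProduct, Fintype.sum_prod_type, Finset.sum_eq_single i]
  · simp [plusState]
    ring
  · intro m _ hm
    simp [plusState, hm]
  · simp

theorem dotProduct_plusState_self (i : M) {z : ℂ} (hz : ‖z‖ = 1) :
    dotProduct (star (plusState i z)) (plusState i z) = 1 := by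
  rw [dotProduct_plusState]
  simp only [plusState, if_true, Bool.false_eq_true, if_false, mul_one]
  rw [mul_left_comm (star z), ← mul_one_add, ← mul_assoc, inv_sqrt_two_mul_self, Complex.star_def,
    Complex.conj_mul', hz]
  norm_num

/-- The self-adjoint unitary `|0⟩⟨1| ⊗ U + |1⟩⟨0| ⊗ U†`. -/
noncomputable def flipMat (U : Matrix M M ℂ) : Matrix (M × Bool) (M × Bool) ℂ :=
  Matrix.of fun x y => if x.2 = !y.2 then (if y.2 then U else U.conjTranspose) x.1 y.1 else 0

theorem conjTranspose_flipMat (U : Matrix M M ℂ) : (flipMat U).conjTranspose = flipMat U := by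
  ext ⟨m, b⟩ ⟨m', b'⟩
  cases b <;> cases b' <;> simp [flipMat]

theorem flipMat_mul_self {U : Matrix M M ℂ} (hU : U ∈ Matrix.unitaryGroup M ℂ) :
    flipMat U * flipMat U = 1 := by
  have h1 := Matrix.mem_unitaryGroup_iff.mp hU
  have h2 := Matrix.mem_unitaryGroup_iff'.mp hU
  rw [Matrix.star_eq_conjTranspose] at h1 h2
  ext ⟨m, b⟩ ⟨m', b'⟩
  have h3 := congrFun (congrFun h1 m) m'
  have h4 := congrFun (congrFun h2 m) m'
  simp only [Matrix.mul_apply, Matrix.conjTranspose_apply] at h3 h4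
  rw [Matrix.mul_apply, Fintype.sum_prod_type]
  cases b <;> cases b' <;> simp [flipMat, Matrix.one_apply] <;> simpa [Matrix.one_apply]

/-- This reduces an entry of an arbitrary unitary to the expectation of a self-adjoint one; the
phase `z` selects which real component of the entry is seen. -/
theorem flipMat_expectation (U : Matrix M M ℂ) (i : M) (z : ℂ) :
    dotProduct (star (plusState i z)) ((flipMat U).mulVec (plusState i z)) =
      (((z * U i i).re : ℝ) : ℂ) := by
  have h : ∀ b, (flipMat U).mulVec (plusState i z) (i, b) = ((Real.sqrt 2 : ℝ) : ℂ)⁻¹ *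
      (if b then star (U i i) else z * U i i) := by
    intro b
    rw [Matrix.mulVec, dotProduct, Fintype.sum_prod_type, Finset.sum_eq_single i]
    · cases b <;> simp [flipMat, plusState] <;> ring
    · intro m _ hm
      simp [plusState, hm]
    · simp
  rw [dotProduct_plusState, h, h]
  simp only [if_true, Bool.false_eq_true, if_false]
  rw [mul_left_comm (star z), ← mul_add, ← mul_assoc, inv_sqrt_two_mul_self, ← star_mul',
    Complex.re_eq_add_conj, Complex.star_def]
  ring

/-- One step of amplitude amplification. -/
noncomputable def groverGates (gs : List (Gate X M)) (i : M) {z : ℂ} (hz : ‖z‖ = 1) :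
    List (Gate X (M × Bool)) :=
  gs.map (Gate.control fun b => b) ++ (inverseGates gs).map (Gate.control fun b => !b) ++
    [Gate.onRegister ⟨_, boolSwap_mem_unitaryGroup⟩,
      .free ⟨_, reflection_mem_unitaryGroup (dotProduct_plusState_self i hz)⟩]

theorem gatesMat_groverGates (O : ∀ i, Matrix (X i) (X i) ℂ) (gs : List (Gate X M)) (i : M) {z : ℂ}
    (hz : ‖z‖ = 1) : gatesMat O (groverGates gs i hz) =
      reflection (plusState i z) * flipMat (gatesMat O gs) := by
  rw [groverGates, gatesMat_append, gatesMat_append, gatesMat_map_control, gatesMat_map_control,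
    gatesMat_inverseGates, ← Matrix.blockDiagonal_mul]
  simp only [gatesMat, one_mul, Gate.mat_onRegister]
  rw [Matrix.mul_assoc]
  congr 1
  ext ⟨m, b⟩ ⟨m', b'⟩
  rw [Matrix.mul_apply, Fintype.sum_prod_type, Finset.sum_eq_single m]
  · cases b <;> cases b' <;> simp [flipMat, Matrix.blockDiagonal_apply]
  · intro x _ hx
    simp [Matrix.one_apply_ne hx.symm]
  · simp

theorem gatesQueries_groverGates (j : ι) (gs : List (Gate X M)) (i : M) {z : ℂ} (hz : ‖z‖ = 1) :
    gatesQueries j (groverGates gs i hz) = 2 * gatesQueries j gs := by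
  rw [groverGates, gatesQueries_append, gatesQueries_append, gatesQueries_map_control,
    gatesQueries_map_control, gatesQueries_inverseGates]
  simp [gatesQueries_cons, gatesQueries_nil, Gate.onRegister, Gate.queries]
  ring

open Classical in
/-- Estimation of the real part of `z ⟨i|U|i⟩` with one sample. -/
theorem exists_circuit_re_estimate [∀ i, Fintype (X i)] [∀ i, DecidableEq (X i)] {N : ℕ}
    (hN : 0 < N) {α : Fin N → ℂ} (hα : IsWindow α) {η δ : ℝ} (hres : Resolves α η δ)
    (gs : List (Gate X M)) (i : M) {z : ℂ} (hz : ‖z‖ = 1) :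
    ∃ (c : Circuit X) (f : c.M → ℝ), (∀ j, c.queries j = 2 * N * gatesQueries j gs) ∧
      ∀ O : ∀ i, Matrix (X i) (X i) ℂ, (∀ i, O i ∈ Matrix.unitaryGroup (X i) ℂ) →
        1 - δ ≤ ∑ x, c.prob O x * if |f x - (z * gatesMat O gs i i).re| ≤ η then 1 else 0 := by
  obtain ⟨Wχ, hWχ⟩ := exists_unitary_with_column (i, false) (plusState i z) (by
    have h := dotProduct_plusState_self i hz
    apply Complex.ofReal_injective
    rw [Complex.ofReal_one, ← h, Complex.ofReal_sum]
    refine Finset.sum_congr rfl fun x _ => ?_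
    rw [Pi.star_apply, Complex.star_def, Complex.conj_mul']
    push_cast
    rfl)
  obtain ⟨Wα, hWα⟩ := exists_unitary_with_column (⟨0, hN⟩ : Fin N) α hα
  -- Phase estimation of the Grover step: window weights in the time register, `plusState i z` in
  -- the system, controlled powers, Fourier transform.
  let gates : List (Gate X ((M × Bool) × Fin N)) :=
    [Gate.onRegister Wα, (Gate.free Wχ).control fun _ => true] ++
      powerGates N (fun k : Fin N => k.val) (groverGates gs i hz) ++
      [Gate.onRegister ⟨_, fourier_mem_unitaryGroup N 0⟩]
  refine ⟨⟨(M × Bool) × Fin N, ((i, false), ⟨0, hN⟩), gates⟩,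
    fun x => Real.cos (2 * Real.pi * (x.2.val : ℝ) / (N : ℝ)), fun j => ?_, fun O hO => ?_⟩
  · change gatesQueries j gates = _
    rw [gatesQueries_append, gatesQueries_append, gatesQueries_powerGates, gatesQueries_groverGates]
    simp [gatesQueries_cons, gatesQueries_nil, Gate.onRegister, Gate.queries, Gate.control]
    ring
  · set U := gatesMat O gs with hU
    have hUu : U ∈ Matrix.unitaryGroup M ℂ := gatesMat_mem_unitaryGroup hO gs
    have hre : |(z * U i i).re| ≤ 1 := by
      refine (Complex.abs_re_le_norm _).trans ?_
      rw [norm_mul, hz, one_mul]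
      exact entry_norm_bound_of_unitary hUu i i
    -- The phase `φ` is defined as the arccosine of the sought real part, which has modulus at most
    -- `1` as part of a unitary entry.
    have hcos := Real.cos_arccos (abs_le.mp hre).1 (abs_le.mp hre).2
    have hφ := flipMat_expectation U i z
    rw [← hcos] at hφ
    have hmain := hres.le_sum_phase_estimation (dotProduct_plusState_self i hz)
      (conjTranspose_flipMat U) (flipMat_mul_self hUu) hφ
    refine hmain.trans (le_of_eq ?_)
    have hst : ∀ x m, gatesMat O gates (x, m) ((i, false), ⟨0, hN⟩) =
        ∑ k : Fin N, fourier N 0 m k * ((reflection (plusState i z) * flipMat U) ^ k.val).mulVec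
          (plusState i z) x * α k := by
      intro x m
      have h1 : gatesMat O gates = Matrix.kroneckerMap (· * ·) (1 : Matrix (M × Bool) (M × Bool) ℂ)
          (fourier N 0) * (Matrix.blockDiagonal (fun k : Fin N =>
            (reflection (plusState i z) * flipMat U) ^ k.val * (Wχ : Matrix _ _ ℂ)) *
          Matrix.kroneckerMap (· * ·) (1 : Matrix (M × Bool) (M × Bool) ℂ)
            (Wα : Matrix (Fin N) (Fin N) ℂ)) := by
        rw [gatesMat_append, gatesMat_append, gatesMat_powerGates O (fun k => k.2.le),
          gatesMat_groverGates, gatesMat_singleton, Matrix.blockDiagonal_mul]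
        simp only [gatesMat, one_mul, Gate.mat_onRegister, Gate.mat_control, if_true,
          Matrix.mul_assoc]
        rfl
      rw [h1, kronecker_block_kronecker_apply]
      refine Finset.sum_congr rfl fun k _ => ?_
      rw [hWα, Matrix.mul_apply]
      simp only [hWχ]
      rfl
    rw [← Fintype.sum_prod_type']
    refine Finset.sum_congr rfl fun x _ => ?_
    rw [Circuit.prob, Circuit.state_eq_gatesMat, hcos, ← hst]

/-- Estimation of an amplitude `⟨i|U|i⟩` with two samples and `O(1/δ)` uses of `U`. -/
theorem exists_amplitude_estimate : ∃ K : ℝ, 0 < K ∧ ∀ (ι : Type) (X : ι → Type)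
    [∀ i, Fintype (X i)] [∀ i, DecidableEq (X i)] (M : Type) [Fintype M] [DecidableEq M]
    (gs : List (Gate X M)) (i : M) (w δ : ℝ), 0 < w → 0 < δ → δ < 1 →
    ∃ P : Protocol X ℂ, P.samples ≤ 2 ∧
      (∀ j, (P.totalQueries j : ℝ) ≤ K / δ * gatesQueries j gs) ∧
      ∀ O : ∀ i, Matrix (X i) (X i) ℂ, (∀ i, O i ∈ Matrix.unitaryGroup (X i) ℂ) →
        2 / 3 ≤ P.prob O fun a => ‖a - w * gatesMat O gs i i‖ ≤ w * δ := by
  classical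
  obtain ⟨K, hK, hwin⟩ := exists_short_window_resolves
  have hlog : 0 < Real.log (2 / (1 / 10)) := Real.log_pos (by norm_num)
  refine ⟨8 * K * Real.log (2 / (1 / 10)), by positivity, ?_⟩
  intro ι X _ _ M _ _ gs i w δ hw hδ hδ1
  -- Real and imaginary parts each get error `δ/2` and failure probability `1/10`; both succeed with
  -- probability at least `(9/10)^2 ≥ 2/3`.
  obtain ⟨q, α, hα, hN, hres⟩ := hwin (δ / 2) (1 / 10) (by linarith) (by linarith) (by norm_num)
    (by norm_num)
  have hN0 : 0 < 2 ^ q := by positivity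
  obtain ⟨c, f, hc, hf⟩ := exists_circuit_re_estimate hN0 hα hres gs i (z := 1) (by simp)
  -- `Re(-i a) = Im a`.
  obtain ⟨c', f', hc', hf'⟩ := exists_circuit_re_estimate hN0 hα hres gs i (z := -Complex.I)
    (by simp)
  refine ⟨.run c fun x => .run c' fun y => .done (w * (f x + f' y * Complex.I)), ?_, fun j => ?_,
    fun O hO => ?_⟩
  · have h : ∀ x : c.M, (Protocol.run c' fun y => .done ((w : ℂ) * (f x + f' y * Complex.I))).samples
        ≤ 1 := fun x => by
      rw [Protocol.samples]
      exact Nat.add_le_add_left (Finset.sup_le fun y _ => le_of_eq rfl) 1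
    rw [Protocol.samples]
    exact Nat.add_le_add_left (Finset.sup_le fun x _ => h x) 1
  · have h : ∀ x : c.M, (Protocol.run c' fun y => .done
        ((w : ℂ) * (f x + f' y * Complex.I))).totalQueries j ≤ c'.queries j := fun x => by
      rw [Protocol.totalQueries]
      exact Nat.add_le_add_left (Finset.sup_le fun y _ => le_of_eq rfl) _
    have h1 : (Protocol.run c fun x => .run c' fun y => .done
        ((w : ℂ) * (f x + f' y * Complex.I))).totalQueries j ≤ c.queries j + c'.queries j := by
      rw [Protocol.totalQueries]
      exact Nat.add_le_add_left (Finset.sup_le fun x _ => h x) _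
    rw [hc, hc', ← two_mul] at h1
    calc _ ≤ ((2 * (2 * 2 ^ q * gatesQueries j gs) : ℕ) : ℝ) := by exact_mod_cast h1
      _ = 4 * ((2 ^ q : ℕ) : ℝ) * gatesQueries j gs := by push_cast; ring
      _ ≤ 4 * (K * Real.log (2 / (1 / 10)) / (δ / 2)) * gatesQueries j gs := by gcongr
      _ = _ := by field_simp; ring
  · have h1 := hf O hO
    have h2 := hf' O hO
    set a := gatesMat O gs i i with ha
    have hre : ((1 : ℂ) * a).re = a.re := by simp
    have him : (-Complex.I * a).re = a.im := by simp
    rw [hre] at h1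
    rw [him] at h2
    have h3 : ∀ x, (9 / 10) * (if |f x - a.re| ≤ δ / 2 then (1 : ℝ) else 0) ≤
        (Protocol.run c' fun y => .done ((w : ℂ) * (f x + f' y * Complex.I))).prob O
          fun z => ‖z - w * a‖ ≤ w * δ := by
      intro x
      split_ifs with hx
      · rw [mul_one, Protocol.prob]
        refine le_trans (by linarith) (h2.trans ?_)
        refine Finset.sum_le_sum fun y _ => mul_le_mul_of_nonneg_left ?_ (c'.prob_nonneg O y)
        split_ifs with hy
        · have h4 : ‖(w : ℂ) * (f x + f' y * Complex.I) - w * a‖ ≤ w * δ := by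
            have e : (w : ℂ) * (f x + f' y * Complex.I) - w * a =
                w * (((f x - a.re : ℝ) : ℂ) + ((f' y - a.im : ℝ) : ℂ) * Complex.I) := by
              conv_lhs => rw [← Complex.re_add_im a]
              push_cast
              ring
            rw [e, norm_mul, Complex.norm_real, Real.norm_eq_abs, abs_of_pos hw]
            refine mul_le_mul_of_nonneg_left ((norm_add_le _ _).trans ?_) hw.le
            rw [norm_mul, Complex.norm_I, mul_one, Complex.norm_real, Complex.norm_real,
              Real.norm_eq_abs, Real.norm_eq_abs]
            linarith
          rw [Protocol.prob, if_pos h4]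
        · exact Protocol.prob_nonneg _ _ _
      · rw [mul_zero]
        exact Protocol.prob_nonneg _ _ _
    rw [Protocol.prob]
    calc (2 : ℝ) / 3 ≤ 9 / 10 * (1 - 1 / 10) := by norm_num
      _ ≤ 9 / 10 * ∑ x, c.prob O x * (if |f x - a.re| ≤ δ / 2 then (1 : ℝ) else 0) := by gcongr
      _ = ∑ x, c.prob O x * (9 / 10 * if |f x - a.re| ≤ δ / 2 then (1 : ℝ) else 0) := by
        rw [Finset.mul_sum]
        exact Finset.sum_congr rfl fun x _ => by ring
      _ ≤ _ := Finset.sum_le_sum fun x _ => mul_le_mul_of_nonneg_left (h3 x) (c.prob_nonneg O x)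

end AmplitudeEstimation

end GQPE

namespace GQPE

/-! ### Simultaneous estimation of many amplitudes -/

section Recovery

variable {ι : Type} {X : ι → Type} {M κ : Type} [Fintype M] [DecidableEq M]

theorem freq_nonneg {n : ℕ} (s : Fin n → M) (m : M) : 0 ≤ freq s m := by
  rw [freq]
  refine mul_nonneg (by positivity) (Finset.sum_nonneg fun i _ => ?_)
  split_ifs <;> norm_num

/-- For nonnegative numbers `(√a - b)^2 ≤ |a - b^2|`. Near zero nothing better holds, so moduli up
to `τ` require probabilities up to `τ^2`. -/
theorem abs_sqrt_sub_le {a b τ : ℝ} (ha : 0 ≤ a) (hb : 0 ≤ b) (hτ : 0 ≤ τ)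
    (h : |a - b ^ 2| ≤ τ ^ 2) : |Real.sqrt a - b| ≤ τ := by
  refine abs_le.mpr (abs_le_of_sq_le_sq' ?_ hτ)
  have hs := Real.sqrt_nonneg a
  have hsq := Real.sq_sqrt ha
  obtain ⟨h1, h2⟩ := abs_le.mp h
  rcases le_total (Real.sqrt a) b with hab | hab <;> nlinarith

/-- Estimation of all absolute values of the amplitudes from samples of the state. -/
theorem le_prob_iid_magnitudes {O : ∀ i, Matrix (X i) (X i) ℂ} {c : Circuit X}
    (hc : ∑ m, c.prob O m = 1) (label : κ → c.M) {n : ℕ} {w τ β : ℝ} (hw : 0 ≤ w) (hτ : 0 < τ)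
    (hβ : 1 ≤ β * (n * τ ^ 4)) :
    1 - β ≤ (Protocol.iid c n fun s k => w * Real.sqrt (freq s (label k))).prob O
      fun z => ∀ k, |z k - w * ‖c.state O (label k)‖| ≤ w * τ := by
  refine Protocol.le_prob_iid hc (τ := τ ^ 2) (by positivity) (by rw [← pow_mul]; exact hβ)
    fun s hs k => ?_
  rw [← mul_sub, abs_mul, abs_of_nonneg hw]
  exact mul_le_mul_of_nonneg_left
    (abs_sqrt_sub_le (freq_nonneg _ _) (norm_nonneg _) hτ.le (hs (label k))) hw

/-- A circuit that interferes the output state of `gs` with a reference state `v`. -/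
theorem exists_interference_circuit (gs : List (Gate X M)) (i : M) {v : M → ℂ}
    (hv : ∑ m, ‖v m‖ ^ 2 = 1) :
    ∃ (c : Circuit X) (lab : M → Fin 4 → c.M), (∀ j, c.queries j = gatesQueries j gs) ∧
      ∀ (O : ∀ i, Matrix (X i) (X i) ℂ) (m : M) (b : Fin 4),
        c.prob O (lab m b) = ‖gatesMat O gs m i + (-Complex.I) ^ b.val * v m‖ ^ 2 / 8 := by
  obtain ⟨V, hV⟩ := exists_unitary_with_column i v hv
  obtain ⟨W, hW⟩ := exists_unitary_with_column (0 : Fin 4)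
    ![((Real.sqrt 2 : ℝ) : ℂ)⁻¹, ((Real.sqrt 2 : ℝ) : ℂ)⁻¹, 0, 0] (by
      rw [Fin.sum_univ_four]
      simp
      norm_num)
  -- Branch `0` of the control register carries the state, branch `1` the reference, and branches
  -- `2`, `3` are empty. The Fourier transform of order four then superposes state and reference
  -- with the four relative phases `(-i)^b`; the factor `1/8` is `(1/2 · 1/√2)^2`.
  let gates : List (Gate X (M × Fin 4)) :=
    [Gate.onRegister W] ++ (gs.map (Gate.control fun q => decide (q = 0)) ++
      [(Gate.free V).control fun q => decide (q = 1)]) ++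
      [Gate.onRegister ⟨_, fourier_mem_unitaryGroup 4 0⟩]
  refine ⟨⟨M × Fin 4, (i, 0), gates⟩, fun m b => (m, b), fun j => ?_, fun O m b => ?_⟩
  · change gatesQueries j gates = _
    rw [gatesQueries_append, gatesQueries_append, gatesQueries_append, gatesQueries_map_control]
    simp [gatesQueries_cons, gatesQueries_nil, Gate.onRegister, Gate.queries, Gate.control]
  · have h1 : gatesMat O gates = Matrix.kroneckerMap (· * ·) (1 : Matrix M M ℂ) (fourier 4 0) *
        (Matrix.blockDiagonal (fun q : Fin 4 =>
          (if decide (q = 1) then (V : Matrix M M ℂ) else 1) *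
            (if decide (q = 0) then gatesMat O gs else 1)) *
        Matrix.kroneckerMap (· * ·) (1 : Matrix M M ℂ) (W : Matrix (Fin 4) (Fin 4) ℂ)) := by
      rw [gatesMat_append, gatesMat_append, gatesMat_append, gatesMat_map_control,
        gatesMat_singleton, gatesMat_singleton, gatesMat_singleton, Gate.mat_control,
        Gate.mat_onRegister, Gate.mat_onRegister, ← Matrix.blockDiagonal_mul]
      rfl
    have hF : ∀ k : Fin 4, fourier 4 0 b k = 1 / 2 * ((-Complex.I) ^ b.val) ^ k.val := by
      intro k
      have h4 : Real.sqrt ((4 : ℕ) : ℝ) = 2 := by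
        rw [show ((4 : ℕ) : ℝ) = 2 ^ 2 by norm_num, Real.sqrt_sq zero_le_two]
      have hI : -Complex.I = Complex.exp (-(Real.pi / 2 * Complex.I)) := by
        rw [Complex.exp_neg, Complex.exp_pi_div_two_mul_I, Complex.inv_I]
      rw [fourier, Matrix.of_apply, h4, hI, ← Complex.exp_nat_mul, ← Complex.exp_nat_mul]
      congr 1
      · norm_num
      · congr 1
        push_cast
        ring
    rw [Circuit.prob, Circuit.state_eq_gatesMat]
    change ‖gatesMat O gates (m, b) (i, 0)‖ ^ 2 = _
    rw [h1, kronecker_block_kronecker_apply]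
    simp only [hW, hF]
    rw [Fin.sum_univ_four]
    have h2 : (1 / 2 * ((-Complex.I) ^ b.val) ^ (0 : Fin 4).val) * gatesMat O gs m i *
        ((Real.sqrt 2 : ℝ) : ℂ)⁻¹ + (1 / 2 * ((-Complex.I) ^ b.val) ^ (1 : Fin 4).val) * v m *
        ((Real.sqrt 2 : ℝ) : ℂ)⁻¹ = (1 / 2 * ((Real.sqrt 2 : ℝ) : ℂ)⁻¹) *
          (gatesMat O gs m i + (-Complex.I) ^ b.val * v m) := by
      simp only [Fin.val_zero, Fin.val_one, pow_zero, pow_one]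
      ring
    have h3 : ‖(1 / 2 * ((Real.sqrt 2 : ℝ) : ℂ)⁻¹)‖ ^ 2 = 1 / 8 := by
      rw [norm_mul, norm_inv, Complex.norm_real, Real.norm_eq_abs, mul_pow, inv_pow, sq_abs,
        Real.sq_sqrt zero_le_two]
      norm_num
    simp only [decide_eq_true_eq, Fin.reduceEq, if_true, if_false, Matrix.one_mul, Matrix.mul_one,
      hV, zero_ne_one, one_ne_zero, Matrix.cons_val, mul_zero, add_zero]
    rw [h2, norm_mul, mul_pow, h3]
    ring

/-- Polarization: opposite phases of the reference cancel the squared moduli and leave the cross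
term. -/
theorem interference_differences (ψ : ℂ) (r : ℝ) :
    ‖ψ + (-Complex.I) ^ 0 * r‖ ^ 2 / 8 - ‖ψ + (-Complex.I) ^ 2 * r‖ ^ 2 / 8 = r * ψ.re / 2 ∧
    ‖ψ + (-Complex.I) ^ 3 * r‖ ^ 2 / 8 - ‖ψ + (-Complex.I) ^ 1 * r‖ ^ 2 / 8 = r * ψ.im / 2 := by
  have h2 : (-Complex.I) ^ 2 = -1 := by rw [neg_sq, Complex.I_sq]
  have h3 : (-Complex.I) ^ 3 = Complex.I := by rw [pow_succ, h2]; ring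
  rw [h2, h3, pow_zero, pow_one]
  simp only [← Complex.normSq_eq_norm_sq, Complex.normSq_apply, Complex.add_re, Complex.add_im,
    Complex.mul_re, Complex.mul_im, Complex.neg_re, Complex.neg_im, Complex.I_re, Complex.I_im,
    Complex.ofReal_re, Complex.ofReal_im, Complex.one_re, Complex.one_im]
  constructor <;> ring

variable [∀ i, Fintype (X i)] [∀ i, DecidableEq (X i)] [Fintype κ]

/-- Recovery of the complex amplitudes when a set `T` that contains all large ones is known. -/
theorem exists_recovery_on_support (gs : List (Gate X M)) (i : M) (label : κ ↪ M) (T : Finset κ)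
    {w δ : ℝ} (hw : 0 < w) (hδ : 0 < δ) {n : ℕ} (hn : 10240 / δ ^ 4 ≤ n) :
    ∃ P : Protocol X (κ → ℂ), P.samples ≤ n ∧ (∀ j, P.circuitQueries j ≤ gatesQueries j gs) ∧
      ∀ O : ∀ i, Matrix (X i) (X i) ℂ, (∀ i, O i ∈ Matrix.unitaryGroup (X i) ℂ) →
        (T.card : ℝ) ≤ (4 / δ) ^ 2 → (∀ k ∉ T, ‖gatesMat O gs (label k) i‖ ≤ δ) →
        9 / 10 ≤ P.prob O fun z => ∀ k, ‖z k - w * gatesMat O gs (label k) i‖ ≤ w * δ := by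
  classical
  -- Without candidates there is no unit reference vector on `T`, but then zero is already a valid
  -- answer everywhere.
  rcases T.eq_empty_or_nonempty with rfl | hT
  · refine ⟨.done 0, Nat.zero_le _, fun j => Nat.zero_le _, fun O hO _ h => ?_⟩
    rw [Protocol.prob, if_pos]
    · norm_num
    · intro k
      rw [Pi.zero_apply, zero_sub, norm_neg, norm_mul, Complex.norm_real, Real.norm_eq_abs,
        abs_of_pos hw]
      exact mul_le_mul_of_nonneg_left (h k (Finset.notMem_empty k)) hw.le
  have hcard : (0 : ℝ) < T.card := by exact_mod_cast hT.card_pos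
  -- The reference is uniform on `T`. The bound on the size of `T` gives `r ≥ δ/4`, which keeps the
  -- final division by `r` affordable.
  set r : ℝ := (Real.sqrt T.card)⁻¹ with hr
  have hr0 : 0 < r := inv_pos.mpr (Real.sqrt_pos.mpr hcard)
  have hr2 : r ^ 2 = (T.card : ℝ)⁻¹ := by rw [hr, inv_pow, Real.sq_sqrt hcard.le]
  obtain ⟨c, lab, hq, hp⟩ := exists_interference_circuit gs i
    (v := fun m => if m ∈ T.map label then (r : ℂ) else 0) (by
      have h : ∀ m, ‖(if m ∈ T.map label then (r : ℂ) else 0)‖ ^ 2 =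
          if m ∈ T.map label then r ^ 2 else 0 := fun m => by
        split_ifs <;> simp
      simp only [h]
      rw [Finset.sum_ite_mem, Finset.univ_inter, Finset.sum_const, Finset.card_map, hr2,
        nsmul_eq_mul, mul_inv_cancel₀ hcard.ne'])
  refine ⟨Protocol.iid c n fun s k => if k ∈ T then (w : ℂ) * (2 / r : ℝ) *
      (((freq s (lab (label k) 0) - freq s (lab (label k) 2) : ℝ) : ℂ) +
        ((freq s (lab (label k) 3) - freq s (lab (label k) 1) : ℝ) : ℂ) * Complex.I) else 0,
    Protocol.samples_iid_le _ _ _, fun j => (Protocol.circuitQueries_iid_le _ _ _ _).trans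
      (hq j).le, fun O hO hTc hsmall => ?_⟩
  -- Frequencies accurate to `δ²/32` give differences up to `δ²/16` and real plus imaginary error
  -- `δ²/8`, which the factor `2/r ≤ 8/δ` turns into `δ`. Failure `1/10` then costs `10 · 32² / δ⁴ =
  -- 10240/δ⁴` samples.
  have hβ : 1 ≤ (1 / 10 : ℝ) * (n * (δ ^ 2 / 32) ^ 2) := by
    rw [div_le_iff₀ (by positivity)] at hn
    calc (1 : ℝ) = 1 / 10240 * 10240 := by norm_num
      _ ≤ 1 / 10240 * (n * δ ^ 4) := by gcongr
      _ = _ := by ring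
  have := Protocol.le_prob_iid (O := O) (c.sum_prob hO) (τ := δ ^ 2 / 32)
    (T := fun z : κ → ℂ => ∀ k, ‖z k - w * gatesMat O gs (label k) i‖ ≤ w * δ)
    (f := fun s k => if k ∈ T then (w : ℂ) * (2 / r : ℝ) *
      (((freq s (lab (label k) 0) - freq s (lab (label k) 2) : ℝ) : ℂ) +
        ((freq s (lab (label k) 3) - freq s (lab (label k) 1) : ℝ) : ℂ) * Complex.I) else 0)
    (by positivity) hβ fun s hs k => ?_
  · exact le_trans (by norm_num) this
  · by_cases hk : k ∈ T
    · simp only [if_pos hk]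
      set ψ := gatesMat O gs (label k) i with hψ
      have hpk : ∀ b : Fin 4, c.prob O (lab (label k) b) =
          ‖ψ + (-Complex.I) ^ b.val * r‖ ^ 2 / 8 := fun b => by
        rw [hp, if_pos (Finset.mem_map_of_mem label hk)]
      have h0 := abs_le.mp (hs (lab (label k) 0))
      have h1 := abs_le.mp (hs (lab (label k) 1))
      have h2 := abs_le.mp (hs (lab (label k) 2))
      have h3 := abs_le.mp (hs (lab (label k) 3))
      rw [show c.prob O (lab (label k) 0) = ‖ψ + (-Complex.I) ^ 0 * r‖ ^ 2 / 8 from hpk 0] at h0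
      rw [show c.prob O (lab (label k) 1) = ‖ψ + (-Complex.I) ^ 1 * r‖ ^ 2 / 8 from hpk 1] at h1
      rw [show c.prob O (lab (label k) 2) = ‖ψ + (-Complex.I) ^ 2 * r‖ ^ 2 / 8 from hpk 2] at h2
      rw [show c.prob O (lab (label k) 3) = ‖ψ + (-Complex.I) ^ 3 * r‖ ^ 2 / 8 from hpk 3] at h3
      obtain ⟨hre, him⟩ := interference_differences ψ r
      set x := freq s (lab (label k) 0) - freq s (lab (label k) 2) with hx
      set y := freq s (lab (label k) 3) - freq s (lab (label k) 1) with hy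
      have hxe : |x - r * ψ.re / 2| ≤ δ ^ 2 / 16 := by
        rw [← hre, abs_le]
        constructor
        · linarith [h0.1, h2.2]
        · linarith [h0.2, h2.1]
      have hye : |y - r * ψ.im / 2| ≤ δ ^ 2 / 16 := by
        rw [← him, abs_le]
        constructor
        · linarith [h3.1, h1.2]
        · linarith [h3.2, h1.1]
      have e : (w : ℂ) * (2 / r : ℝ) * ((x : ℂ) + (y : ℂ) * Complex.I) - w * ψ =
          ((w * (2 / r) : ℝ) : ℂ) * (((x - r * ψ.re / 2 : ℝ) : ℂ) +
            ((y - r * ψ.im / 2 : ℝ) : ℂ) * Complex.I) := by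
        conv_lhs => rw [← Complex.re_add_im ψ]
        have : (r : ℂ) ≠ 0 := by exact_mod_cast hr0.ne'
        push_cast
        field_simp
        ring
      rw [e, norm_mul, Complex.norm_real, Real.norm_eq_abs, abs_of_pos (by positivity), mul_assoc]
      refine mul_le_mul_of_nonneg_left ?_ hw.le
      have hsum : ‖(((x - r * ψ.re / 2 : ℝ) : ℂ) +
          ((y - r * ψ.im / 2 : ℝ) : ℂ) * Complex.I)‖ ≤ δ ^ 2 / 8 := by
        refine (norm_add_le _ _).trans ?_
        rw [norm_mul, Complex.norm_I, mul_one, Complex.norm_real, Complex.norm_real,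
          Real.norm_eq_abs, Real.norm_eq_abs]
        linarith
      have hrinv : 2 / r ≤ 8 / δ := by
        rw [hr, div_inv_eq_mul]
        have : Real.sqrt T.card ≤ 4 / δ := by
          rw [← Real.sqrt_sq (show 0 ≤ 4 / δ by positivity)]
          exact Real.sqrt_le_sqrt hTc
        calc 2 * Real.sqrt T.card ≤ 2 * (4 / δ) := by gcongr
          _ = 8 / δ := by ring
      calc _ ≤ 8 / δ * (δ ^ 2 / 8) := by gcongr
        _ = δ := by field_simp
    · simp only [if_neg hk]
      rw [zero_sub, norm_neg, norm_mul, Complex.norm_real, Real.norm_eq_abs, abs_of_pos hw]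
      exact mul_le_mul_of_nonneg_left (hsmall k hk) hw.le

/-- Estimation of all labelled amplitudes at once. -/
theorem exists_amplitudes_estimate (gs : List (Gate X M)) (i : M) (label : κ ↪ M) {w δ : ℝ}
    (hw : 0 < w) (hδ : 0 < δ) (hδ1 : δ < 1) :
    ∃ P : Protocol X (κ → ℂ), (P.samples : ℝ) ≤ 13000 / δ ^ 4 ∧
      (∀ j, P.circuitQueries j ≤ gatesQueries j gs) ∧
      ∀ O : ∀ i, Matrix (X i) (X i) ℂ, (∀ i, O i ∈ Matrix.unitaryGroup (X i) ℂ) →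
        2 / 3 ≤ P.prob O fun z => ∀ k, ‖z k - w * gatesMat O gs (label k) i‖ ≤ w * δ := by
  classical
  have hrec : ∀ T : Finset κ, _ := fun T =>
    exists_recovery_on_support gs i label T hw hδ (Nat.le_ceil (10240 / δ ^ 4))
  choose P hPs hPq hP using hrec
  -- Moduli up to `δ/4` with failure `1/10`: `10 · 4⁴ = 2560`.
  set n := ⌈2560 / δ ^ 4⌉₊ with hn
  set c : Circuit X := ⟨M, i, gs⟩ with hc
  set Q : Protocol X (κ → ℝ) :=
    Protocol.iid c n fun s k => 1 * Real.sqrt (freq s (label k)) with hQ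
  -- With moduli known to `δ/4`, thresholding at `δ/2` keeps only true moduli of at least `δ/4` and
  -- drops only those of at most `3δ/4`.
  refine ⟨Q.bind fun z => P (Finset.univ.filter fun k => δ / 2 < z k), ?_, fun j => ?_,
    fun O hO => ?_⟩
  · have h1 := Protocol.samples_bind_le Q fun z : κ → ℝ =>
      hPs (Finset.univ.filter fun k => δ / 2 < z k)
    have h2 : Q.samples ≤ n := Protocol.samples_iid_le _ _ _
    have h3 := (Nat.ceil_lt_add_one (a := 2560 / δ ^ 4) (by positivity)).le
    have h4 := (Nat.ceil_lt_add_one (a := 10240 / δ ^ 4) (by positivity)).le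
    have h5 : (1 : ℝ) ≤ 1 / δ ^ 4 := by
      rw [le_div_iff₀ (by positivity), one_mul]
      exact pow_le_one₀ hδ.le hδ1.le
    calc _ ≤ ((n + ⌈10240 / δ ^ 4⌉₊ : ℕ) : ℝ) := by
          exact_mod_cast h1.trans (Nat.add_le_add_right h2 _)
      _ ≤ (2560 / δ ^ 4 + 1 / δ ^ 4) + (10240 / δ ^ 4 + 1 / δ ^ 4) := by
          push_cast
          linarith
      _ = 12802 / δ ^ 4 := by ring
      _ ≤ 13000 / δ ^ 4 := by gcongr; norm_num
  · exact Protocol.circuitQueries_bind_le j Q (Protocol.circuitQueries_iid_le _ _ _ _)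
      fun z => hPq _ j
  · have hβ : 1 ≤ (1 / 10 : ℝ) * (n * (δ / 4) ^ 4) := by
      have := Nat.le_ceil (2560 / δ ^ 4)
      rw [← hn, div_le_iff₀ (by positivity)] at this
      calc (1 : ℝ) = 1 / 2560 * 2560 := by norm_num
        _ ≤ 1 / 2560 * (n * δ ^ 4) := by gcongr
        _ = _ := by ring
    have h1 := le_prob_iid_magnitudes (c.sum_prob hO) label zero_le_one
      (show 0 < δ / 4 by positivity) hβ
    have hst : ∀ m, c.state O m = gatesMat O gs m i := fun m => c.state_eq_gatesMat O m
    simp only [hst, one_mul] at h1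
    have h2 := Protocol.prob_mul_le_prob_bind O Q
      (Q := fun z => ∀ k, |z k - ‖gatesMat O gs (label k) i‖| ≤ δ / 4)
      (T := fun z => ∀ k, ‖z k - w * gatesMat O gs (label k) i‖ ≤ w * δ) (b := 9 / 10)
      (f := fun z => P (Finset.univ.filter fun k => δ / 2 < z k)) fun z hz => ?_
    · refine le_trans ?_ h2
      have h3 : (9 / 10 : ℝ) ≤ Q.prob O
          (fun z => ∀ k, |z k - ‖gatesMat O gs (label k) i‖| ≤ δ / 4) := by
        refine le_trans (by norm_num) (h1.trans (le_of_eq ?_))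
        simp only [hQ, one_mul]
      linarith
    · refine hP _ O hO ?_ fun k hk => ?_
      · set T := Finset.univ.filter fun k => δ / 2 < z k with hT
        -- Every selected amplitude contributes at least `(δ/4)²` to a state of norm one, and
        -- distinct labels are distinct basis states; this bounds the size of `T`.
        have h3 : ∑ k ∈ T, (δ / 4) ^ 2 ≤ 1 := by
          calc ∑ k ∈ T, (δ / 4) ^ 2 ≤ ∑ k ∈ T, ‖gatesMat O gs (label k) i‖ ^ 2 := by
                refine Finset.sum_le_sum fun k hk => ?_
                have h4 := (Finset.mem_filter.mp hk).2
                have h5 := (abs_le.mp (hz k)).2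
                gcongr
                linarith
            _ = ∑ m ∈ T.map label, ‖gatesMat O gs m i‖ ^ 2 := by rw [Finset.sum_map]
            _ ≤ ∑ m, ‖gatesMat O gs m i‖ ^ 2 :=
                Finset.sum_le_univ_sum_of_nonneg fun m => sq_nonneg _
            _ = 1 := sum_norm_sq_column (gatesMat_mem_unitaryGroup hO gs) i
        rw [Finset.sum_const, nsmul_eq_mul] at h3
        have h6 : (4 / δ) ^ 2 = 1 / (δ / 4) ^ 2 := by field_simp
        rw [h6, le_div_iff₀ (by positivity)]
        exact h3
      · have h4 : z k ≤ δ / 2 := by simpa using hk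
        have h5 := (abs_le.mp (hz k)).1
        linarith

end Recovery

end GQPE

namespace GQPE

/-! ### The estimators for the correlation function -/

section Complexity

variable {D : ℕ} {S : Type} [Fintype S] [DecidableEq S] {s0 : S}
  {A : Fin (D + 1) → Type} [∀ j, Fintype (A j)] [∀ j, DecidableEq (A j)] {a0 : ∀ j, A j}
  {ν : Fin (D + 1) → ℝ}

theorem gridPoint_zero {N : ℕ} (hN : 0 < N) :
    gridPoint N (fun _ : Fin D => (⟨0, hN⟩ : Fin N)) = 0 := by
  funext j
  simp [gridPoint]

theorem IsWindow.pos {N : ℕ} {α : Fin N → ℂ} (hα : IsWindow α) : 0 < N := by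
  rcases Nat.eq_zero_or_pos N with rfl | h
  · simp [IsWindow] at hα
  · exact h

/-- `R(ω)/Ω` is an entry of a unitary matrix. The bound settles the case `Ω ≤ ε`, where the estimate
`0` costs nothing. -/
theorem System.norm_R_le (σ : System D S s0 A a0 ν) (hν : ∀ j, 0 < ν j) {N : ℕ} {α : Fin N → ℂ}
    (hα : IsWindow α) (ω : Fin D → ℝ) : ‖σ.R α ω‖ ≤ ∏ j, ν j := by
  obtain ⟨gs, -, -, -, h⟩ := exists_gates_correlation hα.pos hα S s0 A a0 ν ω
  have hΩ : 0 < ∏ j, ν j := Finset.prod_pos fun j _ => hν j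
  have h1 := entry_norm_bound_of_unitary (gatesMat_mem_unitaryGroup σ.oracle_mem_unitaryGroup gs)
    ((a0, s0), fun _ => ⟨0, hα.pos⟩) ((a0, s0), fun _ => ⟨0, hα.pos⟩)
  rw [h, gridPoint_zero, add_zero, norm_div, Complex.norm_real, Real.norm_eq_abs, abs_of_pos hΩ,
    div_le_one hΩ] at h1
  exact h1

variable {ε : ℝ} {N : ℕ} {α : Fin N → ℂ}

/-- Estimation of the correlation function at a single point. -/
theorem exists_single_point_estimate : ∃ K₁ : ℝ, 0 < K₁ ∧ ∀ (D : ℕ) (ε : ℝ), 0 < ε →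
    ∀ (N : ℕ) (α : Fin N → ℂ), IsWindow α →
    ∀ (S : Type) [Fintype S] [DecidableEq S] (s0 : S)
      (A : Fin (D + 1) → Type) [∀ j, Fintype (A j)] [∀ j, DecidableEq (A j)] (a0 : ∀ j, A j)
      (ν : Fin (D + 1) → ℝ), (∀ j, 0 < ν j) → ∀ ω : Fin D → ℝ,
    ∃ P : Protocol (Reg S A) ℂ, P.samples ≤ 2 ∧
      (P.totalQueries .evo : ℝ) ≤ K₁ * ((∏ j, ν j) / ε) * (2 * D * N) ∧
      (P.totalQueries .prep : ℝ) ≤ K₁ * ((∏ j, ν j) / ε) * 2 ∧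
      (∀ j, (P.totalQueries (.block j) : ℝ) ≤ K₁ * ((∏ j, ν j) / ε)) ∧
      ∀ σ : System D S s0 A a0 ν, 2 / 3 ≤ P.prob σ.oracle fun z => ‖z - σ.R α ω‖ ≤ ε := by
  obtain ⟨K₁, hK₁, hest⟩ := exists_amplitude_estimate
  refine ⟨K₁, hK₁, fun D ε hε N α hα S _ _ s0 A _ _ a0 ν hν ω => ?_⟩
  have hΩ : 0 < ∏ j, ν j := Finset.prod_pos fun j _ => hν j
  set Ω := ∏ j, ν j with hΩdef
  -- In the second case `ε/Ω < 1` is an admissible precision for the amplitude, and rescaling by `Ω`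
  -- returns error `ε`.
  rcases le_or_gt Ω ε with hle | hlt
  · refine ⟨.done 0, Nat.zero_le _, ?_, ?_, fun j => ?_, fun σ => ?_⟩
    · rw [Protocol.totalQueries, Nat.cast_zero]; positivity
    · rw [Protocol.totalQueries, Nat.cast_zero]; positivity
    · rw [Protocol.totalQueries, Nat.cast_zero]; positivity
    · rw [Protocol.prob, if_pos]
      · norm_num
      · rw [zero_sub, norm_neg]
        exact (σ.norm_R_le hν hα ω).trans hle
  · obtain ⟨gs, hq1, hq2, hq3, hgs⟩ := exists_gates_correlation hα.pos hα S s0 A a0 ν ω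
    obtain ⟨P, hs, hq, hP⟩ := hest (Oracle D) (Reg S A) _ gs ((a0, s0), fun _ => ⟨0, hα.pos⟩) Ω
      (ε / Ω) hΩ (by positivity) ((div_lt_one hΩ).mpr hlt)
    have hdiv : K₁ / (ε / Ω) = K₁ * (Ω / ε) := by field_simp
    rw [hdiv] at hq
    refine ⟨P, hs, ?_, ?_, fun j => ?_, fun σ => ?_⟩
    · have := hq .evo
      rw [hq1] at this
      exact_mod_cast this
    · have := hq .prep
      rw [hq2] at this
      exact_mod_cast this
    · have := hq (.block j)
      rw [hq3 j, Nat.cast_one, mul_one] at this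
      exact this
    · have h := hP σ.oracle σ.oracle_mem_unitaryGroup
      have hΩc : (Ω : ℂ) ≠ 0 := by exact_mod_cast hΩ.ne'
      rwa [hgs, gridPoint_zero, add_zero, mul_div_cancel₀ _ hΩ.ne', mul_div_cancel₀ _ hΩc] at h

/-- The circuit that encodes all grid values, and the estimation of their absolute values. -/
theorem exists_grid_circuit (hε : 0 < ε) (hα : IsWindow α) (hν : ∀ j, 0 < ν j) :
    ∃ (c : Circuit (Reg S A)) (label : (Fin D → Fin N) ↪ c.M)
      (n : ℕ) (f : (Fin n → c.M) → (Fin D → Fin N) → ℝ),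
      c.queries .evo = 2 * D * N ∧ c.queries .prep = 2 ∧ (∀ j, c.queries (.block j) = 1) ∧
      (n : ℝ) ≤ 4 * ((∏ j, ν j) ^ 4 / ε ^ 4) ∧
      ∀ σ : System D S s0 A a0 ν,
        (∀ k, c.state σ.oracle (label k) = σ.R α (gridPoint N k) / ((∏ j, ν j : ℝ) : ℂ)) ∧
        2 / 3 ≤ (Protocol.iid c n f).prob σ.oracle
          fun z => ∀ k, |z k - ‖σ.R α (gridPoint N k)‖| ≤ ε := by
  have hΩ : 0 < ∏ j, ν j := Finset.prod_pos fun j _ => hν j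
  obtain ⟨gs, hq1, hq2, hq3, hgs⟩ := exists_gates_correlation hα.pos hα S s0 A a0 ν 0
  set Ω := ∏ j, ν j with hΩdef
  let c : Circuit (Reg S A) := ⟨_, ((a0, s0), fun _ => ⟨0, hα.pos⟩), gs⟩
  let label : (Fin D → Fin N) ↪ c.M := ⟨fun k => ((a0, s0), k), fun k k' h => (Prod.ext_iff.mp h).2⟩
  have hst : ∀ (σ : System D S s0 A a0 ν) k,
      c.state σ.oracle (label k) = σ.R α (gridPoint N k) / (Ω : ℂ) := fun σ k => by
    rw [Circuit.state_eq_gatesMat]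
    refine (hgs σ k).trans ?_
    rw [zero_add]
  rcases le_or_gt Ω ε with hle | hlt
  · refine ⟨c, label, 0, fun _ _ => 0, hq1, hq2, hq3, ?_, fun σ => ⟨hst σ, ?_⟩⟩
    · rw [Nat.cast_zero]
      positivity
    · rw [Protocol.iid, Protocol.prob, if_pos]
      · norm_num
      · intro k
        rw [zero_sub, abs_neg, abs_of_nonneg (norm_nonneg _)]
        exact (σ.norm_R_le hν hα _).trans hle
  -- The factor `3` corresponds to failure probability `1/3`; the rounding is absorbed into `4`
  -- because `Ω/ε > 1` here.
  · set n := ⌈3 * (Ω ^ 4 / ε ^ 4)⌉₊ with hn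
    refine ⟨c, label, n, fun s k => Ω * Real.sqrt (freq s (label k)), hq1, hq2, hq3, ?_,
      fun σ => ⟨hst σ, ?_⟩⟩
    · have h1 := (Nat.ceil_lt_add_one (a := 3 * (Ω ^ 4 / ε ^ 4)) (by positivity)).le
      have h2 : 1 ≤ Ω ^ 4 / ε ^ 4 := by
        rw [le_div_iff₀ (by positivity), one_mul]
        gcongr
      linarith
    · have hβ : 1 ≤ (1 / 3 : ℝ) * (n * (ε / Ω) ^ 4) := by
        have h1 := Nat.le_ceil (3 * (Ω ^ 4 / ε ^ 4))
        rw [← hn] at h1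
        calc (1 : ℝ) = 1 / 3 * (3 * (Ω ^ 4 / ε ^ 4) * (ε / Ω) ^ 4) := by field_simp
          _ ≤ _ := by gcongr
      have h := le_prob_iid_magnitudes (c.sum_prob σ.oracle_mem_unitaryGroup) label hΩ.le
        (show 0 < ε / Ω by positivity) hβ
      have hnorm : ∀ k, Ω * ‖c.state σ.oracle (label k)‖ = ‖σ.R α (gridPoint N k)‖ := fun k => by
        rw [hst, norm_div, Complex.norm_real, Real.norm_eq_abs, abs_of_pos hΩ,
          mul_div_cancel₀ _ hΩ.ne']
      simp only [hnorm, mul_div_cancel₀ _ hΩ.ne'] at h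
      linarith

/-- The estimation of all complex grid values. -/
theorem exists_grid_estimate (hε : 0 < ε) (hα : IsWindow α) (hν : ∀ j, 0 < ν j) :
    ∃ P : Protocol (Reg S A) ((Fin D → Fin N) → ℂ),
      (P.samples : ℝ) ≤ 13000 * ((∏ j, ν j) ^ 4 / ε ^ 4) ∧
      P.circuitQueries .evo ≤ 2 * D * N ∧ P.circuitQueries .prep ≤ 2 ∧
      (∀ j, P.circuitQueries (.block j) ≤ 1) ∧
      ∀ σ : System D S s0 A a0 ν, 2 / 3 ≤ P.prob σ.oracle
        fun z => ∀ k, ‖z k - σ.R α (gridPoint N k)‖ ≤ ε := by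
  have hΩ : 0 < ∏ j, ν j := Finset.prod_pos fun j _ => hν j
  obtain ⟨gs, hq1, hq2, hq3, hgs⟩ := exists_gates_correlation hα.pos hα S s0 A a0 ν 0
  set Ω := ∏ j, ν j with hΩdef
  rcases le_or_gt Ω ε with hle | hlt
  · refine ⟨.done 0, ?_, Nat.zero_le _, Nat.zero_le _, fun j => Nat.zero_le _, fun σ => ?_⟩
    · rw [Protocol.samples, Nat.cast_zero]
      positivity
    · rw [Protocol.prob, if_pos]
      · norm_num
      · intro k
        rw [Pi.zero_apply, zero_sub, norm_neg]
        exact (σ.norm_R_le hν hα _).trans hle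
  · let label : (Fin D → Fin N) ↪ SysMem S A × (Fin D → Fin N) :=
      ⟨fun k => ((a0, s0), k), fun k k' h => (Prod.ext_iff.mp h).2⟩
    obtain ⟨P, hs, hq, hP⟩ := exists_amplitudes_estimate gs ((a0, s0), fun _ => ⟨0, hα.pos⟩) label
      hΩ (show 0 < ε / Ω by positivity) ((div_lt_one hΩ).mpr hlt)
    refine ⟨P, hs.trans (le_of_eq (by field_simp)), hq1 ▸ hq _, hq2 ▸ hq _, fun j => hq3 j ▸ hq _,
      fun σ => ?_⟩
    have h := hP σ.oracle σ.oracle_mem_unitaryGroup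
    have hval : ∀ k, (Ω : ℂ) * gatesMat σ.oracle gs (label k) ((a0, s0), fun _ => ⟨0, hα.pos⟩) =
        σ.R α (gridPoint N k) := fun k => by
      have hΩc : (Ω : ℂ) ≠ 0 := by exact_mod_cast hΩ.ne'
      refine (congrArg ((Ω : ℂ) * ·) (hgs σ k)).trans ?_
      rw [zero_add]
      exact mul_div_cancel₀ _ hΩc
    simp only [hval, mul_div_cancel₀ _ hΩ.ne'] at h
    exact h

end Complexity

end GQPE

/-! ### Assembly of the bounds -/

theorem theorem1 :
    -- windows of resolution `η` with `Õ(1/η)` coefficients exist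
    (∃ K : ℝ, 0 < K ∧ ∀ (D : ℕ) (η ε : ℝ), 1 ≤ D → 0 < η → η < 1 → 0 < ε → ε < 1 →
      ∃ (q : ℕ) (α : Fin (2 ^ q) → ℂ), GQPE.IsWindow α ∧
        ((2 ^ q : ℕ) : ℝ) ≤ K * Real.log (2 * D / ε) / η ∧ GQPE.Resolves α η (ε / D)) ∧
    -- the complexities, for every window with `Õ(1/η)` coefficients
    (∀ K : ℝ, 0 < K → ∃ C : ℝ, 0 < C ∧ ∀ (D : ℕ) (η ε : ℝ),
      1 ≤ D → 0 < η → η < 1 → 0 < ε → ε < 1 →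
      ∀ (N : ℕ) (α : Fin N → ℂ), GQPE.IsWindow α → (N : ℝ) ≤ K * Real.log (2 * D / ε) / η →
      ∀ (S : Type) [Fintype S] [DecidableEq S] (s0 : S)
        (A : Fin (D + 1) → Type) [∀ j, Fintype (A j)] [∀ j, DecidableEq (A j)] (a0 : ∀ j, A j)
        (ν : Fin (D + 1) → ℝ), (∀ j, 0 < ν j) →
      -- (1) a single frequency point
      (∀ ω : Fin D → ℝ, ∃ P : GQPE.Protocol (GQPE.Reg S A) ℂ,
        (P.samples : ℝ) ≤ C ∧
        (P.totalQueries .evo : ℝ) ≤ C * (D * (∏ j, ν j) / (η * ε)) * Real.log (2 * D / ε) ∧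
        (P.totalQueries .prep : ℝ) ≤ C * ((∏ j, ν j) / ε) ∧
        (∀ j, (P.totalQueries (.block j) : ℝ) ≤ C * ((∏ j, ν j) / ε)) ∧
        ∀ σ : GQPE.System D S s0 A a0 ν,
          2 / 3 ≤ P.prob σ.oracle (fun z => ‖z - σ.R α ω‖ ≤ ε)) ∧
      -- (2) all frequency points at once: the circuit that encodes `R` in its amplitudes ...
      (∃ (c : GQPE.Circuit (GQPE.Reg S A)) (label : (Fin D → Fin N) ↪ c.M)
          (n : ℕ) (f : (Fin n → c.M) → (Fin D → Fin N) → ℝ),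
        (c.queries .evo : ℝ) ≤ C * (D / η) * Real.log (2 * D / ε) ∧
        (c.queries .prep : ℝ) ≤ C ∧
        (∀ j, (c.queries (.block j) : ℝ) ≤ C) ∧
        (n : ℝ) ≤ C * ((∏ j, ν j) ^ 4 / ε ^ 4) ∧
        ∀ σ : GQPE.System D S s0 A a0 ν,
          (∀ k, c.state σ.oracle (label k) =
            σ.R α (GQPE.gridPoint N k) / ((∏ j, ν j : ℝ) : ℂ)) ∧
          2 / 3 ≤ (GQPE.Protocol.iid c n f).prob σ.oracle
            (fun z => ∀ k, |z k - ‖σ.R α (GQPE.gridPoint N k)‖| ≤ ε)) ∧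
      -- ... and the recovery of the complex values
      (∃ P : GQPE.Protocol (GQPE.Reg S A) ((Fin D → Fin N) → ℂ),
        (P.samples : ℝ) ≤ C * ((∏ j, ν j) ^ 4 / ε ^ 4) ∧
        (P.circuitQueries .evo : ℝ) ≤ C * (D / η) * Real.log (2 * D / ε) ∧
        (P.circuitQueries .prep : ℝ) ≤ C ∧
        (∀ j, (P.circuitQueries (.block j) : ℝ) ≤ C) ∧
        (P.totalQueries .evo : ℝ) ≤
          C * (D * (∏ j, ν j) ^ 4 / (η * ε ^ 4)) * Real.log (2 * D / ε) ∧
        (P.totalQueries .prep : ℝ) ≤ C * ((∏ j, ν j) ^ 4 / ε ^ 4) ∧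
        (∀ j, (P.totalQueries (.block j) : ℝ) ≤ C * ((∏ j, ν j) ^ 4 / ε ^ 4)) ∧
        ∀ σ : GQPE.System D S s0 A a0 ν,
          2 / 3 ≤ P.prob σ.oracle (fun z => ∀ k, ‖z k - σ.R α (GQPE.gridPoint N k)‖ ≤ ε))) := by
  refine ⟨?_, fun K hK => ?_⟩
  · obtain ⟨K, hK, h⟩ := GQPE.exists_short_window_resolves
    refine ⟨K, hK, fun D η ε hD hη hη1 hε hε1 => ?_⟩
    have hD1 : (1 : ℝ) ≤ D := by exact_mod_cast hD
    have hδ1 : ε / D < 1 := by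
      rw [div_lt_one (by linarith)]
      linarith
    obtain ⟨q, α, hα, hN, hres⟩ := h η (ε / D) hη hη1 (by positivity) hδ1
    rw [div_div_eq_mul_div] at hN
    exact ⟨q, α, hα, by simpa using hN, hres⟩
  · obtain ⟨K₁, hK₁, h1⟩ := GQPE.exists_single_point_estimate
    -- `K` enters through the window length, `K₁` through amplitude estimation, and `26000 = 13000 ·
    -- 2` through sample count times queries per circuit; the product dominates all combinations
    -- that occur.
    obtain ⟨C, hC⟩ : ∃ C : ℝ, C = 26000 * (1 + K) * (1 + K₁) := ⟨_, rfl⟩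
    have hKK := mul_pos hK hK₁
    have hC2 : 2 ≤ C := by nlinarith
    have hCK : 2 * K ≤ C := by nlinarith
    have hCK₁ : 2 * K₁ ≤ C := by nlinarith
    have hCK₁' : K₁ ≤ C := by nlinarith
    have hCKK : 2 * (K * K₁) ≤ C := by nlinarith
    have hC26 : 26000 ≤ C := by nlinarith
    have hCK26 : 26000 * K ≤ C := by nlinarith
    have hC13 : 13000 ≤ C := by linarith
    have hC4 : 4 ≤ C := by linarith
    refine ⟨C, by linarith, ?_⟩
    intro D η ε hD hη hη1 hε hε1 N α hα hN S _ _ s0 A _ _ a0 ν hν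
    have hD1 : (1 : ℝ) ≤ D := by exact_mod_cast hD
    have hΩ : 0 < ∏ j, ν j := Finset.prod_pos fun j _ => hν j
    set Ω := ∏ j, ν j with hΩdef
    set l := Real.log (2 * D / ε) with hl
    have hl0 : 0 < l := Real.log_pos (by
      rw [lt_div_iff₀ hε]
      linarith)
    have hevo : (2 : ℝ) * D * N ≤ 2 * K * (D / η) * l := by
      calc (2 : ℝ) * D * N ≤ 2 * D * (K * l / η) := by gcongr
        _ = _ := by ring
    have hCevo : 2 * K * (D / η) * l ≤ C * (D / η) * l := by gcongr
    refine ⟨fun ω => ?_, ?_, ?_⟩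
    · obtain ⟨P, hs, hq1, hq2, hq3, hP⟩ := h1 D ε hε N α hα S s0 A a0 ν hν ω
      refine ⟨P, le_trans (by exact_mod_cast hs) hC2, hq1.trans ?_, hq2.trans ?_,
        fun j => (hq3 j).trans ?_, hP⟩
      · calc K₁ * (Ω / ε) * (2 * D * N) ≤ K₁ * (Ω / ε) * (2 * K * (D / η) * l) := by gcongr
          _ = 2 * (K * K₁) * (D * Ω / (η * ε)) * l := by field_simp
          _ ≤ _ := by gcongr
      · calc K₁ * (Ω / ε) * 2 = 2 * K₁ * (Ω / ε) := by ring
          _ ≤ _ := by gcongr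
      · gcongr
    · obtain ⟨c, label, n, f, hq1, hq2, hq3, hn, hc⟩ :=
        GQPE.exists_grid_circuit (S := S) (A := A) (a0 := a0) (s0 := s0) hε hα hν
      refine ⟨c, label, n, f, ?_, ?_, fun j => ?_, hn.trans ?_, hc⟩
      · rw [hq1]
        push_cast
        exact hevo.trans hCevo
      · rw [hq2]
        exact_mod_cast hC2
      · rw [hq3]
        push_cast
        linarith
      · gcongr
    · obtain ⟨P, hs, hq1, hq2, hq3, hP⟩ :=
        GQPE.exists_grid_estimate (S := S) (A := A) (a0 := a0) (s0 := s0) hε hα hν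
      have hq1' : (P.circuitQueries .evo : ℝ) ≤ 2 * K * (D / η) * l :=
        le_trans (by exact_mod_cast hq1) hevo
      have hq2' : (P.circuitQueries .prep : ℝ) ≤ 2 := by exact_mod_cast hq2
      have hq3' : ∀ j, (P.circuitQueries (.block j) : ℝ) ≤ 2 := fun j => by
        have : (P.circuitQueries (.block j) : ℝ) ≤ 1 := by exact_mod_cast hq3 j
        linarith
      have htot : ∀ i, (P.totalQueries i : ℝ) ≤ P.samples * P.circuitQueries i := fun i => by
        exact_mod_cast P.totalQueries_le i
      have htwo : 13000 * (Ω ^ 4 / ε ^ 4) * 2 ≤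
          C * (Ω ^ 4 / ε ^ 4) := by
        calc 13000 * (Ω ^ 4 / ε ^ 4) * 2 = 26000 * (Ω ^ 4 / ε ^ 4) := by ring
          _ ≤ _ := by gcongr
      refine ⟨P, hs.trans ?_, hq1'.trans hCevo, hq2'.trans hC2, fun j => (hq3' j).trans hC2,
        (htot _).trans ?_, (htot _).trans ?_, fun j => (htot _).trans ?_, hP⟩
      · gcongr
      · calc (P.samples : ℝ) * P.circuitQueries .evo
            ≤ 13000 * (Ω ^ 4 / ε ^ 4) * (2 * K * (D / η) * l) := by gcongr
          _ = 26000 * K * (D * Ω ^ 4 / (η * ε ^ 4)) * l := by field_simp; ring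
          _ ≤ _ := by gcongr
      · refine le_trans ?_ htwo
        gcongr
      · refine le_trans ?_ htwo
        gcongr
        exact hq3' j
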